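/- **Green's identity for $\operatorname{div}\operatorname{div}$ in 3D.** Let $K\subset\mathbb R^3$ be a polyhedron, that is, a bounded open set with Lipschitz boundary such that $\partial K$ is contained in a finite union of planes. Let $\mathcal F(K)$ be the (finite) set of its faces, and for each $F\in\mathcal F(K)$ let $\mathcal E(F)$ be the (finite) set of its edges. On a face $F$ let $\boldsymbol n$ be the unit normal vector outward to $\partial K$; for $e\in\mathcal E(F)$ let $\boldsymbol n_{F,e}$ be the unit vector parallel to $F$ and outward normal to $\partial F$ on $e$. Let $(\cdot,\cdot)_D$ be the $L^2$ inner product on $D=K$, $F$ or $e$ (with respect to volume, area and length), let $\mathbb S$ be the space of symmetric $3\times 3$ real matrices, and set $\operatorname{div}\operatorname{div}\boldsymbol\tau=\sum_{i,j}\partial_i\partial_j\tau_{ij}$ and, for a vector field $\boldsymbol w$, $\operatorname{div}_F\boldsymbol w=\big((I-\boldsymbol n\boldsymbol n^{\intercal})\nabla\big)\cdot\boldsymbol w$. Let $\boldsymbol\tau:\overline K\to\mathbb S$ be of class $C^2$ up to the boundary of $K$, and let $v\in H^2(K)$. Then the traces in $L^2$ of $v$ and of $\partial_n v=\boldsymbol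 n\cdot\nabla v$ on each face $F\in\mathcal F(K)$, and of $v$ on each edge $e\in\mathcal E(F)$, exist (as limits of the restrictions of smooth functions that converge to $v$ in $H^2(K)$), and $$ \begin{aligned} (\operatorname{div}\operatorname{div}\boldsymbol\tau, v)_K={}&(\boldsymbol\tau,\nabla^2 v)_K-\sum_{F\in\mathcal F(K)}\sum_{e\in\mathcal E(F)}(\boldsymbol n_{F,e}^{\intercal}\boldsymbol\tau\boldsymbol n, v)_e\\ &-\sum_{F\in\mathcal F(K)}\Big[(\boldsymbol n^{\intercal}\boldsymbol\tau\boldsymbol n,\partial_n v)_F-\big(2\operatorname{div}_F(\boldsymbol\tau\boldsymbol n)+\partial_n(\boldsymbol n^{\intercal}\boldsymbol\tau\boldsymbol n), v\big)_F\Big]. \end{aligned} $$ -/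

import Mathlib

open MeasureTheory Filter Topology
open scoped ContDiff ENNReal NNReal

namespace DivDivGreen

/-- Three-dimensional Euclidean space. -/
abbrev R3 : Type := EuclideanSpace ℝ (Fin 3)

/-- The `i`-th standard unit vector. -/
noncomputable def basisVec (i : Fin 3) : R3 := EuclideanSpace.single i 1

section Geometry

/-- `K` is locally, near each of its boundary points, the strict subgraph of a Lipschitz function
over a plane: after a rotation the "vertical" direction is `ν`, the height of `y` is `⟪ν, y⟫`, and
its projection to the plane through the origin orthogonal to `ν` is `y - ⟪ν, y⟫ ν`. -/
def HasLipschitzBoundary (K : Set R3) : Prop :=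
  ∀ x₀ ∈ frontier K, ∃ ν : R3, ‖ν‖ = 1 ∧ ∃ (L : ℝ≥0) (f : R3 → ℝ), LipschitzWith L f ∧
    ∃ r > 0, ∀ y ∈ Metric.ball x₀ r, (y ∈ K ↔ inner ℝ ν y < f (y - inner ℝ ν y • ν))

/-- A polyhedron (without its boundary): a bounded open set with Lipschitz boundary, the boundary
being covered by finitely many planes. It may be non-convex. -/
structure IsPolyhedron (K : Set R3) : Prop where
  isOpen : IsOpen K
  isBounded : Bornology.IsBounded K
  lipschitz : HasLipschitzBoundary K
  planar : ∃ P : Finset (R3 × ℝ), (∀ p ∈ P, p.1 ≠ 0) ∧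
    ∀ x ∈ frontier K, ∃ p ∈ P, inner ℝ p.1 x = p.2

/-- The boundary points of `K` in the plane `⟪n, x⟫ = c` near which `K` is the half-space
`⟪n, y⟫ < c`; for a unit vector `n` this says that `n` is the outward unit normal there. -/
def flatPart (K : Set R3) (n : R3) (c : ℝ) : Set R3 :=
  {x | inner ℝ n x = c ∧ ∃ r > 0, ∀ y ∈ Metric.ball x r, (y ∈ K ↔ inner ℝ n y < c)}

/-- A face of `K` (without its relative boundary), with its outward unit normal `normal`: a
connected component of the part of the boundary that is flat with this normal and level. -/
structure Face (K : Set R3) where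
  normal : R3
  level : ℝ
  carrier : Set R3
  norm_normal : ‖normal‖ = 1
  isComponent : ∃ x ∈ flatPart K normal level,
    carrier = connectedComponentIn (flatPart K normal level) x

/-- The relative boundary points of the face `F` on the line `⟪m, x⟫ = d` of its plane, near which
`F` is the half-plane `⟪m, y⟫ < d`; for a unit vector `m` parallel to `F` this says that `m` is the
unit vector parallel to `F` and outward normal to the relative boundary of `F` there. -/
def straightPart {K : Set R3} (F : Face K) (m : R3) (d : ℝ) : Set R3 :=
  {x | inner ℝ F.normal x = F.level ∧ inner ℝ m x = d ∧
    ∃ r > 0, ∀ y ∈ Metric.ball x r, inner ℝ F.normal y = F.level →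
      (y ∈ F.carrier ↔ inner ℝ m y < d)}

/-- An edge of the face `F` (without its end points), with the unit vector `conormal` that is
parallel to `F` and outward normal to the relative boundary of `F` on this edge. -/
structure Edge {K : Set R3} (F : Face K) where
  conormal : R3
  level : ℝ
  carrier : Set R3
  norm_conormal : ‖conormal‖ = 1
  parallel : inner ℝ F.normal conormal = 0
  isComponent : ∃ x ∈ straightPart F conormal level,
    carrier = connectedComponentIn (straightPart F conormal level) x

/-- Surface measure on a face. -/
noncomputable def Face.area {K : Set R3} (F : Face K) : Measure R3 :=
  (μHE[2] : Measure R3).restrict F.carrier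

/-- Length measure on an edge. -/
noncomputable def Edge.length {K : Set R3} {F : Face K} (e : Edge F) : Measure R3 :=
  (μHE[1] : Measure R3).restrict e.carrier

end Geometry

section Derivatives

/-- The derivative of `f` at `x` in direction `w`, for functions that are differentiable up to the
boundary of `K`. -/
noncomputable def dirDeriv (K : Set R3) (w : R3) (f : R3 → ℝ) (x : R3) : ℝ :=
  fderivWithin ℝ f (closure K) x w

/-- A tensor field that is symmetric and `C²` up to the boundary of `K`. -/
structure IsC2Sym (K : Set R3) (τ : R3 → Matrix (Fin 3) (Fin 3) ℝ) : Prop where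
  contDiffOn : ∀ i j, ContDiffOn ℝ 2 (fun x => τ x i j) (closure K)
  symm : ∀ x ∈ closure K, (τ x).IsSymm

/-- `div div τ = ∑ i j, ∂ᵢ ∂ⱼ τᵢⱼ`. -/
noncomputable def divDiv (K : Set R3) (τ : R3 → Matrix (Fin 3) (Fin 3) ℝ) (x : R3) : ℝ :=
  ∑ i, ∑ j, dirDeriv K (basisVec i) (dirDeriv K (basisVec j) fun y => τ y i j) x

/-- The bilinear form `aᵀ A b`. -/
def bilin (A : Matrix (Fin 3) (Fin 3) ℝ) (a b : R3) : ℝ :=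
  ∑ i, ∑ j, a i * A i j * b j

/-- Surface divergence on a plane with unit normal `n`: `div_F w = ∇_F · w` with
`∇_F = (I - n nᵀ) ∇`. -/
noncomputable def surfDiv (K : Set R3) (n : R3) (w : R3 → Fin 3 → ℝ) (x : R3) : ℝ :=
  ∑ i, dirDeriv K (basisVec i - n i • n) (fun y => w y i) x

end Derivatives

section Sobolev

/-- `g` is the weak partial derivative `∂ᵢ u` in the open set `K`. -/
def IsWeakPartial (K : Set R3) (i : Fin 3) (u g : R3 → ℝ) : Prop :=
  ∀ φ : R3 → ℝ, ContDiff ℝ ∞ φ → HasCompactSupport φ → tsupport φ ⊆ K →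
    ∫ x in K, u x * fderiv ℝ φ x (basisVec i) = - ∫ x in K, g x * φ x

/-- `v ∈ H²(K)`, with weak gradient `G` and weak Hessian `H`. -/
structure IsH2 (K : Set R3) (v : R3 → ℝ) (G : Fin 3 → R3 → ℝ) (H : Fin 3 → Fin 3 → R3 → ℝ) :
    Prop where
  memLp : MemLp v 2 (volume.restrict K)
  grad_memLp : ∀ i, MemLp (G i) 2 (volume.restrict K)
  hess_memLp : ∀ i j, MemLp (H i j) 2 (volume.restrict K)
  grad_weak : ∀ i, IsWeakPartial K i v (G i)
  hess_weak : ∀ i j, IsWeakPartial K j (G i) (H i j)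

/-- The smooth functions `φ k` converge to `v` in the norm of `H²(K)`. -/
structure TendstoH2 (K : Set R3) (φ : ℕ → R3 → ℝ) (v : R3 → ℝ) (G : Fin 3 → R3 → ℝ)
    (H : Fin 3 → Fin 3 → R3 → ℝ) : Prop where
  value : Tendsto (fun k => eLpNorm (fun x => φ k x - v x) 2 (volume.restrict K)) atTop (𝓝 0)
  grad : ∀ i, Tendsto (fun k => eLpNorm (fun x => fderiv ℝ (φ k) x (basisVec i) - G i x) 2
    (volume.restrict K)) atTop (𝓝 0)
  hess : ∀ i j, Tendsto (fun k => eLpNorm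
    (fun x => fderiv ℝ (fun y => fderiv ℝ (φ k) y (basisVec i)) x (basisVec j) - H i j x) 2
    (volume.restrict K)) atTop (𝓝 0)

/-- For a measure `μ` carried by a part of the boundary of `K` and an operator `B` on smooth
functions, `g ∈ L²(μ)` is the trace of `B v`: the value at `v` of the extension by continuity
`H²(K) → L²(μ)` of the operator `φ ↦ B φ`, defined for `φ` smooth up to the boundary of `K`. -/
def IsTrace (K : Set R3) (v : R3 → ℝ) (G : Fin 3 → R3 → ℝ) (H : Fin 3 → Fin 3 → R3 → ℝ)
    (μ : Measure R3) (B : (R3 → ℝ) → R3 → ℝ) (g : R3 → ℝ) : Prop :=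
  MemLp g 2 μ ∧ ∃ φ : ℕ → R3 → ℝ, (∀ k, ContDiff ℝ ∞ (φ k)) ∧ TendstoH2 K φ v G H ∧
    Tendsto (fun k => eLpNorm (fun x => B (φ k) x - g x) 2 μ) atTop (𝓝 0)

/-- The boundary operator `φ ↦ φ`. -/
def valueOp (φ : R3 → ℝ) : R3 → ℝ := φ

/-- The boundary operator `φ ↦ ∂ₙ φ = n · ∇φ`. -/
noncomputable def normalDerivOp (n : R3) (φ : R3 → ℝ) : R3 → ℝ := fun x => fderiv ℝ φ x n

end Sobolev

end DivDivGreen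

namespace DivDivGreen

/-! For `φ` smooth up to the boundary the identity is two integrations by parts. Pointwise, `div div
τ · φ - τ : ∇²φ` is the sum of `∂ᵢ(∂ⱼτᵢⱼ φ) - ∂ⱼ(τᵢⱼ ∂ᵢφ)`, so the divergence theorem in `K` leaves
on each face the flux `(n · div τ) φ - (τn) · ∇φ` (`green_of_contDiff`). By symmetry of `τ`, `n ·
div τ = div(τn) = div_F(τn) + ∂ₙ(nᵀτn)`. Splitting `∇φ` into normal and tangential parts gives `(τn)
· ∇φ = nᵀτn ∂ₙφ + div_F(φ τn) - φ div_F(τn)`. This explains the factor `2` (`faceFlux_eq`). The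
remaining term `div_F(φ τn)` becomes the edge integrals by the divergence theorem on the face
(`Face.integral_faceFlux`).

Both divergence theorems are instances of `IsPiecewiseFlat.hasDivergenceFormula`, which holds in
every dimension for bounded open sets whose boundary lies on finitely many hyperplanes and is flat
at each point where only one of them passes. A partition of unity reduces it to half-spaces away
from the singular boundary points. Those lie on finitely many planes of codimension two. A cutoff at
distance `ε` from such a plane has gradient `O(1/ε)` on a tube of volume `O(ε²)`, so its
contribution vanishes in the limit. A polyhedron satisfies the hypotheses because a Lipschitz graph
contained in a plane fills it locally (`IsPolyhedron.exists_isPiecewiseFlat`). A face in coordinates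
of its plane satisfies them because it cannot lie on both sides of a boundary segment
(`FlatFace.exists_isPiecewiseFlat`). No Lipschitz property of the faces is needed. Finiteness of
faces and edges follows by counting the sign patterns of finitely many affine functions
(`IsPiecewiseFlat.finite_flatFace`).

The passage to `H²(K)` rests on the uniform interior cone property of Lipschitz domains
(`exists_isConeAt`). Integrating along the cone gives the Sobolev bound of `sup |φ|` by the `H²`
norm (`IsPolyhedron.sup_bound`), which controls values on faces and edges, and along its axis the
`H¹` trace bound on faces (`Face.trace_bound`), which controls `∂ₙφ`. Mollifying with kernels
shifted into the cone gives density of smooth functions (`IsH2.exists_tendstoH2`). Hence traces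
exist and do not depend on the approximating sequence (`IsBoundedOp.exists_isTrace`,
`IsTrace.tendsto`), and every term of the smooth identity converges. -/

/-- `d`-dimensional Euclidean space. -/
abbrev Eu (d : ℕ) : Type := EuclideanSpace ℝ (Fin d)

/-! ### Coordinates adapted to a hyperplane, for volume and for surface measure. -/

/-- An isometric parametrization of the hyperplane through the origin orthogonal to a unit
vector. -/
theorem exists_hyperplane_isometry {d : ℕ} (n : Eu (d + 1)) (hn : ‖n‖ = 1) :
    ∃ L : Eu d →ₗᵢ[ℝ] Eu (d + 1), (∀ y, inner ℝ n (L y) = 0) ∧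
      ∀ x, inner ℝ n x = 0 → ∃ y, L y = x := by
  have hn0 : n ≠ 0 := by rintro rfl; simp at hn
  have : Fact (Module.finrank ℝ (Eu (d + 1)) = d + 1) := ⟨by simp⟩
  let b := OrthonormalBasis.fromOrthogonalSpanSingleton (𝕜 := ℝ) d hn0
  refine ⟨(ℝ ∙ n)ᗮ.subtypeₗᵢ.comp b.repr.symm.toLinearIsometry, fun y => ?_, fun x hx => ?_⟩
  · exact Submodule.mem_orthogonal_singleton_iff_inner_right.1 (b.repr.symm y).2
  · refine ⟨b.repr ⟨x, Submodule.mem_orthogonal_singleton_iff_inner_right.2 hx⟩, ?_⟩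
    simp

section Param

variable {d : ℕ} {n : Eu (d + 1)} {L : Eu d →ₗᵢ[ℝ] Eu (d + 1)}

/-- By Pythagoras the map is a linear isometry from the `ℓ²` product, and it is onto because the
dimensions agree. -/
theorem measurePreserving_normal_coords (hn : ‖n‖ = 1) (hL : ∀ y, inner ℝ n (L y) = 0) :
    MeasurePreserving (fun p : Eu d × ℝ => L p.1 + p.2 • n) := by
  let T : WithLp 2 (Eu d × ℝ) →ₗᵢ[ℝ] Eu (d + 1) :=
    { toLinearMap := (L.toLinearMap.comp (LinearMap.fst ℝ (Eu d) ℝ) +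
        (LinearMap.snd ℝ (Eu d) ℝ).smulRight n).comp
          (WithLp.linearEquiv 2 ℝ (Eu d × ℝ)).toLinearMap
      norm_map' := fun p => by
        have h1 : ‖L p.fst + p.snd • n‖ ^ 2 = ‖p‖ ^ 2 := by
          rw [WithLp.prod_norm_sq_eq_of_L2, norm_add_sq_real, inner_smul_right,
            real_inner_comm, hL, norm_smul, hn, L.norm_map]
          simp
        exact (sq_eq_sq₀ (norm_nonneg _) (norm_nonneg _)).1 h1 }
  have hfin : Module.finrank ℝ (WithLp 2 (Eu d × ℝ)) = Module.finrank ℝ (Eu (d + 1)) := by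
    rw [(WithLp.linearEquiv 2 ℝ (Eu d × ℝ)).finrank_eq]; simp
  exact (T.toLinearIsometryEquiv hfin).measurePreserving.comp
    (WithLp.volume_preserving_toLp (Eu d) ℝ)

/-- With `a = L z + n`, these are the orthonormal coordinates after the shear `(y, t) ↦ (y + t z, t
+ c)`, which preserves volume by Fubini. The normalization of `⟪n, a⟫` makes the Jacobian one. -/
theorem measurePreserving_skew_coords (hn : ‖n‖ = 1) (hL : ∀ y, inner ℝ n (L y) = 0)
    (hL' : ∀ x, inner ℝ n x = 0 → ∃ y, L y = x) (c : ℝ) {a : Eu (d + 1)}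
    (ha : inner ℝ n a = 1) :
    MeasurePreserving (fun p : Eu d × ℝ => L p.1 + c • n + p.2 • a) := by
  obtain ⟨z, hz⟩ := hL' (a - n) (by
    rw [inner_sub_right, ha, real_inner_self_eq_norm_sq, hn]; norm_num)
  have hshear : MeasurePreserving (fun p : ℝ × Eu d => (p.1 + c, p.2 + p.1 • z)) := by
    refine MeasurePreserving.skew_product (f := fun t : ℝ => t + c)
      (g := fun t y => y + t • z) (measurePreserving_add_right volume c) (by fun_prop) ?_
    exact .of_forall fun t => (measurePreserving_add_right volume (t • z)).map_eq
  have e : a = L z + n := by rw [hz]; abel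
  have hfun : (fun p : Eu d × ℝ => L p.1 + c • n + p.2 • a) = (fun p => L p.1 + p.2 • n) ∘
      (Prod.swap ∘ ((fun p : ℝ × Eu d => (p.1 + c, p.2 + p.1 • z)) ∘ Prod.swap)) := by
    ext1 p
    simp only [e, Function.comp, Prod.swap, map_add, map_smul]
    module
  rw [hfun]
  exact (measurePreserving_normal_coords hn hL).comp
    (Measure.measurePreserving_swap.comp (hshear.comp Measure.measurePreserving_swap))

theorem isometry_plane (c : ℝ) : Isometry fun y : Eu d => L y + c • n :=
  (IsometryEquiv.addRight (c • n)).isometry.comp L.isometry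

theorem inner_plane (hn : ‖n‖ = 1) (hL : ∀ y, inner ℝ n (L y) = 0) (c : ℝ) (y : Eu d) :
    inner ℝ n (L y + c • n) = c := by
  rw [inner_add_right, hL, inner_smul_right, real_inner_self_eq_norm_sq, hn]; simp

theorem exists_plane_eq (hn : ‖n‖ = 1) (hL' : ∀ x, inner ℝ n x = 0 → ∃ y, L y = x) {c : ℝ}
    {x : Eu (d + 1)} (hx : inner ℝ n x = c) : ∃ y, L y + c • n = x := by
  obtain ⟨y, hy⟩ := hL' (x - c • n) (by
    rw [inner_sub_right, inner_smul_right, real_inner_self_eq_norm_sq, hn, hx]; simp)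
  exact ⟨y, by rw [hy]; abel⟩

theorem range_plane (hn : ‖n‖ = 1) (hL : ∀ y, inner ℝ n (L y) = 0)
    (hL' : ∀ x, inner ℝ n x = 0 → ∃ y, L y = x) (c : ℝ) :
    Set.range (fun y : Eu d => L y + c • n) = {x | inner ℝ n x = c} := by
  ext x
  exact ⟨by rintro ⟨y, rfl⟩; exact inner_plane hn hL c y, fun hx => exists_plane_eq hn hL' hx⟩

/-- An isometry transports the normalized Hausdorff measure, and in its own dimension this is
Lebesgue measure. All surface integrals are computed through this. -/
theorem map_plane_volume (hn : ‖n‖ = 1) (hL : ∀ y, inner ℝ n (L y) = 0)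
    (hL' : ∀ x, inner ℝ n x = 0 → ∃ y, L y = x) (c : ℝ) :
    (volume : Measure (Eu d)).map (fun y => L y + c • n) =
      (μHE[d] : Measure (Eu (d + 1))).restrict {x | inner ℝ n x = c} := by
  rw [← range_plane hn hL hL' c, ← (isometry_plane c).map_euclideanHausdorffMeasure,
    EuclideanSpace.euclideanHausdorffMeasure_eq_volume]

theorem measurableEmbedding_plane (c : ℝ) : MeasurableEmbedding fun y : Eu d => L y + c • n :=
  (isometry_plane c).isClosedEmbedding.measurableEmbedding

/-- Integrals over a subset of a hyperplane in isometric coordinates. -/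
theorem setIntegral_plane (hn : ‖n‖ = 1) (hL : ∀ y, inner ℝ n (L y) = 0)
    (hL' : ∀ x, inner ℝ n x = 0 → ∃ y, L y = x) {c : ℝ} {s : Set (Eu (d + 1))}
    (hs : s ⊆ {x | inner ℝ n x = c}) (f : Eu (d + 1) → ℝ) :
    ∫ x in s, f x ∂μHE[d] = ∫ y in (fun y => L y + c • n) ⁻¹' s, f (L y + c • n) := by
  have h := (measurableEmbedding_plane (n := n) (L := L) c).setIntegral_map (μ := volume) f s
  rw [map_plane_volume hn hL hL', Measure.restrict_restrict_of_subset hs] at h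
  exact h

theorem setLIntegral_plane (hn : ‖n‖ = 1) (hL : ∀ y, inner ℝ n (L y) = 0)
    (hL' : ∀ x, inner ℝ n x = 0 → ∃ y, L y = x) {c : ℝ} {s : Set (Eu (d + 1))}
    (hs : s ⊆ {x | inner ℝ n x = c}) (f : Eu (d + 1) → ℝ≥0∞) :
    ∫⁻ x in s, f x ∂μHE[d] = ∫⁻ y in (fun y => L y + c • n) ⁻¹' s, f (L y + c • n) := by
  have h := (measurableEmbedding_plane (n := n) (L := L) c).restrict_map (μ := volume) s
  rw [map_plane_volume hn hL hL', Measure.restrict_restrict_of_subset hs] at h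
  rw [h, (measurableEmbedding_plane (n := n) (L := L) c).lintegral_map]

end Param

/-! ### The divergence theorem on a half-space. -/

/-- The divergence theorem on a half-space for functions that are `C¹` up to the boundary, in a
direction `a` with `⟪n, a⟫ = 1`. -/
theorem integral_halfSpace_of_inner_eq_one {d : ℕ} {n : Eu (d + 1)} (hn : ‖n‖ = 1) {c : ℝ}
    {W : Eu (d + 1) → ℝ} {dW : Eu (d + 1) → Eu (d + 1) →L[ℝ] ℝ}
    (hW : ContinuousOn W {x | inner ℝ n x ≤ c})
    (hdW : ∀ x, inner ℝ n x < c → HasFDerivAt W (dW x) x) (hc : HasCompactSupport W)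
    {a : Eu (d + 1)} (ha : inner ℝ n a = 1)
    (hint : IntegrableOn (fun x => dW x a) {x | inner ℝ n x < c}) :
    ∫ x in {x | inner ℝ n x < c}, dW x a = ∫ x in {x | inner ℝ n x = c}, W x ∂μHE[d] := by
  obtain ⟨L, hL, hL'⟩ := exists_hyperplane_isometry n hn
  have hΦ := measurePreserving_skew_coords hn hL hL' c ha
  set Φ := fun p : Eu d × ℝ => L p.1 + c • n + p.2 • a with hΦdef
  have hin : ∀ p, inner ℝ n (Φ p) = c + p.2 := fun p => by
    simp only [hΦdef]
    rw [inner_add_right, inner_plane hn hL, inner_smul_right, ha, mul_one]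
  have hopen : MeasurableSet {x : Eu (d + 1) | inner ℝ n x < c} :=
    (isOpen_lt (by fun_prop) continuous_const).measurableSet
  set g : Eu (d + 1) → ℝ := {x | inner ℝ n x < c}.indicator fun x => dW x a with hg
  have hgint : Integrable g := (integrable_indicator_iff hopen).2 hint
  have hpre : Integrable (fun p => g (Φ p)) := hΦ.integrable_comp_of_integrable hgint
  have h1 : ∫ x, g x = ∫ p, g (Φ p) := by
    have hs := hΦ.map_eq
    conv_lhs => rw [← hs]
    exact integral_map hΦ.aemeasurable (by rw [hs]; exact hgint.aestronglyMeasurable)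
  rw [← integral_indicator hopen, ← hg, h1,
    show (volume : Measure (Eu d × ℝ)) = volume.prod volume from rfl, integral_prod _ hpre,
    setIntegral_plane hn hL hL' (c := c) subset_rfl]
  have huniv : (fun y => L y + c • n) ⁻¹' {x | inner ℝ n x = c} = Set.univ :=
    Set.eq_univ_of_forall fun y => inner_plane hn hL c y
  rw [huniv, setIntegral_univ]
  -- By Fubini the derivative is integrable along almost every line in direction `a`; there the
  -- fundamental theorem of calculus on `(-∞, 0]` leaves only the value on the hyperplane.
  have hae := hpre.prod_right_ae
  refine integral_congr_ae ?_
  filter_upwards [hae] with y hy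
  have hgy : (fun t => g (Φ (y, t))) = (Set.Iio (0 : ℝ)).indicator fun t => dW (Φ (y, t)) a := by
    ext t
    simp only [hg, Set.indicator, Set.mem_ofPred_eq, hin, Set.mem_Iio]
    simp
  rw [hgy] at hy ⊢
  rw [integral_indicator measurableSet_Iio, ← integral_Iic_eq_integral_Iio]
  rw [integrable_indicator_iff measurableSet_Iio, ← integrableOn_Iic_iff_integrableOn_Iio] at hy
  have hline : Continuous fun t : ℝ => Φ (y, t) := by simp only [hΦdef]; fun_prop
  have hclosed : Topology.IsClosedEmbedding fun t : ℝ => Φ (y, t) := by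
    have hane : a ≠ 0 := by rintro rfl; simp at ha
    exact (Homeomorph.addLeft (L y + c • n)).isClosedEmbedding.comp
      (isClosedEmbedding_smul_left hane)
  have hlim : Tendsto (fun t => W (Φ (y, t))) atBot (𝓝 0) :=
    ((hc.comp_isClosedEmbedding hclosed).is_zero_at_infty).mono_left atBot_le_cocompact
  have := integral_Iic_of_hasDerivAt_of_tendsto (a := (0 : ℝ)) (f := fun t => W (Φ (y, t)))
    (f' := fun t => dW (Φ (y, t)) a) (m := 0) ?_ ?_ hy hlim
  · rw [this]; simp [hΦdef]
  · refine (hW.comp hline.continuousOn (fun t ht => ?_)).continuousWithinAt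
      (s := Set.Iic 0) (by simp)
    show inner ℝ n (Φ (y, t)) ≤ c
    rw [hin]; simpa using ht
  · intro t ht
    have hd : HasDerivAt (fun t : ℝ => Φ (y, t)) a t := by
      simp only [hΦdef]
      simpa using ((hasDerivAt_id t).smul_const a).const_add (L y + c • n)
    exact (hdW (Φ (y, t)) (by rw [hin]; simpa using ht)).comp_hasDerivAt t hd

/-- The divergence theorem on a half-space for functions that are `C¹` up to the boundary. -/
theorem integral_halfSpace {d : ℕ} {n : Eu (d + 1)} (hn : ‖n‖ = 1) {c : ℝ}
    {W : Eu (d + 1) → ℝ} {dW : Eu (d + 1) → Eu (d + 1) →L[ℝ] ℝ}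
    (hW : ContinuousOn W {x | inner ℝ n x ≤ c})
    (hdW : ∀ x, inner ℝ n x < c → HasFDerivAt W (dW x) x) (hc : HasCompactSupport W)
    (hint : ∀ a, IntegrableOn (fun x => dW x a) {x | inner ℝ n x < c}) (a : Eu (d + 1)) :
    ∫ x in {x | inner ℝ n x < c}, dW x a =
      inner ℝ n a * ∫ x in {x | inner ℝ n x = c}, W x ∂μHE[d] := by
  have hnn : inner ℝ n n = (1 : ℝ) := by rw [real_inner_self_eq_norm_sq, hn]; norm_num
  -- Both `a + (1 - ⟪n, a⟫) n` and `n` have inner product one with `n`, so the transversal case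
  -- applies to each and linearity gives all directions, the tangential ones included.
  have e : a = (a + (1 - inner ℝ n a) • n) - (1 - inner ℝ n a) • n := by abel
  have h1 := integral_halfSpace_of_inner_eq_one hn hW hdW hc
    (a := a + (1 - inner ℝ n a) • n)
    (by rw [inner_add_right, inner_smul_right, hnn]; ring) (hint _)
  have h2 := integral_halfSpace_of_inner_eq_one hn hW hdW hc hnn (hint _)
  have h3 : ∀ x, dW x a = dW x (a + (1 - inner ℝ n a) • n) - (1 - inner ℝ n a) * dW x n := by
    intro x; conv_lhs => rw [e]
    rw [map_sub, map_smul, smul_eq_mul]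
  simp_rw [h3]
  rw [integral_sub (hint _) ((hint n).const_mul _), integral_const_mul, h1, h2]
  ring

/-! ### Hyperplanes and transversal intersections are null sets. -/

theorem volume_hyperplane_eq_zero {d : ℕ} {w : Eu d} (hw : w ≠ 0) (s : ℝ) :
    volume {z : Eu d | inner ℝ w z = s} = 0 := by
  by_cases h : ∃ z₀ : Eu d, inner ℝ w z₀ = s
  · obtain ⟨z₀, hz₀⟩ := h
    have hset : {z : Eu d | inner ℝ w z = s} = (AffineSubspace.mk' z₀ (ℝ ∙ w)ᗮ : Set (Eu d)) := by
      ext z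
      simp only [Set.mem_ofPred_eq, SetLike.mem_coe, AffineSubspace.mem_mk', vsub_eq_sub,
        Submodule.mem_orthogonal_singleton_iff_inner_right, inner_sub_right, hz₀, sub_eq_zero]
    rw [hset]
    refine Measure.addHaar_affineSubspace _ _ fun htop => hw ?_
    have h1 : w + z₀ ∈ AffineSubspace.mk' z₀ (ℝ ∙ w)ᗮ := htop ▸ AffineSubspace.mem_top ..
    rw [AffineSubspace.mem_mk', vsub_eq_sub, add_sub_cancel_right,
      Submodule.mem_orthogonal_singleton_iff_inner_right] at h1
    exact inner_self_eq_zero.1 h1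
  · push Not at h
    rw [show {z : Eu d | inner ℝ w z = s} = ∅ from Set.eq_empty_of_forall_notMem h]
    simp

/-- In isometric coordinates of a hyperplane, the intersection with a hyperplane that is not
parallel to it is a null set. -/
theorem volume_plane_inter_eq_zero {d : ℕ} {n : Eu (d + 1)} {L : Eu d →ₗᵢ[ℝ] Eu (d + 1)}
    (hn : ‖n‖ = 1) (hL' : ∀ x, inner ℝ n x = 0 → ∃ y, L y = x) (c : ℝ) {u : Eu (d + 1)}
    (hu : ¬ ∃ s : ℝ, u = s • n) (s : ℝ) :
    volume {z : Eu d | inner ℝ u (L z + c • n) = s} = 0 := by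
  obtain ⟨w, hw⟩ := hL' (u - inner ℝ n u • n) (by
    rw [inner_sub_right, inner_smul_right, real_inner_self_eq_norm_sq, hn]; simp)
  have hw0 : w ≠ 0 := by
    rintro rfl
    exact hu ⟨inner ℝ n u, by rw [map_zero] at hw; exact (sub_eq_zero.1 hw.symm)⟩
  -- The range of `L` is necessarily orthogonal to `n`: otherwise `L` would be onto, which the
  -- dimensions forbid.
  by_cases hL : ∀ y, inner ℝ n (L y) = 0
  · have h : {z : Eu d | inner ℝ u (L z + c • n) = s} =
        {z | inner ℝ w z = s - inner ℝ u (c • n)} := by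
      ext z
      have h1 : inner ℝ w z = inner ℝ u (L z) := by
        rw [← L.inner_map_map, hw, inner_sub_left, inner_smul_left, hL]; simp
      simp only [Set.mem_ofPred_eq, inner_add_right, h1, eq_sub_iff_add_eq]
    rw [h]
    exact volume_hyperplane_eq_zero hw0 _
  · exfalso
    push Not at hL
    obtain ⟨y, hy⟩ := hL
    -- the range of `L` contains the orthogonal complement of `n` and is not everything
    have hinj := L.injective
    have hsurj : Function.Surjective L := fun x => by
      obtain ⟨z, hz⟩ := hL' (x - (inner ℝ n x / inner ℝ n (L y)) • L y) (by
        rw [inner_sub_right, inner_smul_right]; field_simp; ring)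
      exact ⟨z + (inner ℝ n x / inner ℝ n (L y)) • y, by rw [map_add, hz, map_smul]; abel⟩
    have := (LinearEquiv.ofBijective L.toLinearMap ⟨hinj, hsurj⟩).finrank_eq
    simp at this

/-! ### Flat boundary parts and their components, the faces. -/

section Flat

variable {m : ℕ}

/-- The points of the hyperplane `⟪n, x⟫ = c` near which `U` is the half-space `⟪n, y⟫ < c`. -/
def flatBdry (U : Set (Eu m)) (n : Eu m) (c : ℝ) : Set (Eu m) :=
  {x | inner ℝ n x = c ∧ ∃ r > 0, ∀ y ∈ Metric.ball x r, (y ∈ U ↔ inner ℝ n y < c)}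

/-- A connected component of a flat part of the boundary. -/
structure FlatFace (U : Set (Eu m)) where
  normal : Eu m
  level : ℝ
  carrier : Set (Eu m)
  norm_normal : ‖normal‖ = 1
  isComponent : ∃ x ∈ flatBdry U normal level,
    carrier = connectedComponentIn (flatBdry U normal level) x

variable {U : Set (Eu m)} {n n' : Eu m} {c c' : ℝ} {x : Eu m}

theorem exists_small_smul_mem_ball (x v : Eu m) {r : ℝ} (hr : 0 < r) :
    ∃ t > (0 : ℝ), t < 1 ∧ x + t • v ∈ Metric.ball x r := by
  have h : Tendsto (fun t : ℝ => x + t • v) (𝓝[>] 0) (𝓝 x) := by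
    have : Continuous fun t : ℝ => x + t • v := by fun_prop
    simpa using (this.tendsto 0).mono_left nhdsWithin_le_nhds
  obtain ⟨t, ht1, ht2⟩ := ((h.eventually (Metric.ball_mem_nhds x hr)).and
    (Ioo_mem_nhdsGT one_pos)).exists
  exact ⟨t, ht2.1, ht2.2, ht1⟩

theorem flatBdry_subset_frontier (hn : ‖n‖ = 1) : flatBdry U n c ⊆ frontier U := by
  rintro x ⟨hx, r, hr, h⟩
  have hnU : x ∉ U := fun hxU => by
    have := (h x (Metric.mem_ball_self hr)).1 hxU
    linarith
  refine ⟨?_, fun hi => hnU (interior_subset hi)⟩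
  rw [Metric.mem_closure_iff]
  intro ε hε
  obtain ⟨t, ht0, -, ht⟩ := exists_small_smul_mem_ball x (-n) (lt_min hr hε)
  refine ⟨x + t • (-n), ?_, ?_⟩
  · rw [h _ (Metric.ball_subset_ball (min_le_left _ _) ht), inner_add_right, inner_smul_right,
      inner_neg_right, real_inner_self_eq_norm_sq, hn, hx]
    linarith
  · rw [dist_comm]
    exact lt_of_lt_of_le ht (min_le_right _ _)

/-- If `n ≠ n'`, a small step along `n' - n` decreases `⟪n, ·⟫` and increases `⟪n', ·⟫`, so one
description puts the new point inside `U` and the other outside. -/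
theorem flatBdry_unique (hn : ‖n‖ = 1) (hn' : ‖n'‖ = 1) (h : x ∈ flatBdry U n c)
    (h' : x ∈ flatBdry U n' c') : n = n' ∧ c = c' := by
  obtain ⟨hx, r, hr, h⟩ := h
  obtain ⟨hx', r', hr', h'⟩ := h'
  have key : n = n' := by
    by_contra hne
    obtain ⟨t, ht0, -, ht⟩ := exists_small_smul_mem_ball x (n' - n) (lt_min hr hr')
    have h1 := (h _ (Metric.ball_subset_ball (min_le_left _ _) ht)).symm.trans
      (h' _ (Metric.ball_subset_ball (min_le_right _ _) ht))
    have hlt : inner ℝ n n' < (1 : ℝ) := (inner_lt_one_iff_real_of_norm_eq_one hn hn').2 hne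
    simp only [inner_add_right, inner_smul_right, inner_sub_right, real_inner_self_eq_norm_sq,
      hn, hn', hx, hx', real_inner_comm] at h1
    rw [real_inner_comm] at hlt
    have h2 := h1.1 (by nlinarith [real_inner_comm n n'])
    nlinarith [real_inner_comm n n']
  exact ⟨key, by rw [← hx, ← hx', key]⟩

theorem mem_flatBdry_of_mem_ball {r : ℝ}
    (h : ∀ y ∈ Metric.ball x r, (y ∈ U ↔ inner ℝ n y < c)) {y : Eu m} (hy : y ∈ Metric.ball x r)
    (hyc : inner ℝ n y = c) : y ∈ flatBdry U n c := by
  refine ⟨hyc, r - dist y x, by simpa using hy, fun z hz => h z ?_⟩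
  rw [Metric.mem_ball] at *
  linarith [dist_triangle z y x]

theorem inner_eq_of_mem_frontier_of_mem_ball {r : ℝ} (hU : IsOpen U)
    (h : ∀ y ∈ Metric.ball x r, (y ∈ U ↔ inner ℝ n y < c)) {y : Eu m} (hy : y ∈ Metric.ball x r)
    (hyU : y ∈ frontier U) : inner ℝ n y = c := by
  rw [hU.frontier_eq] at hyU
  refine le_antisymm (not_lt.1 fun hlt => ?_) (not_lt.1 fun hlt => hyU.2 ((h y hy).2 hlt))
  have hopen : IsOpen ({z : Eu m | c < inner ℝ n z} ∩ Metric.ball x r) :=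
    (isOpen_lt continuous_const (by fun_prop)).inter Metric.isOpen_ball
  obtain ⟨z, hz, hzU⟩ := mem_closure_iff.1 hyU.1 _ hopen ⟨hlt, hy⟩
  have h1 : c < inner ℝ n z := hz.1
  have := (h z hz.2).1 hzU
  linarith

/-- A limit of points of a flat part at which `U` is a half-space on either side is in the flat
part. -/
theorem mem_flatBdry_of_mem_closure (hn : ‖n‖ = 1) (hx : x ∈ closure (flatBdry U n c))
    (h : x ∈ flatBdry U n (inner ℝ n x) ∨ x ∈ flatBdry U (-n) (inner ℝ (-n) x)) :
    x ∈ flatBdry U n c := by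
  have hxc : inner ℝ n x = c := by
    have hcl : IsClosed {y : Eu m | inner ℝ n y = c} := isClosed_eq (by fun_prop) continuous_const
    exact hcl.closure_subset_iff.2 (fun y hy => hy.1) hx
  rcases h with h | h
  · rwa [hxc] at h
  · exfalso
    obtain ⟨-, r, hr, h2⟩ := h
    -- Otherwise a nearby point of the flat part would have both `n` and `-n` as outward normal.
    obtain ⟨w, hwu, hwy⟩ := Metric.mem_closure_iff.1 hx r hr
    have h3 := mem_flatBdry_of_mem_ball h2 (by rwa [Metric.mem_ball, dist_comm]) (by
      rw [inner_neg_left, inner_neg_left, hxc, hwu.1])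
    have h4 := (flatBdry_unique hn (by rwa [norm_neg]) hwu h3).1
    have h5 : (2 : ℝ) • n = 0 := by
      rw [two_smul]
      nth_rewrite 2 [h4]
      exact add_neg_cancel n
    have : n = 0 := (smul_eq_zero.1 h5).resolve_left two_ne_zero
    rw [this, norm_zero] at hn
    exact zero_ne_one hn

namespace FlatFace

theorem carrier_subset (C : FlatFace U) : C.carrier ⊆ flatBdry U C.normal C.level := by
  obtain ⟨x, hx, h⟩ := C.isComponent
  rw [h]
  exact connectedComponentIn_subset _ _

theorem carrier_subset_frontier (C : FlatFace U) : C.carrier ⊆ frontier U :=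
  C.carrier_subset.trans (flatBdry_subset_frontier C.norm_normal)

theorem carrier_subset_plane (C : FlatFace U) : C.carrier ⊆ {x | inner ℝ C.normal x = C.level} :=
  fun _ hx => (C.carrier_subset hx).1

theorem nonempty (C : FlatFace U) : C.carrier.Nonempty := by
  obtain ⟨x, hx, h⟩ := C.isComponent
  exact ⟨x, h ▸ mem_connectedComponentIn hx⟩

theorem carrier_eq (C : FlatFace U) (hx : x ∈ C.carrier) :
    C.carrier = connectedComponentIn (flatBdry U C.normal C.level) x := by
  obtain ⟨y, hy, h⟩ := C.isComponent
  rw [h] at hx ⊢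
  exact connectedComponentIn_eq hx

/-- A point determines the normal and the level, and these with the point determine the component.
Distinct faces are therefore disjoint. -/
theorem eq_of_mem {C C' : FlatFace U} (h : x ∈ C.carrier) (h' : x ∈ C'.carrier) : C = C' := by
  have h3 := C.carrier_eq h
  have h4 := C'.carrier_eq h'
  obtain ⟨h1, h2⟩ := flatBdry_unique C.norm_normal C'.norm_normal (C.carrier_subset h)
    (C'.carrier_subset h')
  rw [← h1, ← h2, ← h3] at h4
  cases C; cases C'
  simp_all

theorem exists_mem (hn : ‖n‖ = 1) (hx : x ∈ flatBdry U n c) : ∃ C : FlatFace U, x ∈ C.carrier :=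
  ⟨⟨n, c, _, hn, x, hx, rfl⟩, mem_connectedComponentIn hx⟩

/-- The union of the boundary near a point of a face is the face. -/
theorem exists_ball (hU : IsOpen U) (C : FlatFace U) (hx : x ∈ C.carrier) :
    ∃ r > 0, ∀ y ∈ Metric.ball x r, (y ∈ U ↔ inner ℝ C.normal y < C.level) ∧
      ∀ C' : FlatFace U, y ∈ C'.carrier ↔ C' = C ∧ inner ℝ C.normal y = C.level := by
  obtain ⟨hxc, r, hr, h⟩ := C.carrier_subset hx
  -- The disc cut out of the hyperplane by the ball is convex, hence connected, and so lies in a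
  -- single component.
  have hsub : Metric.ball x r ∩ {y | inner ℝ C.normal y = C.level} ⊆ C.carrier := by
    rw [C.carrier_eq hx]
    refine IsPreconnected.subset_connectedComponentIn ?_ ⟨Metric.mem_ball_self hr, hxc⟩
      fun y hy => mem_flatBdry_of_mem_ball h hy.1 hy.2
    exact ((convex_ball x r).inter
      (convex_hyperplane (innerₛₗ ℝ C.normal).isLinear C.level)).isPreconnected
  refine ⟨r, hr, fun y hy => ⟨h y hy, fun C' => ⟨fun hyC' => ?_, ?_⟩⟩⟩
  · have hyc := inner_eq_of_mem_frontier_of_mem_ball hU h hy (C'.carrier_subset_frontier hyC')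
    exact ⟨eq_of_mem hyC' (hsub ⟨hy, hyc⟩), hyc⟩
  · rintro ⟨rfl, hyc⟩
    exact hsub ⟨hy, hyc⟩

/-- The face through `x` is the only one that meets a small ball around `x`, so a face that
accumulates at `x` is this one. -/
theorem mem_of_mem_closure (hU : IsOpen U) (C : FlatFace U) (hx : x ∈ closure C.carrier)
    (hxf : x ∈ flatBdry U C.normal C.level) : x ∈ C.carrier := by
  obtain ⟨C', hC'⟩ := exists_mem C.norm_normal hxf
  obtain ⟨r, hr, h⟩ := C'.exists_ball hU hC'
  obtain ⟨z, hz, hzr⟩ := Metric.mem_closure_iff.1 hx r hr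
  have := (((h z (by rwa [Metric.mem_ball, dist_comm])).2 C).1 hz).1
  rwa [this]

end FlatFace

end Flat

/-! ### Sets with piecewise flat boundary: generic points and finiteness of the faces. -/

/-- A bounded open set with piecewise flat boundary: the boundary is covered by the hyperplanes
`⟪p.1, x⟫ = p.2`, and at a boundary point on only one of them `U` is locally a half-space. -/
structure IsPiecewiseFlat {m : ℕ} (U : Set (Eu m)) (P : Finset (Eu m × ℝ)) : Prop where
  isOpen : IsOpen U
  isBounded : Bornology.IsBounded U
  ne_zero : ∀ p ∈ P, p.1 ≠ 0
  cover : ∀ x ∈ frontier U, ∃ p ∈ P, inner ℝ p.1 x = p.2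
  regular : ∀ x ∈ frontier U, ∀ n : Eu m, ‖n‖ = 1 →
    (∀ p ∈ P, inner ℝ p.1 x = p.2 → ∃ s : ℝ, p.1 = s • n) →
    x ∈ flatBdry U n (inner ℝ n x) ∨ x ∈ flatBdry U (-n) (inner ℝ (-n) x)

/-- Every relatively open piece of a hyperplane has a point that is on no other one of finitely
many hyperplanes. -/
theorem exists_generic_mem_plane {d : ℕ} (P : Finset (Eu (d + 1) × ℝ)) {n : Eu (d + 1)}
    (hn : ‖n‖ = 1) {c : ℝ} {x : Eu (d + 1)} (hx : inner ℝ n x = c) {r : ℝ} (hr : 0 < r) :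
    ∃ y ∈ Metric.ball x r, inner ℝ n y = c ∧
      ∀ p ∈ P, inner ℝ p.1 y = p.2 → ∃ s : ℝ, p.1 = s • n := by
  obtain ⟨L, hL, hL'⟩ := exists_hyperplane_isometry n hn
  obtain ⟨z, rfl⟩ := exists_plane_eq hn hL' hx
  classical
  -- The non-parallel hyperplanes leave null sets in the coordinates of the plane, which cannot fill
  -- a ball.
  set B : Set (Eu d) := ⋃ p ∈ P.filter (fun p : Eu (d + 1) × ℝ => ¬ ∃ s : ℝ, p.1 = s • n),
    {z : Eu d | inner ℝ p.1 (L z + c • n) = p.2} with hB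
  have hB0 : volume B = 0 := by
    refine (measure_biUnion_null_iff (Finset.countable_toSet _)).2 fun p hp => ?_
    exact volume_plane_inter_eq_zero hn hL' c (Finset.mem_filter.1 hp).2 _
  have hpos : 0 < volume (Metric.ball z r \ B) := by
    rw [measure_sdiff_null hB0]
    exact Metric.measure_ball_pos _ _ hr
  obtain ⟨w, hw, hwB⟩ := nonempty_of_measure_ne_zero hpos.ne'
  refine ⟨L w + c • n, ?_, inner_plane hn hL c w, fun p hp hpw => ?_⟩
  · rw [Metric.mem_ball, (isometry_plane c).dist_eq]
    exact hw
  · by_contra hcon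
    exact hwB (Set.mem_biUnion (x := p) (Finset.mem_filter.2 ⟨hp, hcon⟩) hpw)

namespace IsPiecewiseFlat

variable {d : ℕ} {U : Set (Eu (d + 1))} {P : Finset (Eu (d + 1) × ℝ)}

/-- A boundary point outside of the faces is on two different hyperplanes. -/
theorem exists_pair (h : IsPiecewiseFlat U P) {x : Eu (d + 1)} (hx : x ∈ frontier U)
    (hxC : ∀ C : FlatFace U, x ∉ C.carrier) :
    ∃ p ∈ P, ∃ q ∈ P, LinearIndependent ℝ ![p.1, q.1] ∧ inner ℝ p.1 x = p.2 ∧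
      inner ℝ q.1 x = q.2 := by
  obtain ⟨p, hp, hpx⟩ := h.cover x hx
  have hp0 := h.ne_zero p hp
  by_contra hcon
  push Not at hcon
  have hn : ‖‖p.1‖⁻¹ • p.1‖ = 1 := by
    rw [norm_smul, norm_inv, norm_norm, inv_mul_cancel₀ (norm_ne_zero_iff.2 hp0)]
  -- If no two hyperplanes through `x` are independent, all are parallel to the first one, and
  -- regularity with its unit normal puts `x` on a face.
  have := h.regular x hx (‖p.1‖⁻¹ • p.1) hn fun q hq hqx => by
    have h1 := mt (hcon p hp q hq · hpx) (not_not.2 hqx)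
    rw [LinearIndependent.pair_iff' hp0] at h1
    push Not at h1
    obtain ⟨a, ha⟩ := h1
    refine ⟨a * ‖p.1‖, ?_⟩
    rw [smul_smul, mul_assoc, mul_inv_cancel₀ (norm_ne_zero_iff.2 hp0), mul_one, ha]
  rcases this with h1 | h1
  · obtain ⟨C, hC⟩ := FlatFace.exists_mem hn h1
    exact hxC C hC
  · obtain ⟨C, hC⟩ := FlatFace.exists_mem (by rwa [norm_neg]) h1
    exact hxC C hC

/-- A face is relatively open in its plane, so it is not exhausted by the transversal hyperplanes.
Such a generic point serves as the base point of the face in the count of faces. -/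
theorem exists_generic (h : IsPiecewiseFlat U P) (C : FlatFace U) :
    ∃ x ∈ C.carrier, (∀ p ∈ P, inner ℝ p.1 x = p.2 → ∃ s : ℝ, p.1 = s • C.normal) ∧
      ∃ p ∈ P, inner ℝ p.1 x = p.2 := by
  obtain ⟨x, hx⟩ := C.nonempty
  obtain ⟨r, hr, hb⟩ := C.exists_ball h.isOpen hx
  obtain ⟨y, hy, hyc, hyP⟩ := exists_generic_mem_plane P C.norm_normal (C.carrier_subset hx).1 hr
  have hyC := ((hb y hy).2 C).2 ⟨rfl, hyc⟩
  exact ⟨y, hyC, hyP, h.cover y (C.carrier_subset_frontier hyC)⟩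

/-- Two points of flat parts with the same normal that are not separated by any of the other
hyperplanes belong to the same face. -/
theorem mem_connectedComponentIn_of_sign_eq (h : IsPiecewiseFlat U P) {n : Eu (d + 1)}
    (hn : ‖n‖ = 1) {c : ℝ} {x x' : Eu (d + 1)} (hx : x ∈ flatBdry U n c)
    (hx' : x' ∈ flatBdry U n c)
    (hxP : ∀ p ∈ P, inner ℝ p.1 x = p.2 → ∃ s : ℝ, p.1 = s • n)
    (hsign : ∀ p ∈ P, SignType.sign (inner ℝ p.1 x - p.2) = SignType.sign (inner ℝ p.1 x' - p.2)) :
    x' ∈ connectedComponentIn (flatBdry U n c) x := by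
  obtain ⟨L, hL, hL'⟩ := exists_hyperplane_isometry n hn
  obtain ⟨z, rfl⟩ := exists_plane_eq hn hL' hx.1
  obtain ⟨z', rfl⟩ := exists_plane_eq hn hL' hx'.1
  set A := fun y : Eu d => L y + c • n with hA
  have hAc : Continuous A := (isometry_plane c).continuous
  set u := A ⁻¹' flatBdry U n c with hu
  have huo : IsOpen u := by
    rw [Metric.isOpen_iff]
    rintro y ⟨-, r, hr, hy⟩
    refine ⟨r, hr, fun w hw => mem_flatBdry_of_mem_ball hy ?_ (inner_plane hn hL c w)⟩
    rw [Metric.mem_ball, (isometry_plane c).dist_eq]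
    exact hw
  -- The flat part is relatively open, so it suffices that its limit points on the segment belong to
  -- it. An affine function with equal nonzero signs at the ends cannot vanish in between; hence a
  -- hyperplane through a point of the segment also passes through the first end, is parallel to the
  -- face, and regularity applies.
  have hseg : segment ℝ z z' ⊆ u := by
    refine (convex_segment z z').isPreconnected.subset_of_closure_inter_subset huo
      ⟨z, left_mem_segment ℝ z z', hx⟩ ?_
    rintro y ⟨hyu, hys⟩
    have hyf : A y ∈ frontier U := by
      have h1 : A y ∈ closure (A '' u) := image_closure_subset_closure_image hAc ⟨y, hyu, rfl⟩
      refine isClosed_frontier.closure_subset_iff.2 ?_ h1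
      exact (Set.image_preimage_subset _ _).trans (flatBdry_subset_frontier hn)
    have hyP : ∀ p ∈ P, inner ℝ p.1 (A y) = p.2 → ∃ s : ℝ, p.1 = s • n := by
      intro p hp hpy
      by_cases hpx : inner ℝ p.1 (A z) = p.2
      · exact hxP p hp hpx
      exfalso
      obtain ⟨a, b, ha, hb, hab, rfl⟩ := hys
      have e : inner ℝ p.1 (A (a • z + b • z')) - p.2 =
          a * (inner ℝ p.1 (A z) - p.2) + b * (inner ℝ p.1 (A z') - p.2) := by
        simp only [hA, map_add, map_smul, inner_add_right, inner_smul_right]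
        linear_combination (p.2 - c * inner ℝ p.1 n) * hab
      rw [hpy, sub_self] at e
      have hs := hsign p hp
      rcases lt_or_gt_of_ne (sub_ne_zero.2 hpx) with h1 | h1
      · have h2 := h1
        rw [← sign_eq_neg_one_iff] at h1
        change SignType.sign (inner ℝ p.1 (A z) - p.2) = _ at h1
        have h3 := sign_eq_neg_one_iff.1 (hs.symm.trans h1)
        change inner ℝ p.1 (A z') - p.2 < 0 at h3
        rcases ha.eq_or_lt with rfl | ha
        · rw [zero_add] at hab; subst hab; linarith
        · nlinarith
      · have h2 := h1
        rw [← sign_eq_one_iff] at h1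
        have h3 := sign_eq_one_iff.1 (hs.symm.trans h1)
        change 0 < inner ℝ p.1 (A z') - p.2 at h3
        rcases ha.eq_or_lt with rfl | ha
        · rw [zero_add] at hab; subst hab; linarith
        · nlinarith
    refine mem_flatBdry_of_mem_closure hn ?_ (h.regular (A y) hyf n hn hyP)
    exact closure_mono (Set.image_preimage_subset _ _)
      (image_closure_subset_closure_image hAc ⟨y, hyu, rfl⟩)
  have himg : A '' segment ℝ z z' ⊆ flatBdry U n c := Set.image_subset_iff.2 hseg
  exact ((convex_segment z z').isPreconnected.image A hAc.continuousOn).subset_connectedComponentIn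
    ⟨z, left_mem_segment ℝ z z', rfl⟩ himg ⟨z', right_mem_segment ℝ z z', rfl⟩

/-- A face is determined by finite data at a generic point: a hyperplane of `P` through it, the
orientation of the face normal relative to that hyperplane, and the position of the point with
respect to every hyperplane of `P`. -/
theorem finite_flatFace (h : IsPiecewiseFlat U P) : Finite (FlatFace U) := by
  choose x hx hgen p hp hpx using h.exists_generic
  choose s hs using fun C : FlatFace U => hgen C (p C) (hp C) (hpx C)
  let f : FlatFace U → (P × SignType) × (P → SignType) := fun C =>
    ((⟨p C, hp C⟩, SignType.sign (s C)), fun q => SignType.sign (inner ℝ q.1.1 (x C) - q.1.2))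
  refine Finite.of_injective f fun C C' hCC' => ?_
  simp only [f, Prod.mk.injEq, Subtype.mk.injEq] at hCC'
  obtain ⟨⟨hpp, hss⟩, hsg⟩ := hCC'
  -- The face normal is a unit vector, so the factor `s C` is known up to sign from the hyperplane;
  -- its sign is part of the data.
  have habs : ∀ C : FlatFace U, |s C| = ‖(p C).1‖ := fun C => by
    rw [hs C, norm_smul, C.norm_normal, mul_one, Real.norm_eq_abs]
  have hseq : s C = s C' := by
    rw [← sign_mul_abs (s C), ← sign_mul_abs (s C'), hss, habs, habs, hpp]
  have hs0 : s C ≠ 0 := fun h0 => h.ne_zero _ (hp C) (by rw [hs C, h0, zero_smul])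
  have hnn : C.normal = C'.normal := by
    refine smul_right_injective _ hs0 ?_
    change s C • C.normal = s C • C'.normal
    rw [← hs C, hseq, ← hs C', hpp]
  have hlev : C.level = C'.level := by
    have h1 : ∀ C : FlatFace U, s C * C.level = (p C).2 := fun C => by
      rw [← (C.carrier_subset (hx C)).1, ← hpx C, congrArg (fun v => inner ℝ v (x C)) (hs C), real_inner_smul_left]
    refine mul_left_cancel₀ hs0 ?_
    rw [h1 C, hseq, h1 C', hpp]
  have hx1 := C.carrier_subset (hx C)
  have hx2 := C'.carrier_subset (hx C')
  rw [← hnn, ← hlev] at hx2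
  have h1 := h.mem_connectedComponentIn_of_sign_eq C.norm_normal hx1 hx2 (hgen C)
    fun q hq => congrFun hsg ⟨q, hq⟩
  rw [← C.carrier_eq (hx C)] at h1
  exact FlatFace.eq_of_mem h1 (hx C')

end IsPiecewiseFlat

/-! ### Localization of the divergence theorem. -/

/-- A finite smooth partition of unity subordinate to balls, on a compact set. -/
theorem exists_finite_partition {m : ℕ} {k : Set (Eu m)} (hk : IsCompact k) (r : Eu m → ℝ)
    (hr : ∀ x ∈ k, 0 < r x) :
    ∃ (t : Finset (Eu m)) (f : Eu m → Eu m → ℝ), (∀ x ∈ t, x ∈ k) ∧ (∀ x, ContDiff ℝ ∞ (f x)) ∧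
      (∀ x ∈ t, tsupport (f x) ⊆ Metric.ball x (r x)) ∧ ∀ y ∈ k, ∑ x ∈ t, f x y = 1 := by
  classical
  obtain ⟨t, htk, ht⟩ := hk.elim_nhds_subcover (fun x => Metric.ball x (r x))
    fun x hx => Metric.ball_mem_nhds x (hr x hx)
  obtain ⟨f, hf⟩ := SmoothPartitionOfUnity.exists_isSubordinate (ι := t) (modelWithCornersSelf ℝ (Eu m))
    hk.isClosed (fun x => Metric.ball x.1 (r x)) (fun _ => Metric.isOpen_ball)
    (by simpa [Set.iUnion_subtype] using ht)
  refine ⟨t, fun x y => if hx : x ∈ t then f ⟨x, hx⟩ y else 0, htk, fun x => ?_, fun x hx => ?_,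
    fun y hy => ?_⟩
  · by_cases hx : x ∈ t
    · simpa [hx] using (f ⟨x, hx⟩).contMDiff.contDiff
    · simpa [hx] using contDiff_const
  · simpa [hx] using hf ⟨x, hx⟩
  · rw [← f.sum_eq_one hy, finsum_eq_sum_of_fintype, ← Finset.sum_coe_sort t]
    exact Finset.sum_congr rfl fun x _ => by simp

/-- `w` is continuous on the closure of `U` and has the bounded continuous derivative `dw`
in `U`. -/
structure IsC1Upto {m : ℕ} (U : Set (Eu m)) (w : Eu m → ℝ) (dw : Eu m → Eu m →L[ℝ] ℝ) :
    Prop where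
  continuousOn : ContinuousOn w (closure U)
  hasFDerivAt : ∀ x ∈ U, HasFDerivAt w (dw x) x
  continuousOn_deriv : ContinuousOn dw U
  bounded : ∃ M, ∀ x ∈ U, ‖dw x‖ ≤ M

namespace IsC1Upto

variable {m : ℕ} {U : Set (Eu m)} {w : Eu m → ℝ} {dw : Eu m → Eu m →L[ℝ] ℝ}

theorem exists_bound (h : IsC1Upto U w dw) (hU : Bornology.IsBounded U) :
    ∃ M, ∀ x ∈ closure U, ‖w x‖ ≤ M :=
  hU.isCompact_closure.exists_bound_of_continuousOn h.continuousOn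

theorem mul_smooth (h : IsC1Upto U w dw) (hU : Bornology.IsBounded U) {θ : Eu m → ℝ}
    (hθ : ContDiff ℝ ∞ θ) :
    IsC1Upto U (fun x => θ x * w x) (fun x => θ x • dw x + w x • fderiv ℝ θ x) where
  continuousOn := hθ.continuous.continuousOn.mul h.continuousOn
  hasFDerivAt x hx := ((hθ.differentiable (by simp)) x).hasFDerivAt.mul (h.hasFDerivAt x hx)
  continuousOn_deriv := (hθ.continuous.continuousOn.smul h.continuousOn_deriv).add
    ((h.continuousOn.mono subset_closure).smul
      (hθ.continuous_fderiv (by simp)).continuousOn)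
  bounded := by
    obtain ⟨M₁, h₁⟩ := h.bounded
    obtain ⟨M₂, h₂⟩ := h.exists_bound hU
    obtain ⟨M₃, h₃⟩ := hU.isCompact_closure.exists_bound_of_continuousOn hθ.continuous.continuousOn
    obtain ⟨M₄, h₄⟩ := hU.isCompact_closure.exists_bound_of_continuousOn
      (hθ.continuous_fderiv (by simp)).continuousOn
    refine ⟨M₃ * M₁ + M₂ * M₄, fun x hx => (norm_add_le _ _).trans ?_⟩
    have hxc := subset_closure hx
    rw [norm_smul, norm_smul]
    exact add_le_add
      (mul_le_mul (h₃ x hxc) (h₁ x hx) (norm_nonneg _) ((norm_nonneg _).trans (h₃ x hxc)))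
      (mul_le_mul (h₂ x hxc) (h₄ x hxc) (norm_nonneg _) ((norm_nonneg _).trans (h₂ x hxc)))

theorem integrableOn_deriv (h : IsC1Upto U w dw) (hUo : IsOpen U) (hU : Bornology.IsBounded U)
    (a : Eu m) : IntegrableOn (fun x => dw x a) U := by
  obtain ⟨M, hM⟩ := h.bounded
  have : IsFiniteMeasure (volume.restrict U) := isFiniteMeasure_restrict.2 hU.measure_lt_top.ne
  refine Integrable.of_bound
    ((h.continuousOn_deriv.clm_apply continuousOn_const).aestronglyMeasurable hUo.measurableSet)
    (M * ‖a‖) ?_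
  refine (ae_restrict_mem hUo.measurableSet).mono fun x hx => ?_
  exact ((dw x).le_opNorm a).trans (by gcongr; exact hM x hx)

end IsC1Upto

/-- The divergence theorem in `U`, with the boundary integral over the flat faces. -/
def HasDivergenceFormula {d : ℕ} (U : Set (Eu (d + 1))) (w : Eu (d + 1) → ℝ)
    (dw : Eu (d + 1) → Eu (d + 1) →L[ℝ] ℝ) : Prop :=
  ∀ a, ∫ x in U, dw x a =
    ∑ᶠ C : FlatFace U, inner ℝ C.normal a * ∫ x in C.carrier, w x ∂μHE[d]

section Local

variable {d : ℕ} {U : Set (Eu (d + 1))} {w : Eu (d + 1) → ℝ}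
  {dw : Eu (d + 1) → Eu (d + 1) →L[ℝ] ℝ} {θ : Eu (d + 1) → ℝ}

/-- The divergence theorem for a function that is cut off in a ball in which `U` is a
half-space. -/
theorem setIntegral_deriv_of_halfSpace_in_ball (hUo : IsOpen U) (hU : Bornology.IsBounded U)
    (h : IsC1Upto U w dw) (hθ : ContDiff ℝ ∞ θ) {x : Eu (d + 1)} {r : ℝ}
    (hθs : tsupport θ ⊆ Metric.ball x r) {n : Eu (d + 1)} (hn : ‖n‖ = 1) {c : ℝ}
    (hb : ∀ y ∈ Metric.ball x r, (y ∈ U ↔ inner ℝ n y < c)) (a : Eu (d + 1)) :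
    ∫ x in U, (θ x • dw x + w x • fderiv ℝ θ x) a =
      inner ℝ n a * ∫ x in {x | inner ℝ n x = c}, θ x * w x ∂μHE[d] := by
  have hp := h.mul_smooth hU hθ
  set W := fun x => θ x * w x with hW
  set dW := fun x => θ x • dw x + w x • fderiv ℝ θ x with hdW
  have hW0 : ∀ y ∉ tsupport θ, W =ᶠ[𝓝 y] fun _ => 0 := fun y hy => by
    filter_upwards [notMem_tsupport_iff_eventuallyEq.1 hy] with z hz
    simp [hW, hz]
  have hdW0 : ∀ y ∉ tsupport θ, dW y = 0 := fun y hy => by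
    simp [hdW, image_eq_zero_of_notMem_tsupport hy,
      image_eq_zero_of_notMem_tsupport (fun h => hy (tsupport_fderiv_subset ℝ h))]
  have hcl : ∀ y ∈ Metric.ball x r, inner ℝ n y ≤ c → y ∈ closure U := fun y hy hyc => by
    rw [Metric.mem_closure_iff]
    intro ε hε
    obtain ⟨t, ht0, -, ht⟩ := exists_small_smul_mem_ball y (-n)
      (lt_min (sub_pos.2 (Metric.mem_ball.1 hy)) hε)
    refine ⟨y + t • (-n), (hb _ ?_).2 ?_, ?_⟩
    · rw [Metric.mem_ball] at *
      have := lt_of_lt_of_le ht (min_le_left _ _)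
      linarith [dist_triangle (y + t • (-n)) y x]
    · rw [inner_add_right, inner_smul_right, inner_neg_right, real_inner_self_eq_norm_sq, hn]
      linarith
    · rw [dist_comm]
      exact lt_of_lt_of_le ht (min_le_right _ _)
  have hmeas : MeasurableSet {x : Eu (d + 1) | inner ℝ n x < c} :=
    (isOpen_lt (by fun_prop) continuous_const).measurableSet
  -- `U` and the half-space agree in the ball, and the cut-off derivative vanishes outside of it, so
  -- both integrals reduce to `V`.
  set V := U ∩ Metric.ball x r with hV
  have hVmeas : MeasurableSet V := hUo.measurableSet.inter measurableSet_ball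
  have hVsub : V ⊆ {x | inner ℝ n x < c} := fun y hy => (hb y hy.2).1 hy.1
  have hVout : ∀ s ∈ ({U, {x | inner ℝ n x < c}} : Set (Set (Eu (d + 1)))), ∀ a, ∀ y ∈ s \ V,
      dW y a = 0 := by
    intro s hs a y hy
    rw [hdW0 y, zero_apply]
    intro hyt
    have hyb := hθs hyt
    rcases hs with rfl | rfl
    · exact hy.2 ⟨hy.1, hyb⟩
    · exact hy.2 ⟨(hb y hyb).2 hy.1, hyb⟩
  have h1 := setIntegral_eq_of_subset_of_forall_sdiff_eq_zero (μ := volume) hUo.measurableSet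
    (Set.inter_subset_left : V ⊆ U) (hVout U (by simp) a)
  have h2 := setIntegral_eq_of_subset_of_forall_sdiff_eq_zero (μ := volume) hmeas hVsub
    (hVout _ (by simp) a)
  rw [h1, ← h2]
  have hcomp : HasCompactSupport θ :=
    HasCompactSupport.of_support_subset_isCompact (isCompact_closedBall x r)
      ((subset_tsupport θ).trans (hθs.trans Metric.ball_subset_closedBall))
  refine integral_halfSpace hn ?_ ?_ hcomp.mul_right (fun a => ?_) a
  · intro y hy
    by_cases hyt : y ∈ tsupport θ
    · have hyb := hθs hyt
      refine (hp.continuousOn y (hcl y hyb hy)).mono_of_mem_nhdsWithin ?_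
      refine mem_nhdsWithin.2 ⟨_, Metric.isOpen_ball, hyb, fun z hz => hcl z hz.1 hz.2⟩
    · exact (continuousAt_const.congr (hW0 y hyt).symm).continuousWithinAt
  · intro y hy
    by_cases hyt : y ∈ tsupport θ
    · exact hp.hasFDerivAt y ((hb y (hθs hyt)).2 hy)
    · rw [hdW0 y hyt]
      exact (hasFDerivAt_const (0 : ℝ) y).congr_of_eventuallyEq (hW0 y hyt)
  · exact ((hp.integrableOn_deriv hUo hU a).mono_set Set.inter_subset_left).of_forall_sdiff_eq_zero
      hmeas (hVout _ (by simp) a)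

/-- A ball inside `U` may be regarded as lying in any half-space `⟪n, y⟫ < ⟪n, x⟫ + r`. Its bounding
plane misses the open ball, so all boundary terms vanish. -/
theorem HasDivergenceFormula.of_mem (hUo : IsOpen U) (hU : Bornology.IsBounded U)
    (h : IsC1Upto U w dw) (hθ : ContDiff ℝ ∞ θ) {x : Eu (d + 1)} {r : ℝ}
    (hθs : tsupport θ ⊆ Metric.ball x r) (hb : Metric.ball x r ⊆ U) :
    HasDivergenceFormula U (fun x => θ x * w x) (fun x => θ x • dw x + w x • fderiv ℝ θ x) := by
  intro a
  have hn : ‖EuclideanSpace.single (0 : Fin (d + 1)) (1 : ℝ)‖ = 1 := by simp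
  set n := EuclideanSpace.single (0 : Fin (d + 1)) (1 : ℝ)
  have hlt : ∀ y ∈ Metric.ball x r, inner ℝ n y < inner ℝ n x + r := fun y hy => by
    have h1 : inner ℝ n (y - x) ≤ ‖n‖ * ‖y - x‖ := real_inner_le_norm _ _
    rw [hn, one_mul, inner_sub_right, ← dist_eq_norm] at h1
    linarith [Metric.mem_ball.1 hy]
  rw [setIntegral_deriv_of_halfSpace_in_ball hUo hU h hθ hθs hn
    (fun y hy => ⟨fun _ => hlt y hy, fun _ => hb hy⟩) a]
  have h0 : ∀ y ∉ Metric.ball x r, θ y * w y = 0 := fun y hy => by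
    rw [image_eq_zero_of_notMem_tsupport fun hyt => hy (hθs hyt), zero_mul]
  have h1 : ∫ y in {y | inner ℝ n y = inner ℝ n x + r}, θ y * w y ∂μHE[d] = 0 :=
    setIntegral_eq_zero_of_forall_eq_zero fun y hy => h0 y fun hyb => (hlt y hyb).ne hy
  rw [h1, mul_zero]
  refine (finsum_eq_zero_of_forall_eq_zero fun C => ?_).symm
  rw [setIntegral_eq_zero_of_forall_eq_zero, mul_zero]
  refine fun y hy => h0 y fun hyb => ?_
  have := C.carrier_subset_frontier hy
  rw [hUo.frontier_eq] at this
  exact this.2 (hb hyb)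

/-- In the ball the face `C` is the whole plane section and no other face appears, so the boundary
integral of the half-space is the one over `C`. -/
theorem HasDivergenceFormula.of_flat (hUo : IsOpen U) (hU : Bornology.IsBounded U)
    (h : IsC1Upto U w dw) (hθ : ContDiff ℝ ∞ θ) {x : Eu (d + 1)} {r : ℝ}
    (hθs : tsupport θ ⊆ Metric.ball x r) (C : FlatFace U)
    (hb : ∀ y ∈ Metric.ball x r, (y ∈ U ↔ inner ℝ C.normal y < C.level) ∧
      ∀ C' : FlatFace U, y ∈ C'.carrier ↔ C' = C ∧ inner ℝ C.normal y = C.level) :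
    HasDivergenceFormula U (fun x => θ x * w x) (fun x => θ x • dw x + w x • fderiv ℝ θ x) := by
  intro a
  rw [setIntegral_deriv_of_halfSpace_in_ball hUo hU h hθ hθs C.norm_normal
    (fun y hy => (hb y hy).1) a]
  have h0 : ∀ y ∉ Metric.ball x r, θ y * w y = 0 := fun y hy => by
    rw [image_eq_zero_of_notMem_tsupport fun hyt => hy (hθs hyt), zero_mul]
  rw [finsum_eq_single _ C]
  · congr 1
    refine setIntegral_eq_of_subset_of_forall_sdiff_eq_zero
      (isClosed_eq (by fun_prop) continuous_const).measurableSet C.carrier_subset_plane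
      fun y hy => h0 y fun hyb => hy.2 (((hb y hyb).2 C).2 ⟨rfl, hy.1⟩)
  · intro C' hC'
    rw [setIntegral_eq_zero_of_forall_eq_zero, mul_zero]
    exact fun y hy => h0 y fun hyb => hC' (((hb y hyb).2 C').1 hy).1

theorem HasDivergenceFormula.of_eq_zero (hUo : IsOpen U)
    (h : IsC1Upto U w dw) {x : Eu (d + 1)} {r : ℝ}
    (hθs : tsupport θ ⊆ Metric.ball x r) (hb : ∀ y ∈ Metric.ball x r ∩ closure U, w y = 0) :
    HasDivergenceFormula U (fun x => θ x * w x) (fun x => θ x • dw x + w x • fderiv ℝ θ x) := by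
  intro a
  have h0 : ∀ y ∈ closure U, θ y * w y = 0 := fun y hy => by
    by_cases hyb : y ∈ Metric.ball x r
    · rw [hb y ⟨hyb, hy⟩, mul_zero]
    · rw [image_eq_zero_of_notMem_tsupport fun hyt => hyb (hθs hyt), zero_mul]
  rw [setIntegral_eq_zero_of_forall_eq_zero]
  · refine (finsum_eq_zero_of_forall_eq_zero fun C => ?_).symm
    rw [setIntegral_eq_zero_of_forall_eq_zero, mul_zero]
    exact fun y hy => h0 y (C.carrier_subset_frontier hy).1
  · intro y hy
    by_cases hyb : y ∈ Metric.ball x r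
    · have h1 : HasFDerivAt w (0 : Eu (d + 1) →L[ℝ] ℝ) y := by
        refine (hasFDerivAt_const (0 : ℝ) y).congr_of_eventuallyEq ?_
        filter_upwards [(Metric.isOpen_ball.inter hUo).mem_nhds ⟨hyb, hy⟩] with z hz
        exact hb z ⟨hz.1, subset_closure hz.2⟩
      simp only [(h.hasFDerivAt y hy).unique h1, hb y ⟨hyb, subset_closure hy⟩]
      simp
    · have hyt : y ∉ tsupport θ := fun hyt => hyb (hθs hyt)
      simp [image_eq_zero_of_notMem_tsupport hyt,
        image_eq_zero_of_notMem_tsupport (fun h => hyt (tsupport_fderiv_subset ℝ h))]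

end Local

namespace FlatFace

variable {d : ℕ} {U : Set (Eu (d + 1))}

theorem isOpen_preimage (hUo : IsOpen U) (C : FlatFace U) {L : Eu d →ₗᵢ[ℝ] Eu (d + 1)}
    (hL : ∀ y, inner ℝ C.normal (L y) = 0) :
    IsOpen ((fun y => L y + C.level • C.normal) ⁻¹' C.carrier) := by
  rw [Metric.isOpen_iff]
  intro y hy
  obtain ⟨r, hr, h⟩ := C.exists_ball hUo hy
  refine ⟨r, hr, fun z hz => ((h _ ?_).2 C).2 ⟨rfl, inner_plane C.norm_normal hL _ z⟩⟩
  rw [Metric.mem_ball, (isometry_plane C.level).dist_eq]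
  exact hz

theorem measurableSet_carrier (hUo : IsOpen U) (C : FlatFace U) : MeasurableSet C.carrier := by
  obtain ⟨L, hL, hL'⟩ := exists_hyperplane_isometry C.normal C.norm_normal
  have h := (measurableEmbedding_plane (n := C.normal) (L := L) C.level).measurableSet_image'
    (C.isOpen_preimage hUo hL).measurableSet
  rwa [Set.image_preimage_eq_inter_range, range_plane C.norm_normal hL hL',
    Set.inter_eq_left.2 C.carrier_subset_plane] at h

theorem measure_carrier_lt_top (hU : Bornology.IsBounded U) (C : FlatFace U) :
    (μHE[d] : Measure (Eu (d + 1))) C.carrier < ⊤ := by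
  obtain ⟨L, hL, hL'⟩ := exists_hyperplane_isometry C.normal C.norm_normal
  have h := map_plane_volume C.norm_normal hL hL' C.level
  rw [← Measure.restrict_eq_self _ C.carrier_subset_plane, ← h,
    (measurableEmbedding_plane (n := C.normal) (L := L) C.level).map_apply]
  refine Bornology.IsBounded.measure_lt_top ?_
  refine (isometry_plane (n := C.normal) (L := L) C.level).antilipschitz.isBounded_preimage ?_
  exact hU.closure.subset (C.carrier_subset_frontier.trans frontier_subset_closure)

theorem integrableOn_of_continuousOn (hUo : IsOpen U) (hU : Bornology.IsBounded U)
    (C : FlatFace U) {w : Eu (d + 1) → ℝ} (hw : ContinuousOn w (closure U)) :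
    IntegrableOn w C.carrier μHE[d] := by
  have hsub : C.carrier ⊆ closure U := C.carrier_subset_frontier.trans frontier_subset_closure
  obtain ⟨M, hM⟩ := hU.isCompact_closure.exists_bound_of_continuousOn hw
  have hm := C.measurableSet_carrier hUo
  have : IsFiniteMeasure ((μHE[d] : Measure (Eu (d + 1))).restrict C.carrier) :=
    isFiniteMeasure_restrict.2 (C.measure_carrier_lt_top hU).ne
  exact Integrable.of_bound ((hw.mono hsub).aestronglyMeasurable hm) M
    ((ae_restrict_mem hm).mono fun x hx => hM x (hsub hx))

end FlatFace

/-- The divergence theorem for functions that vanish near the singular part of the boundary. -/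
theorem IsPiecewiseFlat.hasDivergenceFormula_of_eq_zero {d : ℕ} {U : Set (Eu (d + 1))}
    {P : Finset (Eu (d + 1) × ℝ)} (hP : IsPiecewiseFlat U P) {w : Eu (d + 1) → ℝ}
    {dw : Eu (d + 1) → Eu (d + 1) →L[ℝ] ℝ} (h : IsC1Upto U w dw)
    (h0 : ∀ x ∈ frontier U, (∃ C : FlatFace U, x ∈ C.carrier) ∨
      ∃ r > 0, ∀ y ∈ Metric.ball x r ∩ closure U, w y = 0) :
    HasDivergenceFormula U w dw := by
  have hUo := hP.isOpen
  have hU := hP.isBounded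
  have hloc : ∀ x ∈ closure U, ∃ r > 0, ∀ θ : Eu (d + 1) → ℝ, ContDiff ℝ ∞ θ →
      tsupport θ ⊆ Metric.ball x r → HasDivergenceFormula U (fun x => θ x * w x)
        (fun x => θ x • dw x + w x • fderiv ℝ θ x) := by
    intro x hx
    by_cases hxU : x ∈ U
    · obtain ⟨r, hr, hb⟩ := Metric.isOpen_iff.1 hUo x hxU
      exact ⟨r, hr, fun θ hθ hs => .of_mem hUo hU h hθ hs hb⟩
    rcases h0 x (by rw [hUo.frontier_eq]; exact ⟨hx, hxU⟩) with ⟨C, hC⟩ | ⟨r, hr, hb⟩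
    · obtain ⟨r, hr, hb⟩ := C.exists_ball hUo hC
      exact ⟨r, hr, fun θ hθ hs => .of_flat hUo hU h hθ hs C hb⟩
    · exact ⟨r, hr, fun θ hθ hs => .of_eq_zero hUo h hs hb⟩
  choose! r hr hdiv using hloc
  obtain ⟨t, f, htk, hf, hfs, hsum⟩ := exists_finite_partition hU.isCompact_closure r hr
  have := hP.finite_flatFace
  have := Fintype.ofFinite (FlatFace U)
  intro a
  have hL : ∫ x in U, dw x a =
      ∑ i ∈ t, ∫ x in U, (f i x • dw x + w x • fderiv ℝ (f i) x) a := by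
    rw [← integral_finsetSum _ fun i _ => (h.mul_smooth hU (hf i)).integrableOn_deriv hUo hU a]
    refine setIntegral_congr_fun hUo.measurableSet fun x hx => ?_
    -- Since the cutoffs sum to one near `x`, the terms in which they are differentiated cancel.
    have hd : ∑ i ∈ t, fderiv ℝ (f i) x = 0 := by
      rw [← fderiv_fun_sum fun i _ => (hf i).differentiable (by simp) x]
      refine ((hasFDerivAt_const (1 : ℝ) x).congr_of_eventuallyEq ?_).fderiv
      filter_upwards [hUo.mem_nhds hx] with y hy using hsum y (subset_closure hy)
    have e : ∑ i ∈ t, (f i x • dw x + w x • fderiv ℝ (f i) x) a =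
        (∑ i ∈ t, f i x) * dw x a + w x * (∑ i ∈ t, fderiv ℝ (f i) x) a := by
      simp [Finset.sum_add_distrib, Finset.sum_mul, Finset.mul_sum]
    simp only [e, hd, hsum x (subset_closure hx)]
    simp
  have hR : ∀ C : FlatFace U, ∫ x in C.carrier, w x ∂μHE[d] =
      ∑ i ∈ t, ∫ x in C.carrier, f i x * w x ∂μHE[d] := fun C => by
    rw [← integral_finsetSum _ fun i _ =>
      C.integrableOn_of_continuousOn hUo hU (h.mul_smooth hU (hf i)).continuousOn]
    refine setIntegral_congr_fun (C.measurableSet_carrier hUo) fun x hx => ?_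
    rw [← Finset.sum_mul, hsum x (C.carrier_subset_frontier hx).1, one_mul]
  rw [hL, finsum_eq_sum_of_fintype]
  simp_rw [hR, Finset.mul_sum]
  rw [Finset.sum_comm]
  refine Finset.sum_congr rfl fun i hi => ?_
  rw [hdiv i (htk i hi) (f i) (hf i) (hfs i hi) a, finsum_eq_sum_of_fintype]

/-! ### Cutoff functions near planes of codimension two. -/

section Cutoff

variable {m : ℕ} {u₁ u₂ : Eu m}

/-- Gram–Schmidt: take the component of `u₁` orthogonal to `u₂` and rescale it. This makes the pair
of linear forms surjective. -/
theorem exists_inner_eq_one_and_zero (h : LinearIndependent ℝ ![u₁, u₂]) :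
    ∃ v, inner ℝ u₁ v = (1 : ℝ) ∧ inner ℝ u₂ v = (0 : ℝ) := by
  have h2 : u₂ ≠ 0 := h.ne_zero 1
  set b := inner ℝ u₂ u₁ / inner ℝ u₂ u₂ with hb
  set v := u₁ - b • u₂ with hv
  have h22 : (inner ℝ u₂ u₂ : ℝ) ≠ 0 := inner_self_ne_zero.2 h2
  have h2v : inner ℝ u₂ v = (0 : ℝ) := by
    rw [hv, inner_sub_right, inner_smul_right, hb, div_mul_cancel₀ _ h22, sub_self]
  have hv0 : v ≠ 0 := fun h0 => by
    have := LinearIndependent.pair_iff.1 h 1 (-b) (by rw [one_smul, neg_smul, ← sub_eq_add_neg]; exact h0)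
    exact one_ne_zero this.1
  have h1v : inner ℝ u₁ v = (inner ℝ v v : ℝ) := by
    conv_rhs => rw [hv, inner_sub_left, inner_smul_left, ← hv, h2v]
    simp
  have hvv : (inner ℝ v v : ℝ) ≠ 0 := inner_self_ne_zero.2 hv0
  refine ⟨(inner ℝ v v : ℝ)⁻¹ • v, ?_, ?_⟩
  · rw [inner_smul_right, h1v, inv_mul_cancel₀ hvv]
  · rw [inner_smul_right, h2v, mul_zero]

/-- A tube of radius `ε` around a plane of codimension two has volume `O(ε²)` in bounded sets. -/
theorem exists_volume_tube_le (h : LinearIndependent ℝ ![u₁, u₂]) (d₁ d₂ : ℝ) {U : Set (Eu m)}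
    (hU : Bornology.IsBounded U) :
    ∃ C : ℝ≥0, ∀ ε : ℝ≥0, volume {x ∈ U | |inner ℝ u₁ x - d₁| ≤ ε ∧ |inner ℝ u₂ x - d₂| ≤ ε} ≤
      C * ε ^ 2 := by
  obtain ⟨v₁, h11, h21⟩ := exists_inner_eq_one_and_zero h
  obtain ⟨v₂, h22, h12⟩ := exists_inner_eq_one_and_zero (LinearIndependent.pair_symm_iff.1 h)
  let f : Eu m →ₗ[ℝ] ℝ × ℝ := (innerₛₗ ℝ u₁).prod (innerₛₗ ℝ u₂)
  have hf : LinearMap.range f = ⊤ := by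
    refine LinearMap.range_eq_top.2 fun p => ⟨p.1 • v₁ + p.2 • v₂, ?_⟩
    simp [f, inner_add_right, inner_smul_right, h11, h21, h22, h12]
  set N := LinearMap.ker f
  let g : Eu m →ₗ[ℝ] N := (N.orthogonalProjectionOnto : Eu m →L[ℝ] N).toLinearMap
  have hg : LinearMap.range g = ⊤ :=
    LinearMap.range_eq_top.2 fun y => ⟨y, Submodule.orthogonalProjectionOnto_mem_subspace_eq_self y⟩
  have hfg : IsCompl (LinearMap.ker f) (LinearMap.ker g) := by
    have : LinearMap.ker g = Nᗮ := N.ker_orthogonalProjectionOnto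
    rw [this]
    exact N.isCompl_orthogonal
  -- Linear coordinates: the two forms, and the projection onto their common kernel. The image of
  -- volume is a constant multiple of the product measure.
  let T := (LinearMap.equivProdOfSurjectiveOfIsCompl f g hf hg hfg).toContinuousLinearEquiv
  obtain ⟨R, hR⟩ := hU.exists_norm_le
  have hT : ∀ x, T x = ((inner ℝ u₁ x, inner ℝ u₂ x), N.orthogonalProjectionOnto x) := fun x => rfl
  set ν : Measure ((ℝ × ℝ) × N) :=
    ((volume : Measure ℝ).prod (volume : Measure ℝ)).prod (volume : Measure N)
  have : ν.IsAddHaarMeasure := by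
    have h1 : ((volume : Measure ℝ).prod (volume : Measure ℝ)).IsAddHaarMeasure := inferInstance
    have h2 : (volume : Measure N).IsAddHaarMeasure := inferInstance
    exact Measure.prod.instIsAddHaarMeasure _ _
  have hmap := Measure.isAddLeftInvariant_eq_smul ((volume : Measure (Eu m)).map T) ν
  set c := Measure.addHaarScalarFactor ((volume : Measure (Eu m)).map T) ν
  have hball : volume (Metric.closedBall (0 : N) R) ≠ ⊤ := measure_closedBall_lt_top.ne
  -- `c` is the Jacobian factor of the coordinates, and `4 ε²` is the product of the lengths of two
  -- intervals of radius `ε`.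
  refine ⟨c * 4 * (volume (Metric.closedBall (0 : N) R)).toNNReal, fun ε => ?_⟩
  have hsub : {x ∈ U | |inner ℝ u₁ x - d₁| ≤ ε ∧ |inner ℝ u₂ x - d₂| ≤ ε} ⊆
      T ⁻¹' ((Metric.closedBall d₁ ε ×ˢ Metric.closedBall d₂ ε) ×ˢ Metric.closedBall (0 : N) R) := by
    rintro x ⟨hxU, hx1, hx2⟩
    refine ⟨⟨by simpa [hT, Real.dist_eq] using hx1, by simpa [hT, Real.dist_eq] using hx2⟩, ?_⟩
    rw [hT, mem_closedBall_zero_iff]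
    exact (N.norm_orthogonalProjectionOnto_apply_le x).trans (hR x hxU)
  refine (measure_mono hsub).trans ?_
  rw [← Measure.map_apply T.continuous.measurable ((Metric.isClosed_closedBall.prod
    Metric.isClosed_closedBall).prod Metric.isClosed_closedBall).measurableSet, hmap,
    Measure.smul_apply, Measure.prod_prod, Measure.prod_prod, Real.volume_closedBall,
    Real.volume_closedBall,
    ENNReal.ofReal_mul two_pos.le, ENNReal.ofReal_coe_nnreal]
  push_cast
  rw [ENNReal.coe_toNNReal hball, ENNReal.smul_def, smul_eq_mul]
  have : ENNReal.ofReal 2 = 2 := by simp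
  rw [this]
  refine le_of_eq ?_
  ring

/-- Cutoff functions near a plane of codimension two. -/
theorem exists_cutoff (h : LinearIndependent ℝ ![u₁, u₂]) (d₁ d₂ : ℝ) {U : Set (Eu m)}
    (hUo : IsOpen U) (hU : Bornology.IsBounded U) (a : Eu m) :
    ∃ η : ℕ → Eu m → ℝ, (∀ k, ContDiff ℝ ∞ (η k)) ∧ (∀ k x, |η k x| ≤ 1) ∧
      (∀ k x, inner ℝ u₁ x = d₁ → inner ℝ u₂ x = d₂ → ∀ᶠ y in 𝓝 x, η k y = 0) ∧
      (∀ x, ¬ (inner ℝ u₁ x = d₁ ∧ inner ℝ u₂ x = d₂) → Tendsto (η · x) atTop (𝓝 1)) ∧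
      Tendsto (fun k => ∫ x in U, |fderiv ℝ (η k) x a|) atTop (𝓝 0) := by
  -- The cutoff is one minus a product of bumps in the two forms, each rescaled by `k + 1`; the bump
  -- is one near `0` and vanishes beyond distance `2`.
  let β : ContDiffBump (0 : ℝ) := ⟨1, 2, one_pos, one_lt_two⟩
  have hβ : ContDiff ℝ ∞ β := β.contDiff
  have hβ1 : ∀ t, |β t| ≤ 1 := fun t => by rw [abs_of_nonneg β.nonneg]; exact β.le_one
  obtain ⟨M, hM⟩ : ∃ M, ∀ t, ‖deriv β t‖ ≤ M := by
    refine (hβ.continuous_deriv (by simp)).bounded_above_of_compact_support ?_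
    exact β.hasCompactSupport.deriv
  have hM0 : 0 ≤ M := (norm_nonneg _).trans (hM 0)
  let ℓ : Eu m → ℝ → ℕ → Eu m → ℝ := fun u d k x => (k + 1) * (inner ℝ u x - d)
  have hℓ : ∀ u d k, ContDiff ℝ ∞ (ℓ u d k) := fun u d k =>
    contDiff_const.mul ((contDiff_const.inner ℝ contDiff_id).sub contDiff_const)
  have hℓ' : ∀ u d k x, HasFDerivAt (ℓ u d k) (((k : ℝ) + 1) • innerSL ℝ u) x := fun u d k x =>
    ((innerSL ℝ u).hasFDerivAt.sub_const d).const_mul ((k : ℝ) + 1)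
  let η : ℕ → Eu m → ℝ := fun k x => 1 - β (ℓ u₁ d₁ k x) * β (ℓ u₂ d₂ k x)
  have hη : ∀ k, ContDiff ℝ ∞ (η k) := fun k =>
    contDiff_const.sub ((hβ.comp (hℓ _ _ k)).mul (hβ.comp (hℓ _ _ k)))
  have hη' : ∀ k x, fderiv ℝ (η k) x a = -(((k : ℝ) + 1) *
      (β (ℓ u₁ d₁ k x) * (deriv β (ℓ u₂ d₂ k x) * inner ℝ u₂ a) +
        β (ℓ u₂ d₂ k x) * (deriv β (ℓ u₁ d₁ k x) * inner ℝ u₁ a))) := by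
    intro k x
    have hd : ∀ t, HasDerivAt β (deriv β t) t := fun t =>
      (hβ.differentiable (by simp) t).hasDerivAt
    have h1 := (hd (ℓ u₁ d₁ k x)).comp_hasFDerivAt x (hℓ' u₁ d₁ k x)
    have h2 := (hd (ℓ u₂ d₂ k x)).comp_hasFDerivAt x (hℓ' u₂ d₂ k x)
    have h3 : HasFDerivAt (η k) _ x := (h1.mul h2).const_sub 1
    rw [h3.fderiv]
    simp only [neg_apply, add_apply, smul_apply, innerSL_apply_apply, smul_eq_mul, Function.comp]
    ring
  have hsupp : ∀ t, 2 < |t| → β t = 0 ∧ deriv β t = 0 := by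
    intro t ht
    have h1 : t ∉ tsupport β := by
      rw [β.tsupport_eq, Metric.mem_closedBall, Real.dist_eq, sub_zero]
      exact not_le.2 ht
    exact ⟨image_eq_zero_of_notMem_tsupport h1,
      image_eq_zero_of_notMem_tsupport fun h2 => h1 (tsupport_deriv_subset h2)⟩
  refine ⟨η, hη, fun k x => ?_, fun k x h1 h2 => ?_, fun x hx => ?_, ?_⟩
  · have h1 := β.nonneg (x := ℓ u₁ d₁ k x)
    have h2 := β.nonneg (x := ℓ u₂ d₂ k x)
    have h3 := β.le_one (x := ℓ u₁ d₁ k x)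
    have h4 := β.le_one (x := ℓ u₂ d₂ k x)
    simp only [η]
    rw [abs_le]
    constructor <;> nlinarith
  · have hone : ∀ u d, inner ℝ u x = d → ∀ᶠ y in 𝓝 x, β (ℓ u d k y) = 1 := by
      intro u d hud
      have h0 : ℓ u d k x = 0 := by simp [ℓ, hud]
      have ht : Tendsto (ℓ u d k) (𝓝 x) (𝓝 0) := h0 ▸ (hℓ u d k).continuous.tendsto x
      exact ht.eventually β.eventuallyEq_one
    filter_upwards [hone u₁ d₁ h1, hone u₂ d₂ h2] with y hy1 hy2
    simp [η, hy1, hy2]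
  · have hz : ∀ u d, inner ℝ u x ≠ d → ∀ᶠ k in atTop, β (ℓ u d k x) = 0 := by
      intro u d hud
      have ht : Tendsto (fun k : ℕ => ((k : ℝ) + 1) * |inner ℝ u x - d|) atTop atTop :=
        (tendsto_atTop_add_const_right _ 1 tendsto_natCast_atTop_atTop).atTop_mul_const
          (abs_pos.2 (sub_ne_zero.2 hud))
      filter_upwards [ht.eventually_gt_atTop 2] with k hk
      refine (hsupp _ ?_).1
      simp only [ℓ]
      rwa [abs_mul, abs_of_pos (by positivity)]
    refine tendsto_const_nhds.congr' ?_
    rw [not_and_or] at hx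
    rcases hx with hx | hx
    · filter_upwards [hz _ _ hx] with k hk
      simp [η, hk]
    · filter_upwards [hz _ _ hx] with k hk
      simp [η, hk]
  · obtain ⟨C, hC⟩ := exists_volume_tube_le h d₁ d₂ hU
    set A := M * (|inner ℝ u₂ a| + |inner ℝ u₁ a|) with hA
    have hA0 : 0 ≤ A := by positivity
    have hbound : ∀ k : ℕ, ∫ x in U, |fderiv ℝ (η k) x a| ≤ (4 * A * C) * (1 / ((k : ℝ) + 1)) := by
      intro k
      -- The derivative lives in the tube of radius `ε = 2/(k+1)`, of volume at most `4 C/(k+1)²`,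
      -- and is at most `(k+1) A` there; the product is `4 A C/(k+1)`.
      set ε : ℝ≥0 := 2 / (k + 1) with hε
      have hεr : (ε : ℝ) = 2 / ((k : ℝ) + 1) := by simp [hε]
      set S := {x ∈ U | |inner ℝ u₁ x - d₁| ≤ ε ∧ |inner ℝ u₂ x - d₂| ≤ ε} with hS
      have hout : ∀ x ∈ U \ S, |fderiv ℝ (η k) x a| = 0 := by
        rintro x ⟨hxU, hxS⟩
        have : ε < |inner ℝ u₁ x - d₁| ∨ ε < |inner ℝ u₂ x - d₂| := by
          by_contra hcon
          push Not at hcon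
          exact hxS ⟨hxU, hcon⟩
        have hbig : ∀ u d, ε < |inner ℝ u x - d| → 2 < |ℓ u d k x| := by
          intro u d hud
          rw [hεr, div_lt_iff₀ (by positivity)] at hud
          simp only [ℓ]
          rwa [abs_mul, abs_of_pos (by positivity : (0 : ℝ) < k + 1), mul_comm]
        rcases this with h1 | h1
        · obtain ⟨h2, h3⟩ := hsupp _ (hbig _ _ h1)
          rw [hη', h2, h3]; simp
        · obtain ⟨h2, h3⟩ := hsupp _ (hbig _ _ h1)
          rw [hη', h2, h3]; simp
      have hSvol : volume S ≤ C * ε ^ 2 := hC ε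
      have hSfin : volume S < ⊤ := hSvol.trans_lt (by finiteness)
      rw [setIntegral_eq_of_subset_of_forall_sdiff_eq_zero hUo.measurableSet (Set.sep_subset _ _)
        hout]
      have hle : ∀ x ∈ S, ‖|fderiv ℝ (η k) x a|‖ ≤ (k + 1) * A := by
        intro x _
        rw [Real.norm_eq_abs, abs_abs, hη', abs_neg, abs_mul,
          abs_of_pos (by positivity : (0 : ℝ) < k + 1)]
        refine mul_le_mul_of_nonneg_left ?_ (by positivity)
        refine (abs_add_le _ _).trans ?_
        rw [abs_mul, abs_mul, abs_mul, abs_mul, hA, mul_add]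
        have b1 := hβ1 (ℓ u₁ d₁ k x)
        have b2 := hβ1 (ℓ u₂ d₂ k x)
        have b3 := hM (ℓ u₁ d₁ k x)
        have b4 := hM (ℓ u₂ d₂ k x)
        rw [Real.norm_eq_abs] at b3 b4
        refine add_le_add ?_ ?_
        · calc _ ≤ 1 * (M * |inner ℝ u₂ a|) := by gcongr
            _ = _ := one_mul _
        · calc _ ≤ 1 * (M * |inner ℝ u₁ a|) := by gcongr
            _ = _ := one_mul _
      have h1 := norm_setIntegral_le_of_norm_le_const (μ := volume) hSfin hle
      refine (le_abs_self _).trans (h1.trans ?_)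
      have h2 : volume.real S ≤ C * ε ^ 2 := by
        have := ENNReal.toReal_mono (by finiteness) hSvol
        simpa [Measure.real] using this
      refine (mul_le_mul_of_nonneg_left h2 (by positivity)).trans (le_of_eq ?_)
      rw [hεr]
      field_simp
      ring
    refine squeeze_zero (fun k => integral_nonneg fun x => abs_nonneg _) hbound ?_
    simpa using (tendsto_one_div_add_atTop_nhds_zero_nat (𝕜 := ℝ)).const_mul (4 * A * C)

end Cutoff

/-! ### The divergence theorem with singular boundary points. -/

namespace IsPiecewiseFlat

variable {d : ℕ} {U : Set (Eu (d + 1))} {P : Finset (Eu (d + 1) × ℝ)}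

/-- A face meets an intersection of two different hyperplanes in a null set. -/
theorem measure_carrier_inter_eq_zero (C : FlatFace U)
    {u₁ u₂ : Eu (d + 1)} (h : LinearIndependent ℝ ![u₁, u₂]) (d₁ d₂ : ℝ) :
    (μHE[d] : Measure (Eu (d + 1))).restrict C.carrier
      {x | inner ℝ u₁ x = d₁ ∧ inner ℝ u₂ x = d₂} = 0 := by
  obtain ⟨L, hL, hL'⟩ := exists_hyperplane_isometry C.normal C.norm_normal
  refine measure_mono_null (μ := (μHE[d] : Measure (Eu (d + 1))).restrict C.carrier)
    (t := {x | inner ℝ u₁ x = d₁ ∧ inner ℝ u₂ x = d₂}) subset_rfl ?_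
  refine nonpos_iff_eq_zero.1 ((Measure.restrict_mono C.carrier_subset_plane le_rfl _).trans ?_)
  rw [← map_plane_volume C.norm_normal hL hL' C.level,
    (measurableEmbedding_plane (n := C.normal) (L := L) C.level).map_apply]
  -- Two independent vectors cannot both be multiples of the face normal, so one of the hyperplanes
  -- cuts the face transversally.
  have hor : (¬ ∃ s : ℝ, u₁ = s • C.normal) ∨ ¬ ∃ s : ℝ, u₂ = s • C.normal := by
    by_contra hcon
    push Not at hcon
    obtain ⟨⟨s, hs⟩, t, ht⟩ := hcon
    have h0 := LinearIndependent.pair_iff.1 h t (-s) (by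
      rw [hs, ht, smul_smul, smul_smul, ← add_smul]; ring_nf; exact zero_smul _ _)
    have ht0 := h0.1
    exact h.ne_zero 1 (by simp [ht, ht0])
  rcases hor with hu | hu
  · exact (measure_mono_null (fun z hz => hz.1)
      (volume_plane_inter_eq_zero C.norm_normal hL' C.level hu d₁)).le
  · exact (measure_mono_null (fun z hz => hz.2)
      (volume_plane_inter_eq_zero C.norm_normal hL' C.level hu d₂)).le

/-- The divergence theorem for functions that vanish near the singular part of the boundary, except
near finitely many planes of codimension two. -/
theorem hasDivergenceFormula_aux (hP : IsPiecewiseFlat U P)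
    (Z : Finset ((Eu (d + 1) × ℝ) × (Eu (d + 1) × ℝ)))
    (hZ : ∀ z ∈ Z, LinearIndependent ℝ ![z.1.1, z.2.1]) {w : Eu (d + 1) → ℝ}
    {dw : Eu (d + 1) → Eu (d + 1) →L[ℝ] ℝ} (h : IsC1Upto U w dw)
    (h0 : ∀ x ∈ frontier U, (∃ C : FlatFace U, x ∈ C.carrier) ∨
      (∃ z ∈ Z, inner ℝ z.1.1 x = z.1.2 ∧ inner ℝ z.2.1 x = z.2.2) ∨
      ∃ r > 0, ∀ y ∈ Metric.ball x r ∩ closure U, w y = 0) :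
    HasDivergenceFormula U w dw := by
  classical
  have hUo := hP.isOpen
  have hU := hP.isBounded
  have := hP.finite_flatFace
  have := Fintype.ofFinite (FlatFace U)
  induction Z using Finset.induction_on generalizing w dw with
  | empty =>
    refine hP.hasDivergenceFormula_of_eq_zero h fun x hx => ?_
    rcases h0 x hx with h1 | ⟨z, hz, -⟩ | h1
    · exact .inl h1
    · simp at hz
    · exact .inr h1
  | insert z Z hzZ ih =>
    have hz := hZ z (Finset.mem_insert_self _ _)
    intro a
    -- One plane is cut away at a time: `η k * w` vanishes near it and is covered by the induction
    -- hypothesis for the remaining planes.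
    obtain ⟨η, hη, hη1, hη0, hηlim, hηint⟩ := exists_cutoff hz z.1.2 z.2.2 hUo hU a
    have hk : ∀ k, HasDivergenceFormula U (fun x => η k x * w x)
        (fun x => η k x • dw x + w x • fderiv ℝ (η k) x) := by
      intro k
      refine ih (fun z' hz' => hZ z' (Finset.mem_insert_of_mem hz')) (h.mul_smooth hU (hη k))
        fun x hx => ?_
      rcases h0 x hx with h1 | ⟨z', hz', hx'⟩ | ⟨r, hr, h1⟩
      · exact .inl h1
      · rcases Finset.mem_insert.1 hz' with rfl | hz'
        · obtain ⟨r, hr, h1⟩ := Metric.eventually_nhds_iff_ball.1 (hη0 k x hx'.1 hx'.2)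
          exact .inr (.inr ⟨r, hr, fun y hy => by rw [h1 y hy.1, zero_mul]⟩)
        · exact .inr (.inl ⟨z', hz', hx'⟩)
      · exact .inr (.inr ⟨r, hr, fun y hy => by rw [h1 y hy, mul_zero]⟩)
    have hR : Tendsto (fun k => ∑ᶠ C : FlatFace U, inner ℝ C.normal a *
        ∫ x in C.carrier, η k x * w x ∂μHE[d]) atTop
        (𝓝 (∑ᶠ C : FlatFace U, inner ℝ C.normal a * ∫ x in C.carrier, w x ∂μHE[d])) := by
      simp_rw [finsum_eq_sum_of_fintype]
      refine tendsto_finsetSum _ fun C _ => Tendsto.const_mul _ ?_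
      refine tendsto_integral_of_dominated_convergence (fun x => ‖w x‖)
        (fun k => (C.integrableOn_of_continuousOn hUo hU
          (h.mul_smooth hU (hη k)).continuousOn).aestronglyMeasurable)
        (C.integrableOn_of_continuousOn hUo hU h.continuousOn).norm
        (fun k => .of_forall fun x => ?_) ?_
      · rw [norm_mul]
        exact mul_le_of_le_one_left (norm_nonneg _) (hη1 k x)
      · have hnull := measure_carrier_inter_eq_zero C hz z.1.2 z.2.2
        filter_upwards [measure_eq_zero_iff_ae_notMem.1 hnull] with x hx
        simpa using (hηlim x hx).mul_const (w x)
    have hL : Tendsto (fun k => ∫ x in U, (η k x • dw x + w x • fderiv ℝ (η k) x) a) atTop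
        (𝓝 (∫ x in U, dw x a)) := by
      have hint := h.integrableOn_deriv hUo hU a
      have i1 : ∀ k, IntegrableOn (fun x => η k x * dw x a) U := fun k =>
        hint.bdd_mul (hη k).continuous.aestronglyMeasurable (.of_forall (hη1 k))
      have i2 : ∀ k, IntegrableOn (fun x => w x * fderiv ℝ (η k) x a) U := fun k => by
        refine (((h.mul_smooth hU (hη k)).integrableOn_deriv hUo hU a).sub (i1 k)).congr
          (.of_forall fun x => ?_)
        simp
      have hsplit : ∀ k, ∫ x in U, (η k x • dw x + w x • fderiv ℝ (η k) x) a =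
          (∫ x in U, η k x * dw x a) + ∫ x in U, w x * fderiv ℝ (η k) x a := fun k => by
        rw [← integral_add (i1 k) (i2 k)]
        simp
      simp_rw [hsplit]
      have t1 : Tendsto (fun k => ∫ x in U, η k x * dw x a) atTop (𝓝 (∫ x in U, dw x a)) := by
        refine tendsto_integral_of_dominated_convergence (fun x => ‖dw x a‖)
          (fun k => (i1 k).aestronglyMeasurable) hint.norm (fun k => .of_forall fun x => ?_) ?_
        · rw [norm_mul]
          exact mul_le_of_le_one_left (norm_nonneg _) (hη1 k x)
        · have hnull : (volume.restrict U) {x | inner ℝ z.1.1 x = z.1.2 ∧ inner ℝ z.2.1 x = z.2.2}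
              = 0 := by
            refine nonpos_iff_eq_zero.1 ((Measure.restrict_apply_le _ _).trans ?_)
            exact (measure_mono_null (fun x hx => hx.1)
              (volume_hyperplane_eq_zero (hz.ne_zero 0) z.1.2)).le
          filter_upwards [measure_eq_zero_iff_ae_notMem.1 hnull] with x hx
          simpa using (hηlim x hx).mul_const (dw x a)
      -- The commutator term vanishes in the limit because `w` is bounded and the derivative of the
      -- cutoff tends to zero in `L¹`.
      have t2 : Tendsto (fun k => ∫ x in U, w x * fderiv ℝ (η k) x a) atTop (𝓝 0) := by
        obtain ⟨M, hM⟩ := h.exists_bound hU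
        have hfi : ∀ k, IntegrableOn (fun x => |fderiv ℝ (η k) x a|) U := fun k =>
          ((((hη k).continuous_fderiv (by simp)).clm_apply continuous_const).abs.continuousOn
            |>.integrableOn_compact hU.isCompact_closure).mono_set subset_closure
        refine squeeze_zero_norm (a := fun k => M * ∫ x in U, |fderiv ℝ (η k) x a|)
          (fun k => ?_) (by simpa using hηint.const_mul M)
        rw [← integral_const_mul]
        refine (norm_integral_le_integral_norm _).trans ?_
        refine setIntegral_mono_on (i2 k).norm ((hfi k).const_mul M) hUo.measurableSet
          fun x hx => ?_
        rw [norm_mul, Real.norm_eq_abs (fderiv ℝ (η k) x a)]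
        exact mul_le_mul_of_nonneg_right (hM x (subset_closure hx)) (abs_nonneg _)
      simpa using t1.add t2
    refine tendsto_nhds_unique hL ?_
    simp_rw [hk _ a]
    exact hR

/-- The divergence theorem in a bounded open set with piecewise flat boundary. -/
theorem hasDivergenceFormula (hP : IsPiecewiseFlat U P) {w : Eu (d + 1) → ℝ}
    {dw : Eu (d + 1) → Eu (d + 1) →L[ℝ] ℝ} (h : IsC1Upto U w dw) :
    HasDivergenceFormula U w dw := by
  classical
  refine hP.hasDivergenceFormula_aux ((P ×ˢ P).filter fun z => LinearIndependent ℝ ![z.1.1, z.2.1])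
    (fun z hz => (Finset.mem_filter.1 hz).2) h fun x hx => ?_
  by_cases hC : ∃ C : FlatFace U, x ∈ C.carrier
  · exact .inl hC
  · push Not at hC
    obtain ⟨p, hp, q, hq, hpq, h1, h2⟩ := hP.exists_pair hx hC
    exact .inr (.inl ⟨(p, q), Finset.mem_filter.2 ⟨Finset.mk_mem_product hp hq, hpq⟩, h1, h2⟩)

end IsPiecewiseFlat

/-! ### Lipschitz charts and the interior cone property. -/

section Chart

variable {K : Set R3} {x₀ ν : R3} {f : R3 → ℝ} {r : ℝ}

/-- In the ball around `x₀` of radius `r`, `K` is the strict subgraph of `f`. -/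
def IsSubgraphIn (K : Set R3) (x₀ ν : R3) (f : R3 → ℝ) (r : ℝ) : Prop :=
  ∀ y ∈ Metric.ball x₀ r, (y ∈ K ↔ inner ℝ ν y < f (y - inner ℝ ν y • ν))

theorem proj_add_smul (hν : ‖ν‖ = 1) (y : R3) (s : ℝ) :
    y + s • ν - inner ℝ ν (y + s • ν) • ν = y - inner ℝ ν y • ν := by
  rw [inner_add_right, inner_smul_right, real_inner_self_eq_norm_sq, hν]
  module

theorem IsSubgraphIn.le_of_mem_closure (h : IsSubgraphIn K x₀ ν f r) (hf : Continuous f)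
    {x : R3} (hx : x ∈ closure K) (hxr : x ∈ Metric.ball x₀ r) :
    inner ℝ ν x ≤ f (x - inner ℝ ν x • ν) := by
  have hcl : IsClosed {y : R3 | inner ℝ ν y ≤ f (y - inner ℝ ν y • ν)} :=
    isClosed_le (by fun_prop) (by fun_prop)
  have h1 := Metric.isOpen_ball.inter_closure ⟨hxr, hx⟩
  exact hcl.closure_subset_iff.2 (fun y hy => ((h y hy.1).1 hy.2).le) h1

theorem IsSubgraphIn.eq_of_mem_frontier (h : IsSubgraphIn K x₀ ν f r) (hf : Continuous f)
    (hK : IsOpen K) {x : R3} (hx : x ∈ frontier K) (hxr : x ∈ Metric.ball x₀ r) :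
    inner ℝ ν x = f (x - inner ℝ ν x • ν) := by
  rw [hK.frontier_eq] at hx
  exact le_antisymm (h.le_of_mem_closure hf hx.1 hxr) (not_lt.1 fun hlt => hx.2 ((h x hxr).2 hlt))

theorem IsSubgraphIn.mem_frontier (h : IsSubgraphIn K x₀ ν f r) (hK : IsOpen K) (hν : ‖ν‖ = 1)
    {x : R3} (hxr : x ∈ Metric.ball x₀ r) (hx : inner ℝ ν x = f (x - inner ℝ ν x • ν)) :
    x ∈ frontier K := by
  rw [hK.frontier_eq]
  refine ⟨Metric.mem_closure_iff.2 fun ε hε => ?_, fun hxK => ((h x hxr).1 hxK).ne hx⟩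
  obtain ⟨t, ht0, -, ht⟩ := exists_small_smul_mem_ball x (-ν)
    (lt_min (sub_pos.2 (Metric.mem_ball.1 hxr)) hε)
  have e : x + t • (-ν) = x + (-t) • ν := by module
  refine ⟨x + t • (-ν), (h _ ?_).2 ?_, ?_⟩
  · rw [Metric.mem_ball] at *
    have := lt_of_lt_of_le ht (min_le_left _ _)
    linarith [dist_triangle (x + t • (-ν)) x x₀]
  · rw [e, proj_add_smul hν, inner_add_right, inner_smul_right, real_inner_self_eq_norm_sq, hν,
      ← hx]
    linarith
  · rw [dist_comm]
    exact lt_of_lt_of_le ht (min_le_right _ _)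

/-- The uniform interior cone property near a boundary point. -/
theorem IsSubgraphIn.cone (h : IsSubgraphIn K x₀ ν f r) (hν : ‖ν‖ = 1) {L : ℝ≥0}
    (hf : LipschitzWith L f) (hr : 0 < r) {x b : R3} {t : ℝ} (hx : x ∈ closure K)
    (hxr : x ∈ Metric.ball x₀ (r / 2)) (ht : t ∈ Set.Ioc (0 : ℝ) 1)
    (hb : b ∈ Metric.ball (-(r / 8) • ν) (r / 8 / (1 + 2 * L))) : x + t • b ∈ K := by
  -- `v` is the deviation of `b` from the downward vector `-(r/8) ν`. The radius of directions is
  -- chosen so that `‖v‖ + 2 L ‖v‖ < r/8`: the descent exceeds the change of the graph, whose base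
  -- point moves by at most `2 t ‖v‖`. Also `‖b‖ ≤ r/4` keeps the path in the chart.
  set v := b + (r / 8) • ν with hv
  have hvn : ‖v‖ < r / 8 / (1 + 2 * L) := by
    rw [Metric.mem_ball, dist_eq_norm] at hb
    rwa [hv, show b + (r / 8) • ν = b - -(r / 8) • ν by module]
  have hL : (0 : ℝ) ≤ L := L.2
  have hvn' : ‖v‖ * (1 + 2 * L) < r / 8 := (lt_div_iff₀ (by positivity)).1 hvn
  have hv8 : ‖v‖ < r / 8 := by nlinarith [norm_nonneg v]
  have hbv : b = v - (r / 8) • ν := by rw [hv]; abel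
  have hbn : ‖b‖ ≤ r / 4 := by
    rw [hbv]
    refine (norm_sub_le _ _).trans ?_
    rw [norm_smul, hν, Real.norm_eq_abs, abs_of_pos (by positivity)]
    linarith
  have hxr' : x ∈ Metric.ball x₀ r := Metric.ball_subset_ball (by linarith) hxr
  have hball : x + t • b ∈ Metric.ball x₀ r := by
    rw [Metric.mem_ball, dist_eq_norm] at *
    have h1 : ‖t • b‖ ≤ r / 4 := by
      rw [norm_smul, Real.norm_eq_abs, abs_of_pos ht.1]
      nlinarith [norm_nonneg b, ht.2]
    have h2 := norm_add_le (x - x₀) (t • b)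
    rw [show x + t • b - x₀ = x - x₀ + t • b by abel]
    linarith
  rw [h _ hball]
  have hν2 : (inner ℝ ν ν : ℝ) = 1 := by rw [real_inner_self_eq_norm_sq, hν]; norm_num
  have hin : inner ℝ ν (x + t • b) = inner ℝ ν x + t * (inner ℝ ν v - r / 8) := by
    rw [hbv, inner_add_right, inner_smul_right, inner_sub_right, inner_smul_right, hν2, mul_one]
  have hνv : |inner ℝ ν v| ≤ ‖v‖ := by
    simpa [hν] using abs_real_inner_le_norm ν v
  have hproj : x + t • b - inner ℝ ν (x + t • b) • ν - (x - inner ℝ ν x • ν) =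
      t • (v - inner ℝ ν v • ν) := by
    rw [hin, hbv]
    module
  have hdist := hf.dist_le_mul (x - inner ℝ ν x • ν) (x + t • b - inner ℝ ν (x + t • b) • ν)
  rw [dist_comm (x - _), dist_eq_norm (x + t • b - _), hproj, norm_smul, Real.norm_eq_abs,
    abs_of_pos ht.1, Real.dist_eq] at hdist
  have hpn : ‖v - inner ℝ ν v • ν‖ ≤ 2 * ‖v‖ := by
    refine (norm_sub_le _ _).trans ?_
    rw [norm_smul, hν, Real.norm_eq_abs]
    linarith
  have hle := h.le_of_mem_closure hf.continuous hx hxr'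
  have h1 := (abs_le.1 hdist).2
  have h2 : (L : ℝ) * (t * ‖v - inner ℝ ν v • ν‖) ≤ L * (t * (2 * ‖v‖)) := by
    have := ht.1.le
    gcongr
  have h3 := (abs_le.1 hνv).2
  have h4 : t * (inner ℝ ν v - r / 8) < - (L * (t * (2 * ‖v‖))) := by
    have := ht.1
    nlinarith
  linarith [hin]

end Chart

/-- A direction ball is an interior cone for the points of the closure near `x₀`. -/
def IsConeAt (K : Set R3) (x₀ : R3) (r : ℝ) (a : R3) (δ : ℝ) : Prop :=
  ∀ x ∈ closure K ∩ Metric.ball x₀ r, ∀ t ∈ Set.Ioc (0 : ℝ) 1, ∀ b ∈ Metric.ball a δ, x + t • b ∈ K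

/-- The uniform interior cone property of a Lipschitz domain. -/
theorem exists_isConeAt {K : Set R3} (hK : IsOpen K) (hL : HasLipschitzBoundary K) {x₀ : R3}
    (hx₀ : x₀ ∈ closure K) : ∃ r > 0, ∃ a, ∃ δ > 0, IsConeAt K x₀ r a δ := by
  by_cases hxK : x₀ ∈ K
  · obtain ⟨r, hr, hb⟩ := Metric.isOpen_iff.1 hK x₀ hxK
    -- At an interior point the axis may be zero: the cone is a full ball of directions.
    refine ⟨r / 2, by positivity, 0, r / 2, by positivity, fun x hx t ht b hbb => hb ?_⟩
    have h1 := hx.2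
    rw [Metric.mem_ball, dist_eq_norm] at *
    rw [sub_zero] at hbb
    have h2 : ‖t • b‖ ≤ ‖b‖ := by
      rw [norm_smul, Real.norm_eq_abs, abs_of_pos ht.1]
      exact mul_le_of_le_one_left (norm_nonneg b) ht.2
    have h3 := norm_add_le (x - x₀) (t • b)
    rw [show x + t • b - x₀ = x - x₀ + t • b by abel]
    linarith
  · obtain ⟨ν, hν, L, f, hf, r, hr, h⟩ := hL x₀ (by rw [hK.frontier_eq]; exact ⟨hx₀, hxK⟩)
    have hL0 : (0 : ℝ) ≤ L := L.2
    exact ⟨r / 2, by positivity, _, r / 8 / (1 + 2 * L), by positivity, fun x hx t ht b hb =>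
      IsSubgraphIn.cone h hν hf hr hx.1 hx.2 ht hb⟩

/-- A cone direction points inwards through the flat parts of the boundary. -/
theorem IsConeAt.inner_neg {K : Set R3} {x₀ : R3} {r : ℝ} {a : R3} {δ : ℝ}
    (h : IsConeAt K x₀ r a δ) (hδ : 0 < δ) {n : R3} (hn : ‖n‖ = 1) {c : ℝ} {x : R3}
    (hx : x ∈ flatBdry K n c) (hxr : x ∈ Metric.ball x₀ r) : inner ℝ n a < 0 := by
  have hxc := (flatBdry_subset_frontier hn hx).1
  obtain ⟨hxn, ρ, hρ, hb⟩ := hx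
  -- Tilting the axis outwards by `(δ/2) n` stays in the cone, which makes the inequality strict.
  obtain ⟨t, ht0, ht1, ht⟩ := exists_small_smul_mem_ball x (a + (δ / 2) • n) hρ
  have h1 := (hb _ ht).1 (h x ⟨hxc, hxr⟩ t ⟨ht0, ht1.le⟩ _ (by
    rw [Metric.mem_ball, dist_eq_norm, add_sub_cancel_left, norm_smul, hn, mul_one,
      Real.norm_eq_abs, abs_of_pos (by positivity)]
    linarith))
  rw [inner_add_right, inner_smul_right, inner_add_right, inner_smul_right,
    real_inner_self_eq_norm_sq, hn, hxn] at h1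
  have : inner ℝ n a + δ / 2 * 1 ^ 2 < 0 := by
    by_contra hcon
    push Not at hcon
    nlinarith
  linarith

/-! ### The boundary of a polyhedron is piecewise flat. -/

section Polyhedron

variable {K : Set R3}

theorem exists_radius_of_continuousAt {m : ℕ} {g : Eu m → Eu m} {x : Eu m}
    (hg : ContinuousAt g x) (hgx : g x = x) {ρ : ℝ} (hρ : 0 < ρ) :
    ∃ σ > 0, ∀ y ∈ Metric.ball x σ, g y ∈ Metric.ball x ρ :=
  Metric.eventually_nhds_iff_ball.1 (hg.eventually (by rw [hgx]; exact Metric.ball_mem_nhds x hρ))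

/-- If the boundary is contained in a plane near a point, then it is flat there. -/
theorem mem_flatBdry_of_frontier_subset (hK : IsOpen K) (hL : HasLipschitzBoundary K) {x n : R3}
    (hx : x ∈ frontier K) (hn : ‖n‖ = 1) {ρ : ℝ} (hρ : 0 < ρ)
    (hsub : ∀ y ∈ Metric.ball x ρ, y ∈ frontier K → inner ℝ n y = inner ℝ n x) :
    x ∈ flatBdry K n (inner ℝ n x) ∨ x ∈ flatBdry K (-n) (inner ℝ (-n) x) := by
  obtain ⟨ν, hν, L, f, hf, r, hr, h⟩ := hL x hx
  have hfc := hf.continuous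
  have hxr := Metric.mem_ball_self (x := x) hr
  have hxf := IsSubgraphIn.eq_of_mem_frontier h hfc hK hx hxr
  -- Vertical projection onto the graph. Its image lies on the boundary, hence in the plane, which
  -- ties the height below the graph to `⟪n, x⟫ - ⟪n, y⟫` through the factor `⟪n, ν⟫`.
  set g : R3 → R3 := fun y => y + (f (y - inner ℝ ν y • ν) - inner ℝ ν y) • ν with hg
  have hgc : Continuous g := by fun_prop
  obtain ⟨σ, hσ, hσg⟩ := exists_radius_of_continuousAt (hgc.continuousAt (x := x))
    (by simp only [hg]; rw [← hxf]; simp) (lt_min hρ hr)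
  have hgn : ∀ y ∈ Metric.ball x σ,
      inner ℝ n y + (f (y - inner ℝ ν y • ν) - inner ℝ ν y) * inner ℝ n ν = inner ℝ n x := by
    intro y hy
    have h1 := hσg y hy
    have h2 : g y ∈ frontier K := by
      refine IsSubgraphIn.mem_frontier h hK hν (Metric.ball_subset_ball (min_le_right _ _) h1) ?_
      simp only [hg]
      rw [proj_add_smul hν, inner_add_right, inner_smul_right, real_inner_self_eq_norm_sq, hν]
      ring
    have h3 := hsub _ (Metric.ball_subset_ball (min_le_left _ _) h1) h2
    rwa [hg, inner_add_right, inner_smul_right] at h3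
  have hmem : ∀ y ∈ Metric.ball x (min σ r), (y ∈ K ↔ 0 < f (y - inner ℝ ν y • ν) - inner ℝ ν y) :=
    fun y hy => (h y (Metric.ball_subset_ball (min_le_right _ _) hy)).trans sub_pos.symm
  have hpos : 0 < min σ r := lt_min hσ hr
  rcases lt_trichotomy (inner ℝ n ν) 0 with hneg | h0 | hpo
  · refine .inr ⟨rfl, min σ r, hpos, fun y hy => ?_⟩
    rw [hmem y hy, inner_neg_left, inner_neg_left]
    have := hgn y (Metric.ball_subset_ball (min_le_left _ _) hy)
    constructor
    · intro h1; nlinarith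
    · intro h1; by_contra hcon; push Not at hcon; nlinarith
  · exfalso
    -- If the plane were vertical, `⟪n, ·⟫` would be constant near `x`.
    obtain ⟨t, ht0, -, ht⟩ := exists_small_smul_mem_ball x n hσ
    have h1 := hgn _ ht
    rw [h0, mul_zero, add_zero, inner_add_right, inner_smul_right, real_inner_self_eq_norm_sq,
      hn] at h1
    linarith
  · refine .inl ⟨rfl, min σ r, hpos, fun y hy => ?_⟩
    rw [hmem y hy]
    have := hgn y (Metric.ball_subset_ball (min_le_left _ _) hy)
    constructor
    · intro h1; nlinarith
    · intro h1; by_contra hcon; push Not at hcon; nlinarith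

/-- If the boundary contains a plane near a limit point of a flat part, then it is flat there. -/
theorem mem_flatBdry_of_subset_frontier (hK : IsOpen K) (hL : HasLipschitzBoundary K) {x n : R3}
    {c : ℝ} (hn : ‖n‖ = 1) (hx : x ∈ closure (flatBdry K n c)) {ρ : ℝ} (hρ : 0 < ρ)
    (hsub : ∀ y ∈ Metric.ball x ρ, inner ℝ n y = c → y ∈ frontier K) :
    x ∈ flatBdry K n c := by
  have hxc : inner ℝ n x = c := by
    have hcl : IsClosed {y : R3 | inner ℝ n y = c} := isClosed_eq (by fun_prop) continuous_const
    exact hcl.closure_subset_iff.2 (fun y hy => hy.1) hx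
  have hxf : x ∈ frontier K := hsub x (Metric.mem_ball_self hρ) hxc
  obtain ⟨ν, hν, L, f, hf, r, hr, h⟩ := hL x hxf
  have hfc := hf.continuous
  have hL0 : (0 : ℝ) ≤ L := L.2
  obtain ⟨z, hz, hzr⟩ := Metric.mem_closure_iff.1 hx (r / 2) (by positivity)
  -- At a nearby flat point with normal `n` the cone axis, a negative multiple of `ν`, must point
  -- inwards; this gives `0 < ⟪n, ν⟫`, so the plane is itself a graph over the chart with `K` below
  -- it.
  have hcone : IsConeAt K x (r / 2) (-(r / 8) • ν) (r / 8 / (1 + 2 * L)) := fun x hx t ht b hb =>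
    IsSubgraphIn.cone h hν hf hr hx.1 hx.2 ht hb
  have hneg := hcone.inner_neg (by positivity) hn hz (by rwa [Metric.mem_ball, dist_comm])
  rw [inner_smul_right] at hneg
  have hpos : 0 < inner ℝ n ν := by
    by_contra hcon
    push Not at hcon
    nlinarith
  set k := inner ℝ n ν with hk
  -- Vertical projection onto the plane. It lands on the boundary, so the plane and the graph of `f`
  -- coincide near `x`.
  set g : R3 → R3 := fun y => y + (-((inner ℝ n y - c) / k)) • ν with hg
  have hgc : Continuous g := by fun_prop
  obtain ⟨σ, hσ, hσg⟩ := exists_radius_of_continuousAt (hgc.continuousAt (x := x))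
    (by simp [hg, hxc]) (lt_min hρ hr)
  refine ⟨hxc, min σ r, lt_min hσ hr, fun y hy => ?_⟩
  have h1 := hσg y (Metric.ball_subset_ball (min_le_left _ _) hy)
  have h2 : g y ∈ frontier K := by
    refine hsub _ (Metric.ball_subset_ball (min_le_left _ _) h1) ?_
    simp only [hg]
    rw [inner_add_right, inner_smul_right, ← hk]
    field_simp
    ring
  have h3 := IsSubgraphIn.eq_of_mem_frontier h hfc hK h2
    (Metric.ball_subset_ball (min_le_right _ _) h1)
  simp only [hg] at h3
  rw [proj_add_smul hν, inner_add_right, inner_smul_right, real_inner_self_eq_norm_sq, hν] at h3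
  rw [h y (Metric.ball_subset_ball (min_le_right _ _) hy), ← h3]
  rw [one_pow, mul_one, lt_add_iff_pos_right, neg_pos, div_neg_iff]
  constructor
  · rintro (⟨-, h4⟩ | ⟨h4, -⟩)
    · linarith
    · linarith
  · exact fun h4 => .inr ⟨by linarith, hpos⟩

/-- Near a point, a set covered by finitely many hyperplanes is covered by those through the
point. -/
theorem exists_ball_covered {m : ℕ} {S : Set (Eu m)} {P : Finset (Eu m × ℝ)}
    (hcov : ∀ x ∈ S, ∃ p ∈ P, inner ℝ p.1 x = p.2) (hne : ∀ p ∈ P, p.1 ≠ 0) {x n : Eu m}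
    (hP : ∀ p ∈ P, inner ℝ p.1 x = p.2 → ∃ s : ℝ, p.1 = s • n) :
    ∃ ρ > 0, ∀ y ∈ Metric.ball x ρ, y ∈ S → inner ℝ n y = inner ℝ n x := by
  have hev : ∀ᶠ y in 𝓝 x, ∀ p ∈ P, inner ℝ p.1 y = p.2 → inner ℝ p.1 x = p.2 := by
    rw [Filter.eventually_all_finset]
    intro p _
    by_cases hpx : inner ℝ p.1 x = p.2
    · exact .of_forall fun _ _ => hpx
    · have hc : Continuous fun y : Eu m => (inner ℝ p.1 y : ℝ) := by fun_prop
      filter_upwards [hc.continuousAt.eventually_ne hpx] with y hy h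
      exact absurd h hy
  obtain ⟨ρ, hρ, h⟩ := Metric.eventually_nhds_iff_ball.1 hev
  refine ⟨ρ, hρ, fun y hy hyS => ?_⟩
  obtain ⟨p, hp, hpy⟩ := hcov y hyS
  have hpx := h y hy p hp hpy
  obtain ⟨s, hs⟩ := hP p hp hpx
  have hs0 : s ≠ 0 := fun h0 => hne p hp (by rw [hs, h0, zero_smul])
  have h1 := hpy.trans hpx.symm
  rw [hs, real_inner_smul_left, real_inner_smul_left] at h1
  exact mul_left_cancel₀ hs0 h1

/-- Near a point where all covering planes are parallel the boundary lies in one plane, and a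
Lipschitz graph contained in a plane is all of it locally. -/
theorem IsPolyhedron.exists_isPiecewiseFlat (hK : IsPolyhedron K) :
    ∃ P : Finset (R3 × ℝ), IsPiecewiseFlat K P := by
  obtain ⟨P, hP0, hP⟩ := hK.planar
  refine ⟨P, hK.isOpen, hK.isBounded, hP0, hP, fun x hx n hn hpar => ?_⟩
  obtain ⟨ρ, hρ, h⟩ := exists_ball_covered hP hP0 hpar
  exact mem_flatBdry_of_frontier_subset hK.isOpen hK.lipschitz hx hn hρ h

end Polyhedron

/-! ### The relative boundary of a face is piecewise flat. -/

section FacePlane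

/-- A convex set that does not meet the boundary of an open set is inside or outside of it. -/
theorem subset_of_disjoint_frontier {m : ℕ} {U D : Set (Eu m)} (hU : IsOpen U) (hD : Convex ℝ D)
    (hDU : ∀ x ∈ D, x ∉ frontier U) (hne : (D ∩ U).Nonempty) : D ⊆ U := by
  refine hD.isPreconnected.subset_of_closure_inter_subset hU hne fun x hx => ?_
  by_contra hxU
  exact hDU x hx.2 (by rw [hU.frontier_eq]; exact ⟨hx.1, hxU⟩)

theorem exists_mem_ball_inner_gt {m : ℕ} {U : Set (Eu m)} (hU : IsOpen U) {y w n : Eu m}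
    (hn : ‖n‖ = 1) {ρ : ℝ} (hw : w ∈ Metric.ball y ρ) (hwU : w ∈ U) :
    ∃ z ∈ Metric.ball y ρ, z ∈ U ∧ inner ℝ n w < inner ℝ n z := by
  obtain ⟨ε, hε, h⟩ := Metric.isOpen_iff.1 (hU.inter Metric.isOpen_ball) w ⟨hwU, hw⟩
  obtain ⟨t, ht0, -, ht⟩ := exists_small_smul_mem_ball w n hε
  refine ⟨_, (h ht).2, (h ht).1, ?_⟩
  rw [inner_add_right, inner_smul_right, real_inner_self_eq_norm_sq, hn]
  linarith

/-- The dividing hyperplane itself carries no point of `U` in the ball: by openness such a point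
could be pushed into the half that `U` does not meet. -/
theorem mem_flatBdry_of_half_ball {m : ℕ} {U : Set (Eu m)} (hU : IsOpen U) {y n : Eu m}
    (hn : ‖n‖ = 1) {ρ : ℝ} (hρ : 0 < ρ)
    (h1 : Metric.ball y ρ ∩ {w | inner ℝ n w < inner ℝ n y} ⊆ U)
    (h2 : ¬ (Metric.ball y ρ ∩ {w | inner ℝ n y < inner ℝ n w} ∩ U).Nonempty) :
    y ∈ flatBdry U n (inner ℝ n y) := by
  refine ⟨rfl, ρ, hρ, fun w hw => ⟨fun hwU => ?_, fun hlt => h1 ⟨hw, hlt⟩⟩⟩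
  by_contra hcon
  push Not at hcon
  obtain ⟨z, hz, hzU, hlt⟩ := exists_mem_ball_inner_gt hU hn hw hwU
  exact h2 ⟨z, ⟨hz, hcon.trans_lt hlt⟩, hzU⟩

variable {K : Set R3} {C : FlatFace K} {L : Eu 2 →ₗᵢ[ℝ] R3}

/-- A face in isometric coordinates of its plane. -/
def FlatFace.inPlane (C : FlatFace K) (L : Eu 2 →ₗᵢ[ℝ] R3) : Set (Eu 2) :=
  (fun y => L y + C.level • C.normal) ⁻¹' C.carrier

/-- A face of a polyhedron has piecewise flat relative boundary. -/
theorem FlatFace.exists_isPiecewiseFlat (hK : IsPolyhedron K) (C : FlatFace K)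
    (hL : ∀ y, inner ℝ C.normal (L y) = 0) (hL' : ∀ x, inner ℝ C.normal x = 0 → ∃ y, L y = x) :
    ∃ Q : Finset (Eu 2 × ℝ), IsPiecewiseFlat (C.inPlane L) Q := by
  classical
  obtain ⟨P, hP⟩ := hK.exists_isPiecewiseFlat
  have hn := C.norm_normal
  set A : Eu 2 → R3 := fun y => L y + C.level • C.normal with hA
  have hAi : Isometry A := isometry_plane C.level
  have hAc : Continuous A := hAi.continuous
  set U := C.inPlane L with hUdef
  have hU : IsOpen U := C.isOpen_preimage hK.isOpen hL
  have hclos : ∀ y ∈ closure U, A y ∈ closure C.carrier := fun y hy =>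
    closure_mono (Set.image_preimage_subset _ _) (image_closure_subset_closure_image hAc ⟨y, hy, rfl⟩)
  have hfr : ∀ y ∈ closure U, A y ∈ frontier K := fun y hy =>
    isClosed_frontier.closure_subset_iff.2 C.carrier_subset_frontier (hclos y hy)
  have hnotflat : ∀ y ∈ frontier U, A y ∉ flatBdry K C.normal C.level := fun y hy hflat => by
    rw [hU.frontier_eq] at hy
    exact hy.2 (C.mem_of_mem_closure hK.isOpen (hclos y hy.1) hflat)
  -- The covering planes not parallel to the face cut its plane in lines; the adjoint of `L` gives
  -- the normals of these lines in coordinates.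
  let adj := ContinuousLinearMap.adjoint L.toContinuousLinearMap
  have hadj : ∀ u y, inner ℝ (adj u) y = inner ℝ u (L y) := fun u y =>
    ContinuousLinearMap.adjoint_inner_left _ _ _
  let P' := P.filter fun p => ¬ ∃ s : ℝ, p.1 = s • C.normal
  let Q := P'.image fun p => (adj p.1, p.2 - inner ℝ p.1 (C.level • C.normal))
  have hline : ∀ p : R3 × ℝ, ∀ y, (inner ℝ (adj p.1) y = p.2 - inner ℝ p.1 (C.level • C.normal) ↔
      inner ℝ p.1 (A y) = p.2) := fun p y => by
    rw [hadj, eq_sub_iff_add_eq, ← inner_add_right]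
  have hQ0 : ∀ q ∈ Q, q.1 ≠ 0 := by
    intro q hq
    obtain ⟨p, hp, rfl⟩ := Finset.mem_image.1 hq
    intro h0
    refine (Finset.mem_filter.1 hp).2 ⟨inner ℝ C.normal p.1, sub_eq_zero.1 ?_⟩
    set u := p.1 - inner ℝ C.normal p.1 • C.normal with hu
    have hnu : inner ℝ C.normal u = (0 : ℝ) := by
      rw [hu, inner_sub_right, inner_smul_right, real_inner_self_eq_norm_sq, hn]; simp
    obtain ⟨y, hy⟩ := hL' u hnu
    have h1 : inner ℝ p.1 u = (0 : ℝ) := by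
      rw [← hy, ← hadj]
      simp only at h0
      rw [h0, inner_zero_left]
    rw [← inner_self_eq_zero (𝕜 := ℝ)]
    conv_lhs => rw [hu, inner_sub_left, ← hu, inner_smul_left, hnu, h1]
    simp
  -- At a limit point of the face on none of the lines only planes parallel to the face pass, so `K`
  -- is flat there and the point already belongs to the face.
  have hQcov : ∀ y ∈ frontier U, ∃ q ∈ Q, inner ℝ q.1 y = q.2 := by
    intro y hy
    by_contra hcon
    push Not at hcon
    refine hnotflat y hy (mem_flatBdry_of_mem_closure hn
      (closure_mono C.carrier_subset (hclos y hy.1)) ?_)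
    refine hP.regular _ (hfr y hy.1) _ hn fun p hp hpy => ?_
    by_contra hpn
    exact hcon _ (Finset.mem_image_of_mem _ (Finset.mem_filter.2 ⟨hp, hpn⟩)) ((hline p y).2 hpy)
  have hUb : Bornology.IsBounded U := hAi.antilipschitz.isBounded_preimage
    (hK.isBounded.closure.subset (C.carrier_subset_frontier.trans frontier_subset_closure))
  refine ⟨Q, hU, hUb, hQ0, hQcov, fun y hy m hm hpar => ?_⟩
  obtain ⟨ρ, hρ, hb⟩ := exists_ball_covered hQcov hQ0 hpar
  -- Near `y` the relative boundary lies on one line, so each open half-disc is either contained in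
  -- the face or disjoint from it.
  set D₁ := Metric.ball y ρ ∩ {w | inner ℝ m w < inner ℝ m y} with hD₁
  set D₂ := Metric.ball y ρ ∩ {w | inner ℝ m y < inner ℝ m w} with hD₂
  have hc₁ : Convex ℝ D₁ := (convex_ball y ρ).inter
    (convex_halfSpace_lt (innerₛₗ ℝ m).isLinear _)
  have hc₂ : Convex ℝ D₂ := (convex_ball y ρ).inter
    (convex_halfSpace_gt (innerₛₗ ℝ m).isLinear _)
  have hs₁ : (D₁ ∩ U).Nonempty → D₁ ⊆ U := subset_of_disjoint_frontier hU hc₁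
    fun w hw hwf => (show inner ℝ m w < inner ℝ m y from hw.2).ne (hb w hw.1 hwf)
  have hs₂ : (D₂ ∩ U).Nonempty → D₂ ⊆ U := subset_of_disjoint_frontier hU hc₂
    fun w hw hwf => (show inner ℝ m y < inner ℝ m w from hw.2).ne' (hb w hw.1 hwf)
  have hm' : ‖-m‖ = 1 := by rwa [norm_neg]
  have hD₁' : Metric.ball y ρ ∩ {w | inner ℝ (-m) y < inner ℝ (-m) w} = D₁ := by
    ext w; simp [hD₁, inner_neg_left]
  have hD₂' : Metric.ball y ρ ∩ {w | inner ℝ (-m) w < inner ℝ (-m) y} = D₂ := by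
    ext w; simp [hD₂, inner_neg_left]
  by_cases h1 : (D₁ ∩ U).Nonempty
  · by_cases h2 : (D₂ ∩ U).Nonempty
    · exfalso
      -- A slit is impossible: with both half-discs in the face, the whole disc is in the boundary
      -- of `K`, and the Lipschitz property makes `K` flat at `y`, which would then be a point of
      -- the face.
      refine hnotflat y hy (mem_flatBdry_of_subset_frontier hK.isOpen hK.lipschitz hn
        (closure_mono C.carrier_subset (hclos y hy.1)) hρ fun x hx hxc => ?_)
      obtain ⟨w, rfl⟩ := exists_plane_eq hn hL' hxc
      have hw : w ∈ Metric.ball y ρ := by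
        rw [Metric.mem_ball, ← hAi.dist_eq]; exact hx
      refine hfr w ?_
      rcases lt_trichotomy (inner ℝ m w) (inner ℝ m y) with h3 | h3 | h3
      · exact subset_closure (hs₁ h1 ⟨hw, h3⟩)
      · rw [Metric.mem_closure_iff]
        intro ε hε
        obtain ⟨t, ht0, -, ht⟩ := exists_small_smul_mem_ball w m
          (lt_min (sub_pos.2 (Metric.mem_ball.1 hw)) hε)
        refine ⟨w + t • m, hs₂ h2 ⟨?_, ?_⟩, ?_⟩
        · rw [Metric.mem_ball] at *
          have := lt_of_lt_of_le ht (min_le_left _ _)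
          linarith [dist_triangle (w + t • m) w y]
        · show inner ℝ m y < inner ℝ m (w + t • m)
          rw [inner_add_right, inner_smul_right, real_inner_self_eq_norm_sq, hm, h3]
          linarith
        · rw [dist_comm]
          exact lt_of_lt_of_le ht (min_le_right _ _)
      · exact subset_closure (hs₂ h2 ⟨hw, h3⟩)
    · exact .inl (mem_flatBdry_of_half_ball hU hm hρ (hs₁ h1) h2)
  · have h2 : (D₂ ∩ U).Nonempty := by
      obtain ⟨w, hwU, hwy⟩ := Metric.mem_closure_iff.1 hy.1 ρ hρ
      rw [dist_comm] at hwy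
      have hle : inner ℝ m y ≤ inner ℝ m w := by
        by_contra hcon
        push Not at hcon
        exact h1 ⟨w, ⟨hwy, hcon⟩, hwU⟩
      obtain ⟨z, hz, hzU, hlt⟩ := exists_mem_ball_inner_gt hU hm (Metric.mem_ball.2 hwy) hwU
      exact ⟨z, ⟨hz, hle.trans_lt hlt⟩, hzU⟩
    refine .inr (mem_flatBdry_of_half_ball hU hm' hρ ?_ ?_)
    · rw [hD₂']; exact hs₂ h2
    · rw [hD₁']; exact h1

end FacePlane

/-! ### Faces and edges as flat faces in dimensions three and two. -/

section Correspondence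

variable {K : Set R3}

/-- The faces of `K` are its flat faces. -/
def Face.equiv (K : Set R3) : Face K ≃ FlatFace K where
  toFun F := ⟨F.normal, F.level, F.carrier, F.norm_normal, F.isComponent⟩
  invFun C := ⟨C.normal, C.level, C.carrier, C.norm_normal, C.isComponent⟩
  left_inv _ := rfl
  right_inv _ := rfl

/-- An embedding carries connected sets to connected sets in both directions between `S` and `A ''
S`, so maximality is preserved. This identifies edges with components in the coordinate plane. -/
theorem image_connectedComponentIn_of_isEmbedding {X Y : Type*} [TopologicalSpace X]
    [TopologicalSpace Y] {A : X → Y} (hA : IsEmbedding A) {S : Set X} {y : X} (hy : y ∈ S) :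
    connectedComponentIn (A '' S) (A y) = A '' connectedComponentIn S y := by
  apply Set.Subset.antisymm
  · have hsub := connectedComponentIn_subset (A '' S) (A y)
    have himg : A '' (A ⁻¹' connectedComponentIn (A '' S) (A y)) =
        connectedComponentIn (A '' S) (A y) := by
      rw [Set.image_preimage_eq_inter_range, Set.inter_eq_left]
      exact hsub.trans (Set.image_subset_range _ _)
    rw [← himg]
    refine Set.image_mono ?_
    refine IsPreconnected.subset_connectedComponentIn ?_
      (mem_connectedComponentIn (Set.mem_image_of_mem A hy)) ?_
    · rw [← hA.isInducing.isPreconnected_image, himg]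
      exact isPreconnected_connectedComponentIn
    · intro z hz
      obtain ⟨w, hw, hwz⟩ := hsub hz
      rwa [← hA.injective hwz]
  · exact (isPreconnected_connectedComponentIn.image A hA.continuous.continuousOn)
      |>.subset_connectedComponentIn (Set.mem_image_of_mem A (mem_connectedComponentIn hy))
      (Set.image_mono (connectedComponentIn_subset S y))

variable {F : Face K} {L : Eu 2 →ₗᵢ[ℝ] R3}

theorem straightPart_eq_image (hL : ∀ y, inner ℝ F.normal (L y) = 0)
    (hL' : ∀ x, inner ℝ F.normal x = 0 → ∃ y, L y = x) (m : Eu 2) (d : ℝ) :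
    straightPart F (L m) d = (fun y => L y + F.level • F.normal) ''
      flatBdry ((Face.equiv K F).inPlane L) m d := by
  have hn := F.norm_normal
  have hin : ∀ y, inner ℝ (L m) (L y + F.level • F.normal) = inner ℝ m y := fun y => by
    rw [inner_add_right, inner_smul_right, real_inner_comm, real_inner_comm F.normal, hL,
      L.inner_map_map, real_inner_comm]
    simp
  have hi := isometry_plane (n := F.normal) (L := L) F.level
  ext x
  constructor
  · rintro ⟨hxc, hxm, r, hr, h⟩
    obtain ⟨y, rfl⟩ := exists_plane_eq hn hL' hxc
    refine ⟨y, ⟨by rwa [hin] at hxm, r, hr, fun w hw => ?_⟩, rfl⟩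
    have := h (L w + F.level • F.normal) (by rw [Metric.mem_ball, hi.dist_eq]; exact hw)
      (inner_plane hn hL _ w)
    rwa [hin] at this
  · rintro ⟨y, ⟨hym, r, hr, h⟩, rfl⟩
    refine ⟨inner_plane hn hL _ y, by rwa [hin], r, hr, fun z hz hzc => ?_⟩
    obtain ⟨w, rfl⟩ := exists_plane_eq hn hL' hzc
    rw [Metric.mem_ball, hi.dist_eq] at hz
    rw [hin]
    exact h w hz

/-- The edges of a face are its flat faces in isometric coordinates of the plane of the face. -/
theorem exists_edge_equiv (hL : ∀ y, inner ℝ F.normal (L y) = 0)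
    (hL' : ∀ x, inner ℝ F.normal x = 0 → ∃ y, L y = x) :
    ∃ e : Edge F ≃ FlatFace ((Face.equiv K F).inPlane L), ∀ E : Edge F,
      L (e E).normal = E.conormal ∧
      (e E).carrier = (fun y => L y + F.level • F.normal) ⁻¹' E.carrier ∧
      E.carrier = (fun y => L y + F.level • F.normal) '' (e E).carrier := by
  have hi := isometry_plane (n := F.normal) (L := L) F.level
  have hex : ∀ E : Edge F, ∃ m : Eu 2, L m = E.conormal := fun E => hL' _ E.parallel
  choose m hm using hex
  have hcomp : ∀ E : Edge F, ∃ y ∈ flatBdry ((Face.equiv K F).inPlane L) (m E) E.level,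
      E.carrier = (fun y => L y + F.level • F.normal) ''
        connectedComponentIn (flatBdry ((Face.equiv K F).inPlane L) (m E) E.level) y := by
    intro E
    obtain ⟨x, hx, h⟩ := E.isComponent
    rw [← hm, straightPart_eq_image hL hL'] at hx h
    obtain ⟨y, hy, rfl⟩ := hx
    exact ⟨y, hy, h.trans (image_connectedComponentIn_of_isEmbedding hi.isEmbedding hy)⟩
  let e : Edge F ≃ FlatFace ((Face.equiv K F).inPlane L) :=
    { toFun := fun E => ⟨m E, E.level, (fun y => L y + F.level • F.normal) ⁻¹' E.carrier,
        by rw [← L.norm_map, hm, E.norm_conormal], by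
          obtain ⟨y, hy, h⟩ := hcomp E
          exact ⟨y, hy, by rw [h, Set.preimage_image_eq _ hi.injective]⟩⟩
      invFun := fun C => ⟨L C.normal, C.level, (fun y => L y + F.level • F.normal) '' C.carrier,
        by rw [L.norm_map, C.norm_normal], hL _, by
          obtain ⟨y, hy, h⟩ := C.isComponent
          rw [straightPart_eq_image hL hL']
          exact ⟨_, Set.mem_image_of_mem _ hy, by
            rw [h, image_connectedComponentIn_of_isEmbedding hi.isEmbedding hy]⟩⟩
      left_inv := fun E => by
        obtain ⟨y, hy, h⟩ := hcomp E
        have h1 : (fun y => L y + F.level • F.normal) ''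
            ((fun y => L y + F.level • F.normal) ⁻¹' E.carrier) = E.carrier := by
          rw [h, Set.preimage_image_eq _ hi.injective]
        have h2 := hm E
        cases E
        simp only [Edge.mk.injEq]
        exact ⟨h2, trivial, h1⟩
      right_inv := fun C => by
        have h1 := hm ⟨L C.normal, C.level, (fun y => L y + F.level • F.normal) '' C.carrier,
          by rw [L.norm_map, C.norm_normal], hL _, by
            obtain ⟨y, hy, h⟩ := C.isComponent
            rw [straightPart_eq_image hL hL']
            exact ⟨_, Set.mem_image_of_mem _ hy, by
              rw [h, image_connectedComponentIn_of_isEmbedding hi.isEmbedding hy]⟩⟩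
        have h2 := L.injective h1
        cases C
        simp only [FlatFace.mk.injEq]
        exact ⟨h2, trivial, Set.preimage_image_eq _ hi.injective⟩ }
  refine ⟨e, fun E => ⟨hm E, rfl, ?_⟩⟩
  obtain ⟨y, hy, h⟩ := hcomp E
  change E.carrier = _ '' (_ ⁻¹' E.carrier)
  rw [h, Set.preimage_image_eq _ hi.injective]

end Correspondence

/-! ### Finiteness, measures of faces and edges, and the two divergence theorems. -/

section Finiteness

variable {K : Set R3}

theorem IsPolyhedron.finite_face (hK : IsPolyhedron K) : Finite (Face K) := by
  obtain ⟨P, hP⟩ := hK.exists_isPiecewiseFlat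
  have := hP.finite_flatFace
  exact Finite.of_equiv _ (Face.equiv K).symm

theorem IsPolyhedron.finite_edge (hK : IsPolyhedron K) (F : Face K) : Finite (Edge F) := by
  obtain ⟨L, hL, hL'⟩ := exists_hyperplane_isometry F.normal F.norm_normal
  obtain ⟨Q, hQ⟩ := FlatFace.exists_isPiecewiseFlat hK (Face.equiv K F) hL hL'
  obtain ⟨e, -⟩ := exists_edge_equiv hL hL'
  have := hQ.finite_flatFace
  exact Finite.of_equiv _ e.symm

theorem Face.carrier_subset_frontier (F : Face K) : F.carrier ⊆ frontier K :=
  (Face.equiv K F).carrier_subset_frontier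

theorem Face.measurableSet_carrier (hK : IsPolyhedron K) (F : Face K) :
    MeasurableSet F.carrier :=
  (Face.equiv K F).measurableSet_carrier hK.isOpen

theorem Face.isFiniteMeasure_area (hK : IsPolyhedron K) (F : Face K) : IsFiniteMeasure F.area :=
  isFiniteMeasure_restrict.2 ((Face.equiv K F).measure_carrier_lt_top hK.isBounded).ne

/-- The properties of an edge that are inherited from the plane of its face. -/
theorem Edge.carrier_properties (hK : IsPolyhedron K) {F : Face K} (E : Edge F) :
    E.carrier ⊆ closure F.carrier ∧ MeasurableSet E.carrier ∧
      (μHE[1] : Measure R3) E.carrier < ⊤ := by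
  obtain ⟨L, hL, hL'⟩ := exists_hyperplane_isometry F.normal F.norm_normal
  obtain ⟨Q, hQ⟩ := FlatFace.exists_isPiecewiseFlat hK (Face.equiv K F) hL hL'
  obtain ⟨e, he⟩ := exists_edge_equiv hL hL'
  obtain ⟨-, -, h⟩ := he E
  have hi := isometry_plane (n := F.normal) (L := L) F.level
  refine ⟨?_, ?_, ?_⟩
  · rw [h]
    refine (Set.image_mono ((e E).carrier_subset_frontier.trans frontier_subset_closure)).trans ?_
    exact (image_closure_subset_closure_image hi.continuous).trans
      (closure_mono (Set.image_preimage_subset _ _))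
  · rw [h]
    exact (measurableEmbedding_plane (n := F.normal) (L := L) F.level).measurableSet_image'
      ((e E).measurableSet_carrier hQ.isOpen)
  · rw [h, hi.euclideanHausdorffMeasure_image]
    exact (e E).measure_carrier_lt_top hQ.isBounded

theorem Edge.carrier_subset_closure (hK : IsPolyhedron K) {F : Face K} (E : Edge F) :
    E.carrier ⊆ closure K :=
  (E.carrier_properties hK).1.trans (closure_minimal
    (F.carrier_subset_frontier.trans frontier_subset_closure) isClosed_closure)

theorem Edge.isFiniteMeasure_length (hK : IsPolyhedron K) {F : Face K} (E : Edge F) :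
    IsFiniteMeasure E.length :=
  isFiniteMeasure_restrict.2 (E.carrier_properties hK).2.2.ne

/-- The divergence theorem in a polyhedron. -/
theorem IsPolyhedron.integral_deriv (hK : IsPolyhedron K) {w : R3 → ℝ} {dw : R3 → R3 →L[ℝ] ℝ}
    (h : IsC1Upto K w dw) (a : R3) :
    ∫ x in K, dw x a = ∑ᶠ F : Face K, inner ℝ F.normal a * ∫ x, w x ∂F.area := by
  obtain ⟨P, hP⟩ := hK.exists_isPiecewiseFlat
  rw [hP.hasDivergenceFormula h a, ← finsum_comp_equiv (Face.equiv K)]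
  rfl

/-- The divergence theorem on a face. -/
theorem Face.integral_deriv (hK : IsPolyhedron K) (F : Face K) {w : R3 → ℝ}
    {dw : R3 → R3 →L[ℝ] ℝ} (hw : ContinuousOn w (closure F.carrier))
    (hdw : ∀ x ∈ F.carrier, HasFDerivWithinAt w (dw x) (closure K) x)
    (hdwc : ContinuousOn dw F.carrier) {M : ℝ} (hM : ∀ x ∈ F.carrier, ‖dw x‖ ≤ M) {a : R3}
    (ha : inner ℝ F.normal a = 0) :
    ∫ x, dw x a ∂F.area = ∑ᶠ E : Edge F, inner ℝ E.conormal a * ∫ x, w x ∂E.length := by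
  obtain ⟨L, hL, hL'⟩ := exists_hyperplane_isometry F.normal F.norm_normal
  obtain ⟨Q, hQ⟩ := FlatFace.exists_isPiecewiseFlat hK (Face.equiv K F) hL hL'
  obtain ⟨e, he⟩ := exists_edge_equiv hL hL'
  obtain ⟨a, rfl⟩ := hL' a ha
  set A := fun y => L y + F.level • F.normal with hA
  have hi : Isometry A := isometry_plane F.level
  have hUdef : (Face.equiv K F).inPlane L = A ⁻¹' F.carrier := rfl
  have hC1 : IsC1Upto ((Face.equiv K F).inPlane L) (fun y => w (A y))
      (fun y => (dw (A y)).comp L.toContinuousLinearMap) := by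
    refine ⟨?_, fun y hy => ?_, ?_, M, fun y hy => ?_⟩
    · refine hw.comp hi.continuous.continuousOn fun y hy => ?_
      exact closure_mono (Set.image_preimage_subset _ _)
        (image_closure_subset_closure_image hi.continuous ⟨y, hy, rfl⟩)
    · have hd : HasFDerivAt A L.toContinuousLinearMap y :=
        L.toContinuousLinearMap.hasFDerivAt.add_const _
      -- A derivative within `closure K` suffices, because `A` maps a whole neighbourhood of `y`
      -- into the face and hence into the closure.
      refine (hdw (A y) hy).comp_hasFDerivAt y hd ?_
      filter_upwards [hQ.isOpen.mem_nhds hy] with z hz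
      exact (F.carrier_subset_frontier hz).1
    · have h1 : ContinuousOn (fun y => dw (A y)) ((Face.equiv K F).inPlane L) :=
        hdwc.comp hi.continuous.continuousOn fun y hy => hy
      exact h1.clm_comp continuousOn_const
    · refine (ContinuousLinearMap.opNorm_comp_le _ _).trans ?_
      exact (mul_le_of_le_one_right (norm_nonneg _) L.norm_toContinuousLinearMap_le).trans (hM _ hy)
  have h := hQ.hasDivergenceFormula hC1 a
  rw [← finsum_comp_equiv e] at h
  have hl : ∫ x, dw x (L a) ∂F.area = ∫ y in (Face.equiv K F).inPlane L, dw (A y) (L a) :=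
    setIntegral_plane F.norm_normal hL hL' (Face.equiv K F).carrier_subset_plane _
  rw [hl]
  refine Eq.trans h (finsum_congr fun E => ?_)
  obtain ⟨h1, h2, h3⟩ := he E
  rw [← h1, L.inner_map_map]
  congr 1
  rw [Edge.length, h3]
  have hme := measurableEmbedding_plane (n := F.normal) (L := L) F.level
  have h4 := hme.setIntegral_map (μ := (μHE[1] : Measure (Eu 2))) w (A '' (e E).carrier)
  rw [hi.map_euclideanHausdorffMeasure, Measure.restrict_restrict_of_subset
    (Set.image_subset_range _ _), Set.preimage_image_eq _ hi.injective] at h4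
  exact h4.symm

end Finiteness

/-! ### Derivatives up to order two and pointwise bounds for directional derivatives. -/

section Jet

/-- The partial derivatives of order at most two. -/
noncomputable def jet : Option (Fin 3 × Option (Fin 3)) → (R3 → ℝ) → R3 → ℝ
  | none, φ => φ
  | some (i, none), φ => fun x => fderiv ℝ φ x (basisVec i)
  | some (i, some j), φ => fun x => fderiv ℝ (fun y => fderiv ℝ φ y (basisVec i)) x (basisVec j)

theorem contDiff_partial {φ : R3 → ℝ} (hφ : ContDiff ℝ ∞ φ) (b : R3) :
    ContDiff ℝ ∞ fun x => fderiv ℝ φ x b :=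
  (hφ.fderiv_right (by simp)).clm_apply contDiff_const

theorem contDiff_jet {φ : R3 → ℝ} (hφ : ContDiff ℝ ∞ φ) :
    ∀ α, ContDiff ℝ ∞ (jet α φ)
  | none => hφ
  | some (_, none) => contDiff_partial hφ _
  | some (_, some _) => contDiff_partial (contDiff_partial hφ _) _

/-- The sum of the squares of the function and its first partial derivatives. -/
noncomputable def gradSq (ψ : R3 → ℝ) (x : R3) : ℝ :=
  ψ x ^ 2 + ∑ i, (fderiv ℝ ψ x (basisVec i)) ^ 2

/-- The sum of the squares of the partial derivatives of order at most two. -/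
noncomputable def jetSq (φ : R3 → ℝ) (x : R3) : ℝ := ∑ α, (jet α φ x) ^ 2

theorem jetSq_eq (φ : R3 → ℝ) (x : R3) :
    jetSq φ x = φ x ^ 2 + ∑ i, gradSq (fun y => fderiv ℝ φ y (basisVec i)) x := by
  simp [jetSq, gradSq, Fintype.sum_option, Fintype.sum_prod_type, jet]

theorem gradSq_nonneg (ψ : R3 → ℝ) (x : R3) : 0 ≤ gradSq ψ x := by unfold gradSq; positivity

theorem jetSq_nonneg (φ : R3 → ℝ) (x : R3) : 0 ≤ jetSq φ x := by unfold jetSq; positivity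

theorem continuous_gradSq {ψ : R3 → ℝ} (hψ : ContDiff ℝ ∞ ψ) : Continuous (gradSq ψ) := by
  unfold gradSq
  have h := fun i => (contDiff_partial hψ (basisVec i)).continuous
  have := hψ.continuous
  fun_prop

theorem continuous_jetSq {φ : R3 → ℝ} (hφ : ContDiff ℝ ∞ φ) : Continuous (jetSq φ) := by
  unfold jetSq
  have h := fun α => (contDiff_jet hφ α).continuous
  fun_prop

theorem eq_sum_basisVec (b : R3) : b = ∑ i, b i • basisVec i := by
  ext j
  simp [basisVec, Finset.sum_apply, Pi.single_apply]

theorem fderiv_apply_eq_sum (φ : R3 → ℝ) (x b : R3) :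
    fderiv ℝ φ x b = ∑ i, b i * fderiv ℝ φ x (basisVec i) := by
  conv_lhs => rw [eq_sum_basisVec b]
  simp

theorem sq_sum_mul_le (b : R3) (g : Fin 3 → ℝ) : (∑ i, b i * g i) ^ 2 ≤ ‖b‖ ^ 2 * ∑ i, g i ^ 2 := by
  rw [EuclideanSpace.real_norm_sq_eq]
  exact Finset.sum_mul_sq_le_sq_mul_sq _ _ _

theorem sq_fderiv_apply_le (ψ : R3 → ℝ) (x b : R3) :
    (fderiv ℝ ψ x b) ^ 2 ≤ ‖b‖ ^ 2 * gradSq ψ x := by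
  rw [fderiv_apply_eq_sum]
  refine (sq_sum_mul_le _ _).trans ?_
  unfold gradSq
  gcongr
  nlinarith [sq_nonneg (ψ x)]

theorem sum_gradSq_le (φ : R3 → ℝ) (x : R3) :
    ∑ i, gradSq (fun y => fderiv ℝ φ y (basisVec i)) x ≤ jetSq φ x := by
  rw [jetSq_eq]
  nlinarith [sq_nonneg (φ x)]

theorem gradSq_le_jetSq (φ : R3 → ℝ) (x : R3) : gradSq φ x ≤ jetSq φ x := by
  rw [jetSq_eq, gradSq]
  gcongr with i
  unfold gradSq
  have : (0 : ℝ) ≤ ∑ j, (fderiv ℝ (fun y => fderiv ℝ φ y (basisVec i)) x (basisVec j)) ^ 2 := by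
    positivity
  linarith

theorem sq_fderiv_fderiv_apply_le {φ : R3 → ℝ} (hφ : ContDiff ℝ ∞ φ) (x b : R3) :
    (fderiv ℝ (fun y => fderiv ℝ φ y b) x b) ^ 2 ≤ ‖b‖ ^ 2 * ‖b‖ ^ 2 * jetSq φ x := by
  have h1 : (fun y => fderiv ℝ φ y b) = fun y => ∑ i, b i * fderiv ℝ φ y (basisVec i) := by
    ext y; exact fderiv_apply_eq_sum φ y b
  have h2 : fderiv ℝ (fun y => fderiv ℝ φ y b) x b =
      ∑ i, b i * fderiv ℝ (fun y => fderiv ℝ φ y (basisVec i)) x b := by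
    have hd : ∀ i, DifferentiableAt ℝ (fun y => fderiv ℝ φ y (basisVec i)) x := fun i =>
      (contDiff_partial hφ _).differentiable (by simp) x
    rw [h1, fderiv_fun_sum fun i _ => (hd i).const_mul _]
    simp only [sum_apply]
    refine Finset.sum_congr rfl fun i _ => ?_
    rw [fderiv_const_mul (hd i)]
    simp
  rw [h2]
  refine (sq_sum_mul_le _ _).trans ?_
  rw [mul_assoc]
  refine mul_le_mul_of_nonneg_left ?_ (by positivity)
  refine (Finset.sum_le_sum fun i _ => sq_fderiv_apply_le _ x b).trans ?_
  rw [← Finset.mul_sum]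
  exact mul_le_mul_of_nonneg_left (sum_gradSq_le φ x) (by positivity)

end Jet

/-! ### Squared Sobolev norms and one-dimensional inequalities. -/

section Energy

theorem enorm_sq_eq (y : ℝ) : ‖y‖ₑ ^ 2 = ENNReal.ofReal (y ^ 2) := by
  rw [← ofReal_norm, ← ENNReal.ofReal_pow (norm_nonneg y), Real.norm_eq_abs, sq_abs]

/-- The squared norm of `H¹(K)`. -/
noncomputable def energyOne (K : Set R3) (ψ : R3 → ℝ) : ℝ≥0∞ :=
  ∫⁻ x in K, ENNReal.ofReal (gradSq ψ x)

/-- The squared norm of `H²(K)`. -/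
noncomputable def energyTwo (K : Set R3) (φ : R3 → ℝ) : ℝ≥0∞ :=
  ∫⁻ x in K, ENNReal.ofReal (jetSq φ x)

theorem energyOne_partial_le (K : Set R3) (φ : R3 → ℝ) (i : Fin 3) :
    energyOne K (fun y => fderiv ℝ φ y (basisVec i)) ≤ energyTwo K φ := by
  refine lintegral_mono fun x => ENNReal.ofReal_le_ofReal ?_
  exact (Finset.single_le_sum (f := fun i => gradSq (fun y => fderiv ℝ φ y (basisVec i)) x)
    (fun i _ => gradSq_nonneg _ x) (Finset.mem_univ i)).trans (sum_gradSq_le φ x)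

/-- Jensen's inequality for squares. -/
theorem sq_lintegral_le {X : Type*} [MeasurableSpace X] {μ : Measure X} (hμ : μ Set.univ ≤ 1)
    {g : X → ℝ≥0∞} (hg : AEMeasurable g μ) : (∫⁻ x, g x ∂μ) ^ 2 ≤ ∫⁻ x, g x ^ 2 ∂μ := by
  have h := ENNReal.lintegral_mul_le_Lp_mul_Lq μ Real.HolderConjugate.two_two hg
    (aemeasurable_const (b := (1 : ℝ≥0∞)))
  simp only [Pi.mul_apply, mul_one, ENNReal.rpow_two, lintegral_const,
    one_mul, one_pow] at h
  have h1 : (μ Set.univ) ^ (1 / 2 : ℝ) ≤ 1 := by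
    simpa using ENNReal.rpow_le_rpow (z := (1 / 2 : ℝ)) hμ (by norm_num)
  have h2 := h.trans (mul_le_of_le_one_right' h1)
  calc (∫⁻ x, g x ∂μ) ^ 2 ≤ ((∫⁻ x, g x ^ 2 ∂μ) ^ (1 / 2 : ℝ)) ^ 2 := by gcongr
    _ = _ := by
      rw [← ENNReal.rpow_natCast, ← ENNReal.rpow_mul]
      norm_num

/-- The square of an increment over the unit interval is at most the integral of the square of the
derivative. -/
theorem enorm_sq_sub_le_lintegral {F F' : ℝ → ℝ} (hF : ∀ s, HasDerivAt F (F' s) s)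
    (hF' : Continuous F') :
    ‖F 1 - F 0‖ₑ ^ 2 ≤ ∫⁻ s in Set.Ioc (0 : ℝ) 1, ENNReal.ofReal (F' s ^ 2) := by
  have h1 : ∫ s in (0 : ℝ)..1, F' s = F 1 - F 0 :=
    intervalIntegral.integral_eq_sub_of_hasDerivAt (fun s _ => hF s) (hF'.intervalIntegrable _ _)
  rw [← h1, intervalIntegral.integral_of_le zero_le_one]
  refine (pow_le_pow_left' (enorm_integral_le_lintegral_enorm _) 2).trans ?_
  refine (sq_lintegral_le (by simp) (by fun_prop)).trans (le_of_eq ?_)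
  simp_rw [enorm_sq_eq]

theorem lintegral_comp_smul {E : Type*} [NormedAddCommGroup E] [NormedSpace ℝ E]
    [MeasurableSpace E] [BorelSpace E] [FiniteDimensional ℝ E] (μ : Measure E) [μ.IsAddHaarMeasure]
    {r : ℝ} (hr : r ≠ 0) (g : E → ℝ≥0∞) :
    ∫⁻ x, g (r • x) ∂μ = ENNReal.ofReal |(r ^ Module.finrank ℝ E)⁻¹| * ∫⁻ x, g x ∂μ := by
  have h := (Homeomorph.smulOfNeZero r hr).measurableEmbedding.lintegral_map (μ := μ) g
  have h2 := Measure.map_addHaar_smul μ hr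
  change Measure.map (Homeomorph.smulOfNeZero r hr) μ = _ at h2
  rw [h2, lintegral_smul_measure] at h
  exact h.symm

end Energy

/-! ### The Sobolev bound of the supremum by the `H²` norm. -/

section Sup

variable {K : Set R3}

/-- The combination is the second derivative of `(1 - t)² p(t)`, with `u = 1 - t` and `p` the
function along a ray with direction of norm at most `M`. The bound is `(a + b + c)² ≤ 3 (a² + b² +
c²)` with generous constants. -/
theorem sq_combination_le {u p p' p'' M J : ℝ} (hu0 : 0 ≤ u) (hu1 : u ≤ 1) (h0 : p ^ 2 ≤ J)
    (h1 : p' ^ 2 ≤ M ^ 2 * J) (h2 : p'' ^ 2 ≤ M ^ 2 * M ^ 2 * J) :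
    (2 * p - 4 * u * p' + u ^ 2 * p'') ^ 2 ≤ 48 * (1 + M ^ 2) ^ 2 * J := by
  have hJ : 0 ≤ J := (sq_nonneg p).trans h0
  have hu2 : u ^ 2 ≤ 1 := pow_le_one₀ hu0 hu1
  have r1 : (u * p') ^ 2 ≤ M ^ 2 * J := by
    rw [mul_pow]
    exact (mul_le_of_le_one_left (sq_nonneg p') hu2).trans h1
  have r2 : (u ^ 2 * p'') ^ 2 ≤ M ^ 2 * M ^ 2 * J := by
    rw [mul_pow]
    exact (mul_le_of_le_one_left (sq_nonneg p'') (pow_le_one₀ (sq_nonneg u) hu2)).trans h2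
  have r3 : (2 * p - 4 * u * p' + u ^ 2 * p'') ^ 2 ≤
      3 * (4 * p ^ 2 + 16 * (u * p') ^ 2 + (u ^ 2 * p'') ^ 2) := by
    generalize u ^ 2 * p'' = z
    rw [mul_assoc]
    generalize u * p' = y
    linarith [sq_nonneg (2 * p + 4 * y), sq_nonneg (2 * p - z), sq_nonneg (4 * y + z)]
  have r4 : 0 ≤ M ^ 2 * J := by positivity
  have r5 : 0 ≤ M ^ 2 * M ^ 2 * J := by positivity
  linarith

/-- Pointwise bound along the path `s ↦ x + s² b`. -/
theorem enorm_sq_le_lintegral_path {φ : R3 → ℝ} (hφ : ContDiff ℝ ∞ φ) (x : R3) {b : R3} {M : ℝ}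
    (hbM : ‖b‖ ≤ M) : ‖φ x‖ₑ ^ 2 ≤ ∫⁻ s in Set.Ioc (0 : ℝ) 1,
      ENNReal.ofReal (192 * (1 + M ^ 2) ^ 2 * s ^ 6 * jetSq φ (x + s ^ 2 • b)) := by
  set p : ℝ → ℝ := fun t => φ (x + t • b) with hp
  set p' : ℝ → ℝ := fun t => fderiv ℝ φ (x + t • b) b with hp'
  set p'' : ℝ → ℝ := fun t => fderiv ℝ (fun y => fderiv ℝ φ y b) (x + t • b) b with hp''
  have hline : ∀ t, HasDerivAt (fun t : ℝ => x + t • b) b t := fun t => by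
    simpa using ((hasDerivAt_id t).smul_const b).const_add x
  have hd1 : ∀ t, HasDerivAt p (p' t) t := fun t =>
    (hφ.differentiable (by simp) _).hasFDerivAt.comp_hasDerivAt t (hline t)
  have hd2 : ∀ t, HasDerivAt p' (p'' t) t := fun t =>
    ((contDiff_partial hφ b).differentiable (by simp) _).hasFDerivAt.comp_hasDerivAt t (hline t)
  -- For `q(t) = (1 - t)² p(t)` one has `q(0) = φ x` and `q(1) = q'(1) = 0`. The function `G = t q'
  -- - q` has derivative `t q''` and increment `φ x` over the unit interval. Substituting `t = s²`
  -- turns the integrand into `2 s³ q''(s²)`, whose square carries the weight `4 s⁶`.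
  set G : ℝ → ℝ := fun t => t * (-2 * (1 - t) * p t + (1 - t) ^ 2 * p' t) - (1 - t) ^ 2 * p t
  set G' : ℝ → ℝ := fun t => t * (2 * p t - 4 * (1 - t) * p' t + (1 - t) ^ 2 * p'' t)
  have hG : ∀ t, HasDerivAt G (G' t) t := by
    intro t
    have h0 : HasDerivAt (fun t : ℝ => 1 - t) (-1) t := (hasDerivAt_id t).const_sub 1
    have h1 : HasDerivAt G _ t := ((hasDerivAt_id t).mul (((h0.const_mul (-2)).mul (hd1 t)).add
      ((h0.pow 2).mul (hd2 t)))).sub ((h0.pow 2).mul (hd1 t))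
    refine h1.congr_deriv ?_
    simp only [G', id, Pi.mul_apply, Pi.add_apply, Pi.pow_apply]
    push_cast
    ring
  have hF : ∀ s, HasDerivAt (fun s : ℝ => G (s ^ 2)) (G' (s ^ 2) * (2 * s)) s := fun s => by
    have h1 : HasDerivAt (fun s : ℝ => G (s ^ 2)) _ s :=
      HasDerivAt.comp (h₂ := G) (h := fun s : ℝ => s ^ 2) s (hG (s ^ 2)) (hasDerivAt_pow 2 s)
    exact h1.congr_deriv (by simp)
  have hpc : Continuous p := by have := hφ.continuous; fun_prop
  have hpc' : Continuous p' := by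
    have := (contDiff_partial hφ b).continuous
    exact this.comp (by fun_prop)
  have hpc'' : Continuous p'' :=
    (contDiff_partial (contDiff_partial hφ b) b).continuous.comp
      (g := fun y => fderiv ℝ (fun y => fderiv ℝ φ y b) y b) (by fun_prop)
  have hmain := enorm_sq_sub_le_lintegral hF (by simp only [G']; fun_prop)
  have e1 : G (1 ^ 2) - G (0 ^ 2) = φ x := by simp [G, hp]
  simp only [e1] at hmain
  refine hmain.trans (setLIntegral_mono' measurableSet_Ioc fun s hs => ?_)
  refine ENNReal.ofReal_le_ofReal ?_
  have hs0 := hs.1.le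
  have hs1 := hs.2
  set t := s ^ 2
  have ht0 : 0 ≤ 1 - t := by simp only [t]; nlinarith
  have ht1 : 1 - t ≤ 1 := by simp only [t]; nlinarith
  set J := jetSq φ (x + t • b)
  have hJ0 : 0 ≤ J := jetSq_nonneg _ _
  have hbM2 : ‖b‖ ^ 2 ≤ M ^ 2 := by gcongr
  have q0 : p t ^ 2 ≤ J := by
    have h1 := jetSq_eq φ (x + t • b)
    have h2 : 0 ≤ ∑ i, gradSq (fun y => fderiv ℝ φ y (basisVec i)) (x + t • b) :=
      Finset.sum_nonneg fun i _ => gradSq_nonneg _ _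
    simp only [hp, J]; linarith
  have q1 : p' t ^ 2 ≤ M ^ 2 * J := by
    refine (sq_fderiv_apply_le φ (x + t • b) b).trans ?_
    exact mul_le_mul hbM2 (gradSq_le_jetSq _ _) (gradSq_nonneg _ _) (by positivity)
  have q2 : p'' t ^ 2 ≤ M ^ 2 * M ^ 2 * J := by
    refine (sq_fderiv_fderiv_apply_le hφ (x + t • b) b).trans ?_
    gcongr
  have hsum := sq_combination_le (J := J) ht0 ht1 q0 q1 q2
  calc (G' t * (2 * s)) ^ 2
      = 4 * s ^ 6 * (2 * p t - 4 * (1 - t) * p' t + (1 - t) ^ 2 * p'' t) ^ 2 := by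
        simp only [G', t]; ring
    _ ≤ 4 * s ^ 6 * (48 * (1 + M ^ 2) ^ 2 * J) := by gcongr
    _ = 192 * (1 + M ^ 2) ^ 2 * s ^ 6 * J := by ring

/-- The path estimate is averaged over the directions `b` of the cone. In dimension three the
substitution `y = x + s² b` has inverse Jacobian `s⁻⁶`, which the weight `s⁶` cancels exactly. This
is the reason for the quadratic path: the linear one would leave the divergent `∫ dt / t`. -/
theorem IsConeAt.sup_bound (hK : IsOpen K) {x₀ a : R3} {r δ : ℝ} (h : IsConeAt K x₀ r a δ)
    (hδ : 0 < δ) : ∃ C : ℝ≥0, ∀ φ : R3 → ℝ, ContDiff ℝ ∞ φ → ∀ x ∈ closure K ∩ Metric.ball x₀ r,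
      ‖φ x‖ₑ ^ 2 ≤ C * energyTwo K φ := by
  set M := ‖a‖ + δ with hM
  set D : ℝ := 192 * (1 + M ^ 2) ^ 2 with hD
  have hD0 : 0 ≤ D := by positivity
  set B := Metric.ball a δ with hB
  have hBpos : 0 < volume B := Metric.measure_ball_pos _ _ hδ
  have hBtop : volume B ≠ ⊤ := measure_ball_lt_top.ne
  refine ⟨(ENNReal.ofReal D / volume B).toNNReal, fun φ hφ x hx => ?_⟩
  rw [ENNReal.coe_toNNReal (ENNReal.div_ne_top ENNReal.ofReal_ne_top hBpos.ne')]
  have hpt : ∀ b ∈ B, ‖φ x‖ₑ ^ 2 ≤ ∫⁻ s in Set.Ioc (0 : ℝ) 1,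
      ENNReal.ofReal (D * s ^ 6 * jetSq φ (x + s ^ 2 • b)) := by
    intro b hb
    refine enorm_sq_le_lintegral_path hφ x ?_
    have h1 := norm_le_norm_add_norm_sub' b a
    rw [hB, Metric.mem_ball, dist_eq_norm] at hb
    linarith
  -- average over the directions
  have hjc := continuous_jetSq hφ
  have hint : volume B * ‖φ x‖ₑ ^ 2 ≤ ENNReal.ofReal D * energyTwo K φ := by
    calc volume B * ‖φ x‖ₑ ^ 2 = ∫⁻ _ in B, ‖φ x‖ₑ ^ 2 := by
          rw [setLIntegral_const, mul_comm]
      _ ≤ ∫⁻ b in B, ∫⁻ s in Set.Ioc (0 : ℝ) 1,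
            ENNReal.ofReal (D * s ^ 6 * jetSq φ (x + s ^ 2 • b)) :=
          setLIntegral_mono' measurableSet_ball hpt
      _ = ∫⁻ s in Set.Ioc (0 : ℝ) 1, ∫⁻ b in B,
            ENNReal.ofReal (D * s ^ 6 * jetSq φ (x + s ^ 2 • b)) := by
          refine lintegral_lintegral_swap (Continuous.aemeasurable ?_)
          simp only [Function.uncurry_def]
          exact ENNReal.continuous_ofReal.comp (by fun_prop)
      _ ≤ ∫⁻ _ in Set.Ioc (0 : ℝ) 1, ENNReal.ofReal D * energyTwo K φ := by
          refine setLIntegral_mono' measurableSet_Ioc fun s hs => ?_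
          have hs6 : 0 ≤ D * s ^ 6 := by have := hs.1; positivity
          simp_rw [ENNReal.ofReal_mul hs6]
          rw [lintegral_const_mul _ (by fun_prop), ENNReal.ofReal_mul hD0, mul_assoc]
          refine mul_le_mul_right ?_ _
          set g : R3 → ℝ≥0∞ := K.indicator fun y => ENNReal.ofReal (jetSq φ y)
          have h1 : ∫⁻ b in B, ENNReal.ofReal (jetSq φ (x + s ^ 2 • b)) ≤
              ∫⁻ b, g (x + s ^ 2 • b) := by
            rw [← lintegral_indicator measurableSet_ball]
            refine lintegral_mono fun b => ?_
            by_cases hb : b ∈ B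
            · have hmem : x + s ^ 2 • b ∈ K := h x hx (s ^ 2)
                ⟨by have := hs.1; positivity, pow_le_one₀ hs.1.le hs.2⟩ b hb
              rw [Set.indicator_of_mem (show b ∈ Metric.ball a δ from hb)]
              simp [g, Set.indicator_of_mem hmem]
            · rw [Set.indicator_of_notMem (show b ∉ Metric.ball a δ from hb)]
              exact zero_le
          have hs2 : s ^ 2 ≠ 0 := pow_ne_zero 2 hs.1.ne'
          have h2 := lintegral_comp_smul (volume : Measure R3) hs2 (fun z => g (x + z))
          rw [lintegral_add_left_eq_self g x] at h2
          have h3 : ∫⁻ y, g y = energyTwo K φ := lintegral_indicator hK.measurableSet _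
          rw [h2, h3] at h1
          refine (mul_le_mul_right h1 _).trans ?_
          rw [← mul_assoc, ← ENNReal.ofReal_mul (by have := hs.1; positivity)]
          have h4 : s ^ 6 * |((s ^ 2) ^ Module.finrank ℝ R3)⁻¹| = 1 := by
            rw [finrank_euclideanSpace_fin, ← pow_mul, abs_of_pos (by have := hs.1; positivity)]
            exact mul_inv_cancel₀ (pow_ne_zero 6 hs.1.ne')
          rw [h4]
          simp
      _ = ENNReal.ofReal D * energyTwo K φ := by simp
  rw [ENNReal.div_eq_inv_mul, mul_assoc]
  calc ‖φ x‖ₑ ^ 2 = (volume B)⁻¹ * (volume B * ‖φ x‖ₑ ^ 2) := by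
        rw [← mul_assoc, ENNReal.inv_mul_cancel hBpos.ne' hBtop, one_mul]
    _ ≤ _ := by gcongr

/-- The Sobolev inequality up to the boundary. -/
theorem IsPolyhedron.sup_bound (hK : IsPolyhedron K) :
    ∃ C : ℝ≥0, ∀ φ : R3 → ℝ, ContDiff ℝ ∞ φ → ∀ x ∈ closure K,
      ‖φ x‖ₑ ^ 2 ≤ C * energyTwo K φ := by
  refine hK.isBounded.isCompact_closure.induction_on
    (p := fun s => ∃ C : ℝ≥0, ∀ φ : R3 → ℝ, ContDiff ℝ ∞ φ → ∀ x ∈ s,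
      ‖φ x‖ₑ ^ 2 ≤ C * energyTwo K φ) ⟨0, by simp⟩ ?_ ?_ ?_
  · rintro s t hst ⟨C, hC⟩
    exact ⟨C, fun φ hφ x hx => hC φ hφ x (hst hx)⟩
  · rintro s t ⟨C, hC⟩ ⟨C', hC'⟩
    refine ⟨C + C', fun φ hφ x hx => ?_⟩
    rw [ENNReal.coe_add, add_mul]
    rcases hx with hx | hx
    · exact (hC φ hφ x hx).trans le_self_add
    · exact (hC' φ hφ x hx).trans le_add_self
  · intro x hx
    obtain ⟨r, hr, a, δ, hδ, h⟩ := exists_isConeAt hK.isOpen hK.lipschitz hx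
    exact ⟨closure K ∩ Metric.ball x r,
      inter_mem self_mem_nhdsWithin (mem_nhdsWithin_of_mem_nhds (Metric.ball_mem_nhds x hr)),
      h.sup_bound hK.isOpen hδ⟩

end Sup

/-! ### The `H¹` trace inequality on faces. -/

section FaceTrace

variable {K : Set R3}

/-- Along the inward segment `x + t a` the function `(1 - t) ψ` vanishes at `t = 1`, so `ψ x ^ 2` is
bounded by an integral of `gradSq ψ` over the segment. Integration over the face is then Fubini in
skew coordinates, nondegenerate because the axis is transversal to the face. -/
theorem IsConeAt.face_bound (hK : IsPolyhedron K) {x₀ a : R3} {r δ : ℝ} (h : IsConeAt K x₀ r a δ)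
    (hδ : 0 < δ) (F : Face K) : ∃ C : ℝ≥0, ∀ ψ : R3 → ℝ, ContDiff ℝ ∞ ψ →
      ∫⁻ x in F.carrier ∩ Metric.ball x₀ r, ‖ψ x‖ₑ ^ 2 ∂(μHE[2] : Measure R3) ≤ C * energyOne K ψ := by
  -- The transversality `⟪n, a⟫ < 0` is read off at a point of the face in the ball, so the empty
  -- case is separate.
  rcases (F.carrier ∩ Metric.ball x₀ r).eq_empty_or_nonempty with hemp | ⟨z, hzF, hzr⟩
  · exact ⟨0, by simp [hemp]⟩
  have hneg := h.inner_neg hδ F.norm_normal ((Face.equiv K F).carrier_subset hzF) hzr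
  change inner ℝ F.normal a < 0 at hneg
  set k := inner ℝ F.normal a with hk
  obtain ⟨L, hL, hL'⟩ := exists_hyperplane_isometry F.normal F.norm_normal
  set A := fun y => L y + F.level • F.normal with hA
  have hk0 : k ≠ 0 := hneg.ne
  -- The skew coordinates need a direction with inner product one. The factor `k⁻¹` is negative,
  -- which is harmless because the integrals run over whole lines, with the integrand extended by
  -- zero outside `K`.
  have ha1 : inner ℝ F.normal (k⁻¹ • a) = 1 := by
    rw [inner_smul_right, ← hk, inv_mul_cancel₀ hk0]
  have hΦ := measurePreserving_skew_coords F.norm_normal hL hL' F.level ha1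
  set D : ℝ := 2 * (1 + ‖a‖ ^ 2) with hD
  have hD0 : 0 ≤ D := by positivity
  refine ⟨(D * |k⁻¹|).toNNReal, fun ψ hψ => ?_⟩
  change _ ≤ ENNReal.ofReal (D * |k⁻¹|) * _
  have hgc := continuous_gradSq hψ
  set g : R3 → ℝ≥0∞ := K.indicator fun y => ENNReal.ofReal (gradSq ψ y) with hg
  have hgm : Measurable g :=
    (ENNReal.measurable_ofReal.comp hgc.measurable).indicator hK.isOpen.measurableSet
  have hpt : ∀ x ∈ F.carrier ∩ Metric.ball x₀ r,
      ‖ψ x‖ₑ ^ 2 ≤ ENNReal.ofReal D * ∫⁻ t : ℝ, g (x + t • a) := by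
    rintro x ⟨hxF, hxr⟩
    have hline : ∀ t, HasDerivAt (fun t : ℝ => x + t • a) a t := fun t => by
      simpa using ((hasDerivAt_id t).smul_const a).const_add x
    set p : ℝ → ℝ := fun t => ψ (x + t • a) with hp
    set p' : ℝ → ℝ := fun t => fderiv ℝ ψ (x + t • a) a with hp'
    have hd1 : ∀ t, HasDerivAt p (p' t) t := fun t =>
      (hψ.differentiable (by simp) _).hasFDerivAt.comp_hasDerivAt t (hline t)
    have hF : ∀ t, HasDerivAt (fun t => (1 - t) * p t) (-p t + (1 - t) * p' t) t := fun t => by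
      have h0 : HasDerivAt (fun t : ℝ => 1 - t) (-1) t := (hasDerivAt_id t).const_sub 1
      have h1 : HasDerivAt (fun t => (1 - t) * p t) _ t := h0.mul (hd1 t)
      exact h1.congr_deriv (by simp)
    have hpc : Continuous p := by have := hψ.continuous; fun_prop
    have hpc' : Continuous p' := by
      have := (contDiff_partial hψ a).continuous
      exact this.comp (by fun_prop)
    have hmain := enorm_sq_sub_le_lintegral hF (by fun_prop)
    have e1 : (1 - 1 : ℝ) * p 1 - (1 - 0) * p 0 = -ψ x := by simp [hp]
    rw [e1, enorm_neg] at hmain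
    refine hmain.trans ?_
    rw [← lintegral_const_mul' _ _ ENNReal.ofReal_ne_top, ← lintegral_indicator measurableSet_Ioc]
    refine lintegral_mono fun t => ?_
    by_cases ht : t ∈ Set.Ioc (0 : ℝ) 1
    · have hmem : x + t • a ∈ K :=
        h x ⟨(F.carrier_subset_frontier hxF).1, hxr⟩ t ht a (Metric.mem_ball_self hδ)
      rw [Set.indicator_of_mem ht, hg, Set.indicator_of_mem hmem, ← ENNReal.ofReal_mul hD0]
      refine ENNReal.ofReal_le_ofReal ?_
      have h1 := sq_fderiv_apply_le ψ (x + t • a) a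
      have h2 : ψ (x + t • a) ^ 2 ≤ gradSq ψ (x + t • a) := by
        unfold gradSq
        have : (0 : ℝ) ≤ ∑ i, (fderiv ℝ ψ (x + t • a) (basisVec i)) ^ 2 := by positivity
        linarith
      have h3 : ((1 - t) * p' t) ^ 2 ≤ p' t ^ 2 := by
        rw [mul_pow]
        have := ht.1
        have := ht.2
        exact mul_le_of_le_one_left (sq_nonneg _) (by nlinarith)
      have h4 : (-p t + (1 - t) * p' t) ^ 2 ≤ 2 * (p t ^ 2 + ((1 - t) * p' t) ^ 2) := by
        nlinarith [sq_nonneg (p t + (1 - t) * p' t)]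
      simp only [hp, hp'] at *
      rw [hD]
      nlinarith
    · rw [Set.indicator_of_notMem ht]
      exact zero_le
  have hmeasF : MeasurableSet (F.carrier ∩ Metric.ball x₀ r) :=
    (F.measurableSet_carrier hK).inter measurableSet_ball
  have hsub : F.carrier ∩ Metric.ball x₀ r ⊆ {x | inner ℝ F.normal x = F.level} :=
    Set.inter_subset_left.trans (Face.equiv K F).carrier_subset_plane
  have hscale : ∀ x : R3, ∫⁻ t : ℝ, g (x + t • a) =
      ENNReal.ofReal |k⁻¹| * ∫⁻ t : ℝ, g (x + t • (k⁻¹ • a)) := fun x => by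
    have h1 := lintegral_comp_smul (volume : Measure ℝ) hk0 (fun t => g (x + t • (k⁻¹ • a)))
    rw [Module.finrank_self, pow_one] at h1
    rw [← h1]
    refine lintegral_congr fun t => ?_
    rw [smul_smul, smul_eq_mul, mul_comm k t, mul_assoc, mul_inv_cancel₀ hk0, mul_one]
  calc ∫⁻ x in F.carrier ∩ Metric.ball x₀ r, ‖ψ x‖ₑ ^ 2 ∂(μHE[2] : Measure R3)
      ≤ ∫⁻ x in F.carrier ∩ Metric.ball x₀ r, (ENNReal.ofReal D * ∫⁻ t : ℝ, g (x + t • a))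
          ∂(μHE[2] : Measure R3) :=
        setLIntegral_mono' hmeasF hpt
    _ ≤ ∫⁻ y : Eu 2, ENNReal.ofReal D * ∫⁻ t : ℝ, g (A y + t • a) := by
        refine (setLIntegral_plane F.norm_normal hL hL' hsub _).le.trans ?_
        exact setLIntegral_le_lintegral _ _
    _ = ENNReal.ofReal D * (ENNReal.ofReal |k⁻¹| *
          ∫⁻ y : Eu 2, ∫⁻ t : ℝ, g (A y + t • (k⁻¹ • a))) := by
        simp_rw [hscale]
        rw [lintegral_const_mul' _ _ ENNReal.ofReal_ne_top,
          lintegral_const_mul' _ _ ENNReal.ofReal_ne_top]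
    _ = ENNReal.ofReal D * (ENNReal.ofReal |k⁻¹| * energyOne K ψ) := by
        have h1 := lintegral_prod (μ := (volume : Measure (Eu 2))) (ν := (volume : Measure ℝ))
          (fun p : Eu 2 × ℝ => g (A p.1 + p.2 • (k⁻¹ • a)))
          (hgm.comp hΦ.measurable).aemeasurable
        have h2 := hΦ.lintegral_comp hgm
        have h3 : ∫⁻ y, g y = energyOne K ψ := lintegral_indicator hK.isOpen.measurableSet _
        rw [← h1, ← h3, ← h2]
        rfl
    _ = _ := by rw [ENNReal.ofReal_mul hD0, mul_assoc]

/-- The trace inequality on a face. -/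
theorem Face.trace_bound (hK : IsPolyhedron K) (F : Face K) :
    ∃ C : ℝ≥0, ∀ ψ : R3 → ℝ, ContDiff ℝ ∞ ψ →
      ∫⁻ x, ‖ψ x‖ₑ ^ 2 ∂F.area ≤ C * energyOne K ψ := by
  have key : ∃ C : ℝ≥0, ∀ ψ : R3 → ℝ, ContDiff ℝ ∞ ψ →
      ∫⁻ x in F.carrier ∩ closure K, ‖ψ x‖ₑ ^ 2 ∂(μHE[2] : Measure R3) ≤ C * energyOne K ψ := by
    refine hK.isBounded.isCompact_closure.induction_on
      (p := fun s => ∃ C : ℝ≥0, ∀ ψ : R3 → ℝ, ContDiff ℝ ∞ ψ →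
        ∫⁻ x in F.carrier ∩ s, ‖ψ x‖ₑ ^ 2 ∂(μHE[2] : Measure R3) ≤ C * energyOne K ψ) ⟨0, by simp⟩ ?_ ?_ ?_
    · rintro s t hst ⟨C, hC⟩
      exact ⟨C, fun ψ hψ =>
        (lintegral_mono_set (Set.inter_subset_inter_right _ hst)).trans (hC ψ hψ)⟩
    · rintro s t ⟨C, hC⟩ ⟨C', hC'⟩
      refine ⟨C + C', fun ψ hψ => ?_⟩
      rw [ENNReal.coe_add, add_mul, Set.inter_union_distrib_left]
      exact (lintegral_union_le _ _ _).trans (add_le_add (hC ψ hψ) (hC' ψ hψ))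
    · intro x hx
      obtain ⟨r, hr, a, δ, hδ, h⟩ := exists_isConeAt hK.isOpen hK.lipschitz hx
      exact ⟨Metric.ball x r, mem_nhdsWithin_of_mem_nhds (Metric.ball_mem_nhds x hr),
        h.face_bound hK hδ F⟩
  rwa [Set.inter_eq_left.2 (F.carrier_subset_frontier.trans frontier_subset_closure)] at key

end FaceTrace

/-! ### Bounded boundary operators and their traces. -/

section Trace

variable {K : Set R3}

/-- The weak derivatives of order at most two of an `H²` function. -/
def weakJet (v : R3 → ℝ) (G : Fin 3 → R3 → ℝ) (H : Fin 3 → Fin 3 → R3 → ℝ) :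
    Option (Fin 3 × Option (Fin 3)) → R3 → ℝ
  | none => v
  | some (i, none) => G i
  | some (i, some j) => H i j

theorem tendstoH2_iff {φ : ℕ → R3 → ℝ} {v : R3 → ℝ} {G : Fin 3 → R3 → ℝ}
    {H : Fin 3 → Fin 3 → R3 → ℝ} : TendstoH2 K φ v G H ↔
      ∀ α, Tendsto (fun k => eLpNorm (fun x => jet α (φ k) x - weakJet v G H α x) 2
        (volume.restrict K)) atTop (𝓝 0) := by
  constructor
  · rintro ⟨h0, h1, h2⟩ (_ | ⟨i, _ | j⟩)
    exacts [h0, h1 i, h2 i j]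
  · intro h
    exact ⟨h none, fun i => h (some (i, none)), fun i j => h (some (i, some j))⟩

theorem IsH2.memLp_weakJet {v : R3 → ℝ} {G : Fin 3 → R3 → ℝ} {H : Fin 3 → Fin 3 → R3 → ℝ}
    (hv : IsH2 K v G H) : ∀ α, MemLp (weakJet v G H α) 2 (volume.restrict K)
  | none => hv.memLp
  | some (i, none) => hv.grad_memLp i
  | some (i, some j) => hv.hess_memLp i j

theorem jet_sub {φ ψ : R3 → ℝ} (hφ : ContDiff ℝ ∞ φ) (hψ : ContDiff ℝ ∞ ψ) :
    ∀ α, jet α (fun x => φ x - ψ x) = fun x => jet α φ x - jet α ψ x := by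
  have h1 : ∀ {φ ψ : R3 → ℝ}, ContDiff ℝ ∞ φ → ContDiff ℝ ∞ ψ → ∀ b : R3,
      (fun x => fderiv ℝ (fun x => φ x - ψ x) x b) =
        fun x => fderiv ℝ φ x b - fderiv ℝ ψ x b := by
    intro φ ψ hφ hψ b
    ext x
    rw [fderiv_fun_sub (hφ.differentiable (by simp) x) (hψ.differentiable (by simp) x)]
    rfl
  rintro (_ | ⟨i, _ | j⟩)
  · rfl
  · exact h1 hφ hψ _
  · simp only [jet]
    rw [h1 hφ hψ]
    exact h1 (contDiff_partial hφ _) (contDiff_partial hψ _) _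

theorem eLpNorm_two_sq {X : Type*} [MeasurableSpace X] (μ : Measure X) (f : X → ℝ) :
    eLpNorm f 2 μ ^ 2 = ∫⁻ x, ‖f x‖ₑ ^ 2 ∂μ := by
  have := eLpNorm_nnreal_pow_eq_lintegral (f := f) (μ := μ) (p := 2) (by norm_num)
  simpa using this

theorem energyTwo_eq {φ : R3 → ℝ} (hφ : ContDiff ℝ ∞ φ) :
    energyTwo K φ = ∑ α, eLpNorm (jet α φ) 2 (volume.restrict K) ^ 2 := by
  simp_rw [eLpNorm_two_sq, enorm_sq_eq]
  rw [← lintegral_finsetSum]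
  · refine lintegral_congr fun x => ?_
    rw [jetSq, ENNReal.ofReal_sum_of_nonneg fun α _ => sq_nonneg _]
  · intro α _
    have := (contDiff_jet hφ α).continuous
    fun_prop

theorem energyTwo_lt_top (hK : IsPolyhedron K) {φ : R3 → ℝ} (hφ : ContDiff ℝ ∞ φ) :
    energyTwo K φ < ⊤ := by
  have h : IntegrableOn (jetSq φ) (closure K) :=
    (continuous_jetSq hφ).continuousOn.integrableOn_compact hK.isBounded.isCompact_closure
  exact (h.mono_set subset_closure).lintegral_lt_top

/-- With equal sequences this is the Cauchy property that produces a trace; with different ones it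
shows that the trace does not depend on the sequence. -/
theorem tendsto_energyTwo_sub {φ ψ : ℕ → R3 → ℝ} {v : R3 → ℝ} {G : Fin 3 → R3 → ℝ}
    {H : Fin 3 → Fin 3 → R3 → ℝ} (hv : IsH2 K v G H) (hφ : ∀ k, ContDiff ℝ ∞ (φ k))
    (hψ : ∀ k, ContDiff ℝ ∞ (ψ k)) (hφv : TendstoH2 K φ v G H) (hψv : TendstoH2 K ψ v G H) :
    Tendsto (fun p : ℕ × ℕ => energyTwo K fun x => φ p.1 x - ψ p.2 x) atTop (𝓝 0) := by
  have hsub : ∀ p : ℕ × ℕ, ContDiff ℝ ∞ fun x => φ p.1 x - ψ p.2 x := fun p =>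
    (hφ p.1).sub (hψ p.2)
  simp_rw [energyTwo_eq (hsub _)]
  have h0 : (0 : ℝ≥0∞) = ∑ _α : Option (Fin 3 × Option (Fin 3)), (0 + 0) ^ 2 := by simp
  rw [h0]
  have hb : Tendsto (fun p : ℕ × ℕ => ∑ α,
      (eLpNorm (fun x => jet α (φ p.1) x - weakJet v G H α x) 2 (volume.restrict K) +
        eLpNorm (fun x => jet α (ψ p.2) x - weakJet v G H α x) 2 (volume.restrict K)) ^ 2)
      atTop (𝓝 (∑ _α : Option (Fin 3 × Option (Fin 3)), (0 + 0) ^ 2)) := by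
    refine tendsto_finsetSum _ fun α _ => ENNReal.Tendsto.pow (Tendsto.add ?_ ?_)
    · rw [← prod_atTop_atTop_eq]
      exact (tendstoH2_iff.1 hφv α).comp tendsto_fst
    · rw [← prod_atTop_atTop_eq]
      exact (tendstoH2_iff.1 hψv α).comp tendsto_snd
  refine tendsto_of_tendsto_of_tendsto_of_le_of_le (by rw [← h0]; exact tendsto_const_nhds) hb
    (fun _ => zero_le) fun p => ?_
  refine Finset.sum_le_sum fun α _ => ?_
  gcongr
  rw [jet_sub (hφ _) (hψ _)]
  have e : (fun x => jet α (φ p.1) x - jet α (ψ p.2) x) =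
      (fun x => jet α (φ p.1) x - weakJet v G H α x) -
        fun x => jet α (ψ p.2) x - weakJet v G H α x := by
    ext x; simp
  rw [e]
  exact eLpNorm_sub_le
    ((contDiff_jet (hφ _) α).continuous.aestronglyMeasurable.sub (hv.memLp_weakJet α).1)
    ((contDiff_jet (hψ _) α).continuous.aestronglyMeasurable.sub (hv.memLp_weakJet α).1) one_le_two

/-- A linear operator on smooth functions that is bounded from `H²(K)` to `L²(μ)`. -/
structure IsBoundedOp (K : Set R3) (μ : Measure R3) (B : (R3 → ℝ) → R3 → ℝ) : Prop where
  map_sub : ∀ {φ ψ : R3 → ℝ}, ContDiff ℝ ∞ φ → ContDiff ℝ ∞ ψ →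
    B (fun x => φ x - ψ x) = fun x => B φ x - B ψ x
  continuous : ∀ {φ : R3 → ℝ}, ContDiff ℝ ∞ φ → Continuous (B φ)
  bound : ∃ C : ℝ≥0, ∀ φ : R3 → ℝ, ContDiff ℝ ∞ φ →
    eLpNorm (B φ) 2 μ ^ 2 ≤ C * energyTwo K φ

variable {μ : Measure R3} {B : (R3 → ℝ) → R3 → ℝ} {v : R3 → ℝ} {G : Fin 3 → R3 → ℝ}
    {H : Fin 3 → Fin 3 → R3 → ℝ}

theorem IsBoundedOp.memLp (hB : IsBoundedOp K μ B) (hK : IsPolyhedron K) {φ : R3 → ℝ}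
    (hφ : ContDiff ℝ ∞ φ) : MemLp (B φ) 2 μ := by
  obtain ⟨C, hC⟩ := hB.bound
  refine ⟨(hB.continuous hφ).aestronglyMeasurable, ?_⟩
  have h1 : eLpNorm (B φ) 2 μ ^ 2 < ⊤ :=
    (hC φ hφ).trans_lt (ENNReal.mul_lt_top ENNReal.coe_lt_top (energyTwo_lt_top hK hφ))
  by_contra h
  simp [not_lt_top_iff.1 h] at h1

theorem IsBoundedOp.tendsto_sub (hB : IsBoundedOp K μ B) (hv : IsH2 K v G H)
    {φ ψ : ℕ → R3 → ℝ} (hφ : ∀ k, ContDiff ℝ ∞ (φ k)) (hψ : ∀ k, ContDiff ℝ ∞ (ψ k))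
    (hφv : TendstoH2 K φ v G H) (hψv : TendstoH2 K ψ v G H) :
    Tendsto (fun p : ℕ × ℕ => eLpNorm (fun x => B (φ p.1) x - B (ψ p.2) x) 2 μ) atTop (𝓝 0) := by
  obtain ⟨C, hC⟩ := hB.bound
  have h1 : Tendsto (fun p : ℕ × ℕ => C * energyTwo K fun x => φ p.1 x - ψ p.2 x) atTop
      (𝓝 (C * 0)) :=
    ENNReal.Tendsto.const_mul (tendsto_energyTwo_sub hv hφ hψ hφv hψv) (Or.inr ENNReal.coe_ne_top)
  rw [mul_zero] at h1
  have h2 : Tendsto (fun p : ℕ × ℕ => eLpNorm (fun x => B (φ p.1) x - B (ψ p.2) x) 2 μ ^ 2) atTop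
      (𝓝 0) := by
    refine tendsto_of_tendsto_of_tendsto_of_le_of_le tendsto_const_nhds h1 (fun _ => zero_le)
      fun p => ?_
    dsimp only
    rw [← hB.map_sub (hφ _) (hψ _)]
    exact hC _ ((hφ _).sub (hψ _))
  have h3 := (ENNReal.continuous_rpow_const (y := (1 / 2 : ℝ))).tendsto (0 : ℝ≥0∞) |>.comp h2
  rw [ENNReal.zero_rpow_of_pos (by norm_num)] at h3
  refine h3.congr fun p => ?_
  simp only [Function.comp]
  rw [← ENNReal.rpow_two, ← ENNReal.rpow_mul]
  norm_num

/-- A bounded operator maps an approximating sequence to a Cauchy sequence in `L²(μ)`, which is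
complete. -/
theorem IsBoundedOp.exists_isTrace (hB : IsBoundedOp K μ B) (hK : IsPolyhedron K)
    (hv : IsH2 K v G H) {φ : ℕ → R3 → ℝ} (hφ : ∀ k, ContDiff ℝ ∞ (φ k))
    (hφv : TendstoH2 K φ v G H) : ∃ g, IsTrace K v G H μ B g := by
  have hm := fun k => hB.memLp hK (hφ k)
  have hc : CauchySeq fun k => (hm k).toLp (B (φ k)) := by
    rw [Lp.cauchySeq_Lp_iff_cauchySeq_eLpNorm]
    refine (hB.tendsto_sub hv hφ hφ hφv hφv).congr fun p => ?_
    exact eLpNorm_congr_ae (((hm p.1).coeFn_toLp.sub (hm p.2).coeFn_toLp).symm)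
  obtain ⟨g, hg⟩ := cauchySeq_tendsto_of_complete hc
  have hg' := Lp.memLp g
  refine ⟨g, hg', φ, hφ, hφv, ?_⟩
  rw [← Lp.toLp_coeFn g hg'] at hg
  exact (Lp.tendsto_Lp_iff_tendsto_eLpNorm'' _ hm _ hg').1 hg

/-- The definition of a trace provides only some approximating sequence. Since the operator is
bounded, every other one has the same limit, so a single sequence can be used in all terms of
Green's identity. -/
theorem IsTrace.tendsto {g : R3 → ℝ} (hg : IsTrace K v G H μ B g) (hB : IsBoundedOp K μ B)
    (hv : IsH2 K v G H) {φ : ℕ → R3 → ℝ} (hφ : ∀ k, ContDiff ℝ ∞ (φ k))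
    (hφv : TendstoH2 K φ v G H) :
    Tendsto (fun k => eLpNorm (fun x => B (φ k) x - g x) 2 μ) atTop (𝓝 0) := by
  obtain ⟨hgm, ψ, hψ, hψv, hψg⟩ := hg
  have h1 := ((hB.tendsto_sub hv hφ hψ hφv hψv).comp tendsto_atTop_diagonal).add hψg
  rw [add_zero] at h1
  refine tendsto_of_tendsto_of_tendsto_of_le_of_le tendsto_const_nhds h1 (fun _ => zero_le)
    fun k => ?_
  have e : (fun x => B (φ k) x - g x) =
      (fun x => B (φ k) x - B (ψ k) x) + fun x => B (ψ k) x - g x := by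
    ext x; simp
  dsimp only
  rw [e]
  exact eLpNorm_add_le
    ((hB.continuous (hφ k)).aestronglyMeasurable.sub (hB.continuous (hψ k)).aestronglyMeasurable)
    ((hB.continuous (hψ k)).aestronglyMeasurable.sub hgm.1) one_le_two

/-- The pointwise Sobolev bound handles any finite measure on the closure, in particular length on
edges, where a trace of codimension two is required. -/
theorem isBoundedOp_valueOp (hK : IsPolyhedron K) [IsFiniteMeasure μ]
    (hμ : ∀ᵐ x ∂μ, x ∈ closure K) : IsBoundedOp K μ valueOp where
  map_sub _ _ := rfl
  continuous h := h.continuous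
  bound := by
    obtain ⟨C, hC⟩ := hK.sup_bound
    refine ⟨C * (μ Set.univ).toNNReal, fun φ hφ => ?_⟩
    rw [eLpNorm_two_sq, ENNReal.coe_mul, ENNReal.coe_toNNReal (measure_ne_top μ _), mul_right_comm,
      ← lintegral_const]
    refine lintegral_mono_ae ?_
    filter_upwards [hμ] with x hx using hC φ hφ x hx

theorem Face.isBoundedOp_valueOp (hK : IsPolyhedron K) (F : Face K) :
    IsBoundedOp K F.area valueOp := by
  have := F.isFiniteMeasure_area hK
  refine DivDivGreen.isBoundedOp_valueOp hK ?_
  refine ae_restrict_of_forall_mem (F.measurableSet_carrier hK) fun x hx => ?_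
  exact (F.carrier_subset_frontier hx).1

/-- The `H¹` trace inequality applies to each of the three first partial derivatives, which accounts
for the factor `3`. -/
theorem Face.isBoundedOp_normalDerivOp (hK : IsPolyhedron K) (F : Face K) :
    IsBoundedOp K F.area (normalDerivOp F.normal) where
  map_sub {φ ψ} hφ hψ := by
    ext x
    simp only [normalDerivOp]
    rw [fderiv_fun_sub (hφ.differentiable (by simp) x) (hψ.differentiable (by simp) x)]
    rfl
  continuous h := (contDiff_partial h _).continuous
  bound := by
    obtain ⟨C, hC⟩ := F.trace_bound hK
    refine ⟨3 * C, fun φ hφ => ?_⟩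
    have hd := fun i => contDiff_partial hφ (basisVec i)
    rw [eLpNorm_two_sq]
    calc ∫⁻ x, ‖normalDerivOp F.normal φ x‖ₑ ^ 2 ∂F.area
        ≤ ∫⁻ x, ∑ i, ‖fderiv ℝ φ x (basisVec i)‖ₑ ^ 2 ∂F.area := by
          refine lintegral_mono fun x => ?_
          simp_rw [enorm_sq_eq]
          rw [← ENNReal.ofReal_sum_of_nonneg fun i _ => sq_nonneg _]
          refine ENNReal.ofReal_le_ofReal ?_
          rw [normalDerivOp, fderiv_apply_eq_sum]
          refine (sq_sum_mul_le _ _).trans ?_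
          rw [F.norm_normal]
          simp
      _ = ∑ i, ∫⁻ x, ‖fderiv ℝ φ x (basisVec i)‖ₑ ^ 2 ∂F.area := by
          refine lintegral_finsetSum _ fun i _ => ?_
          have := (hd i).continuous
          fun_prop
      _ ≤ ∑ _i : Fin 3, C * energyTwo K φ := by
          refine Finset.sum_le_sum fun i _ => (hC _ (hd i)).trans ?_
          gcongr
          exact energyOne_partial_le K φ i
      _ = _ := by simp [mul_assoc]

theorem Edge.isBoundedOp_valueOp (hK : IsPolyhedron K) {F : Face K} (e : Edge F) :
    IsBoundedOp K e.length valueOp := by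
  have := e.isFiniteMeasure_length hK
  refine DivDivGreen.isBoundedOp_valueOp hK ?_
  exact ae_restrict_of_forall_mem (e.carrier_properties hK).2.1 fun x hx =>
    e.carrier_subset_closure hK hx

end Trace

/-! ### Mollification by shifted kernels. -/

section Mollification

/-- Convolution with the kernel `κ`. -/
noncomputable def moll (κ u : R3 → ℝ) : R3 → ℝ := fun x => ∫ y, u y * κ (x - y)

theorem moll_eq_convolution (κ u : R3 → ℝ) :
    moll κ u = convolution u κ (ContinuousLinearMap.mul ℝ ℝ) volume := rfl

theorem contDiff_moll {κ u : R3 → ℝ} (hκ : ContDiff ℝ ∞ κ) (hκc : HasCompactSupport κ)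
    (hu : LocallyIntegrable u volume) : ContDiff ℝ ∞ (moll κ u) := by
  rw [moll_eq_convolution]
  exact hκc.contDiff_convolution_right (n := ⊤) (ContinuousLinearMap.mul ℝ ℝ) hu hκ

theorem fderiv_moll {κ u : R3 → ℝ} (hκ : ContDiff ℝ ∞ κ) (hκc : HasCompactSupport κ)
    (hu : LocallyIntegrable u volume) (x b : R3) :
    fderiv ℝ (moll κ u) x b = moll (fun z => fderiv ℝ κ z b) u x := by
  have h := hκc.hasFDerivAt_convolution_right (ContinuousLinearMap.mul ℝ ℝ) hu
    (hκ.of_le (by simp)) x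
  rw [moll_eq_convolution, h.fderiv, convolution_precompR_apply _ hu (hκc.fderiv ℝ)
    (hκ.continuous_fderiv (by simp))]
  rfl

/-- The function `y ↦ κ (x - y)` is an admissible test function, and the sign from differentiating
in `y` cancels the one in the definition of the weak derivative. The extension by zero is harmless
because the kernel only sees `K`. -/
theorem IsWeakPartial.moll_eq {K : Set R3} (hK : MeasurableSet K) {i : Fin 3} {u g : R3 → ℝ}
    (h : IsWeakPartial K i u g) {κ : R3 → ℝ} (hκ : ContDiff ℝ ∞ κ) (hκc : HasCompactSupport κ)
    {x : R3} (hx : tsupport (fun y => κ (x - y)) ⊆ K) :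
    moll (fun z => fderiv ℝ κ z (basisVec i)) (K.indicator u) x = moll κ (K.indicator g) x := by
  have hφ : ContDiff ℝ ∞ fun y => κ (x - y) := hκ.comp (contDiff_const.sub contDiff_id)
  have h1 := h (fun y => κ (x - y)) hφ (hκc.comp_homeomorph (Homeomorph.subLeft x)) hx
  have h2 : ∀ y, fderiv ℝ (fun y => κ (x - y)) y (basisVec i) =
      -fderiv ℝ κ (x - y) (basisVec i) := fun y => by
    have h3 := (hκ.differentiable (by simp) (x - y)).hasFDerivAt.comp y
      ((hasFDerivAt_id y).const_sub x)
    have h4 : HasFDerivAt (fun y => κ (x - y)) _ y := h3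
    rw [h4.fderiv]
    simp
  simp only [h2, mul_neg, integral_neg, neg_inj] at h1
  unfold moll
  rw [← integral_indicator hK, ← integral_indicator hK] at h1
  simpa only [Set.indicator_mul_left] using h1

theorem tendsto_eLpNorm_translate {u : R3 → ℝ} (hu : MemLp u 2 volume) :
    Tendsto (fun z : R3 => eLpNorm (fun x => u (x - z) - u x) 2 volume) (𝓝 0) (𝓝 0) := by
  let g : C(R3, C(R3, R3)) := (ContinuousMap.mk (fun a : R3 × R3 => a.2 - a.1)
    (by fun_prop)).curry
  have hg : ∀ z, MeasurePreserving (g z) (volume : Measure R3) volume := fun z =>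
    measurePreserving_sub_right volume z
  have h1 : Continuous fun z => Lp.compMeasurePreserving (g z) (hg z) (hu.toLp u) :=
    continuous_const.compMeasurePreservingLp g.continuous hg (by simp)
  have h2 : ∀ z, Lp.compMeasurePreserving (g z) (hg z) (hu.toLp u) =
      (hu.comp_measurePreserving (hg z)).toLp _ := fun z =>
    Lp.toLp_compMeasurePreserving hu (hg z)
  simp only [h2] at h1
  have h3 := h1.tendsto 0
  have h4 : (hu.comp_measurePreserving (hg 0)).toLp (u ∘ g 0) = hu.toLp u := by
    congr 1
    ext x
    simp [g]
  rw [h4, Lp.tendsto_Lp_iff_tendsto_eLpNorm''] at h3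
  exact h3

theorem moll_congr_ae {κ u u' : R3 → ℝ} (h : u =ᵐ[volume] u') : moll κ u = moll κ u' := by
  ext x
  refine integral_congr_ae ?_
  filter_upwards [h] with y hy
  rw [hy]

/-- `moll κ u - u` is the mean of the differences `u (· - z) - u` under the probability measure `κ
dz`; Jensen and Fubini bound its squared norm by a mean of squared norms. Measurability of `u`
itself gives the joint measurability for Fubini. -/
theorem eLpNorm_moll_sub_le_of_measurable {κ u : R3 → ℝ} (hu : MemLp u 2 volume)
    (hum : Measurable u) (hκ : Continuous κ) (hκc : HasCompactSupport κ) (hκ0 : ∀ z, 0 ≤ κ z)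
    (hκ1 : ∫ z, κ z = 1) {η : ℝ≥0∞}
    (hη : ∀ z ∈ Function.support κ, eLpNorm (fun x => u (x - z) - u x) 2 volume ^ 2 ≤ η) :
    eLpNorm (fun x => moll κ u x - u x) 2 volume ^ 2 ≤ η := by
  have hul : LocallyIntegrable u volume := hu.locallyIntegrable one_le_two
  have hκi : Integrable κ := hκ.integrable_of_hasCompactSupport hκc
  set ν : Measure R3 := volume.withDensity fun z => ENNReal.ofReal (κ z) with hν
  have hν1 : ν Set.univ = 1 := by
    rw [hν, withDensity_apply _ MeasurableSet.univ, Measure.restrict_univ,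
      ← ofReal_integral_eq_lintegral_ofReal hκi (ae_of_all _ hκ0), hκ1, ENNReal.ofReal_one]
  have hκm : Measurable fun z => ENNReal.ofReal (κ z) := by fun_prop
  have hpt : ∀ x, ‖moll κ u x - u x‖ₑ ^ 2 ≤ ∫⁻ z, ‖u (x - z) - u x‖ₑ ^ 2 ∂ν := by
    intro x
    have h0 : ConvolutionExistsAt u κ x (ContinuousLinearMap.mul ℝ ℝ) volume :=
      hκc.convolutionExists_right _ hul hκ x
    have h1 : moll κ u x = ∫ z, u (x - z) * κ z := by
      rw [moll_eq_convolution, convolution_eq_swap]; rfl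
    have h2 : Integrable fun z => u (x - z) * κ z := h0.integrable_swap
    have h3 : moll κ u x - u x = ∫ z, (u (x - z) - u x) * κ z := by
      simp_rw [sub_mul]
      rw [integral_sub h2 (hκi.const_mul _), integral_const_mul, hκ1, mul_one, h1]
    have hm : Measurable fun z => ‖u (x - z) - u x‖ₑ := by fun_prop
    refine le_trans ?_ (sq_lintegral_le hν1.le hm.aemeasurable)
    gcongr
    rw [h3, hν, lintegral_withDensity_eq_lintegral_mul _ hκm hm]
    refine (enorm_integral_le_lintegral_enorm _).trans (lintegral_mono fun z => ?_)
    rw [enorm_mul, mul_comm, Real.enorm_eq_ofReal (hκ0 z)]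
    rfl
  have hmeas : Measurable fun p : R3 × R3 => ‖u (p.1 - p.2) - u p.1‖ₑ ^ 2 := by fun_prop
  have : IsFiniteMeasure ν := ⟨by rw [hν1]; exact ENNReal.one_lt_top⟩
  calc eLpNorm (fun x => moll κ u x - u x) 2 volume ^ 2
      = ∫⁻ x, ‖moll κ u x - u x‖ₑ ^ 2 := eLpNorm_two_sq _ _
    _ ≤ ∫⁻ x, ∫⁻ z, ‖u (x - z) - u x‖ₑ ^ 2 ∂ν := lintegral_mono hpt
    _ = ∫⁻ z, (∫⁻ x, ‖u (x - z) - u x‖ₑ ^ 2) ∂ν :=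
        lintegral_lintegral_swap hmeas.aemeasurable
    _ = ∫⁻ z, eLpNorm (fun x => u (x - z) - u x) 2 volume ^ 2 ∂ν := by
        simp_rw [eLpNorm_two_sq]
    _ ≤ ∫⁻ _z, η ∂ν := by
        refine lintegral_mono_ae ?_
        rw [hν, ae_withDensity_iff hκm]
        refine ae_of_all _ fun z hz => hη z ?_
        intro h0
        simp [h0] at hz
    _ = η := by simp [hν1]

theorem eLpNorm_moll_sub_le {κ u : R3 → ℝ} (hu : MemLp u 2 volume)
    (hκ : Continuous κ) (hκc : HasCompactSupport κ) (hκ0 : ∀ z, 0 ≤ κ z)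
    (hκ1 : ∫ z, κ z = 1) {η : ℝ≥0∞}
    (hη : ∀ z ∈ Function.support κ, eLpNorm (fun x => u (x - z) - u x) 2 volume ^ 2 ≤ η) :
    eLpNorm (fun x => moll κ u x - u x) 2 volume ^ 2 ≤ η := by
  obtain ⟨u', hu'm, huu'⟩ := hu.1
  have h1 : eLpNorm (fun x => moll κ u x - u x) 2 volume =
      eLpNorm (fun x => moll κ u' x - u' x) 2 volume := by
    rw [moll_congr_ae huu']
    refine eLpNorm_congr_ae ?_
    filter_upwards [huu'] with x hx
    rw [hx]
  rw [h1]
  refine eLpNorm_moll_sub_le_of_measurable (hu.ae_eq huu') hu'm.measurable hκ hκc hκ0 hκ1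
    fun z hz => ?_
  refine le_trans (le_of_eq ?_) (hη z hz)
  congr 1
  refine eLpNorm_congr_ae ?_
  filter_upwards [huu', (measurePreserving_sub_right volume z).quasiMeasurePreserving.ae_eq_comp
    huu'] with x hx hx'
  simp only [Function.comp] at hx'
  rw [hx, hx']

theorem exists_kernel (c : R3) {s : ℝ} (hs : 0 < s) : ∃ κ : R3 → ℝ, ContDiff ℝ ∞ κ ∧
    HasCompactSupport κ ∧ (∀ z, 0 ≤ κ z) ∧ ∫ z, κ z = 1 ∧ Function.support κ ⊆ Metric.ball c s := by
  let f : ContDiffBump c := ⟨s / 2, s, by positivity, by linarith⟩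
  exact ⟨f.normed volume, f.contDiff_normed, f.hasCompactSupport_normed, f.nonneg_normed,
    f.integral_normed, f.support_normed_eq.subset⟩

theorem norm_le_of_mem_tsupport {κ : R3 → ℝ} {c : R3} {s : ℝ}
    (h : Function.support κ ⊆ Metric.ball c s) {x y : R3} (hy : y ∈ tsupport fun y => κ (x - y)) :
    ‖x - y - c‖ ≤ s := by
  have hcl : IsClosed {y : R3 | ‖x - y - c‖ ≤ s} := isClosed_le (by fun_prop) continuous_const
  refine closure_minimal (fun z hz => ?_) hcl hy
  have h1 := h (show x - z ∈ Function.support κ from hz)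
  rw [Metric.mem_ball, dist_eq_norm] at h1
  exact h1.le

/-- Here `y = x + ε b` with `b` within `δ / 2` of the axis. The margin to `δ` absorbs the closedness
of the topological support of the kernel. -/
theorem IsConeAt.mem_of_norm_le {K : Set R3} {x₀ a : R3} {r δ : ℝ} (h : IsConeAt K x₀ r a δ)
    (hδ : 0 < δ) {ε : ℝ} (hε : ε ∈ Set.Ioc (0 : ℝ) 1) {x y : R3}
    (hx : x ∈ closure K ∩ Metric.ball x₀ r) (hxy : ‖x - y - -(ε • a)‖ ≤ ε * δ / 2) : y ∈ K := by
  have hε0 := hε.1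
  have h3 : y = x + ε • (ε⁻¹ • (y - x)) := by
    rw [smul_smul, mul_inv_cancel₀ hε0.ne', one_smul]; abel
  rw [h3]
  refine h x hx ε hε _ ?_
  rw [Metric.mem_ball, dist_eq_norm]
  have h4 : ε⁻¹ • (y - x) - a = -(ε⁻¹ • (x - y - -(ε • a))) := by
    rw [smul_sub ε⁻¹ (x - y), smul_neg, smul_smul, inv_mul_cancel₀ hε0.ne', one_smul,
      ← neg_sub x y, smul_neg]
    abel
  rw [h4, norm_neg, norm_smul, norm_inv, Real.norm_of_nonneg hε0.le]
  calc ε⁻¹ * ‖x - y - -(ε • a)‖ ≤ ε⁻¹ * (ε * δ / 2) := by gcongr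
    _ = δ / 2 := by field_simp
    _ < δ := by linarith

/-- Mollification in the directions of a cone of translations into `K`. -/
theorem IsConeAt.exists_kernels {K : Set R3} {x₀ a : R3} {r δ : ℝ} (h : IsConeAt K x₀ r a δ)
    (hδ : 0 < δ) : ∃ κ : ℕ → R3 → ℝ, (∀ k, ContDiff ℝ ∞ (κ k)) ∧ (∀ k, HasCompactSupport (κ k)) ∧
      (∀ k, ∀ x ∈ closure K ∩ Metric.ball x₀ r, tsupport (fun y => κ k (x - y)) ⊆ K) ∧
      ∀ u, MemLp u 2 volume →
        Tendsto (fun k => eLpNorm (fun x => moll (κ k) u x - u x) 2 volume) atTop (𝓝 0) := by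
  set ε : ℕ → ℝ := fun k => 1 / ((k : ℝ) + 1) with hε
  have hε0 : ∀ k, 0 < ε k := fun k => Nat.one_div_pos_of_nat
  have hε1 : ∀ k, ε k ≤ 1 := fun k => by
    simp only [hε]
    rw [div_le_one (by positivity)]
    linarith [Nat.cast_nonneg (α := ℝ) k]
  have hεt : Tendsto ε atTop (𝓝 0) := tendsto_one_div_add_atTop_nhds_zero_nat
  -- The kernel is centred at `-ε a`, so that mollification at `x` averages values near `x + ε a`,
  -- which stay in `K` even for `x` on the boundary.
  choose κ hκ hκc hκ0 hκ1 hsupp using fun k => exists_kernel (-(ε k • a))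
    (s := ε k * δ / 2) (by have := hε0 k; positivity)
  refine ⟨κ, hκ, hκc, fun k x hx => ?_, fun u hu => ?_⟩
  · intro y hy
    exact h.mem_of_norm_le hδ ⟨hε0 k, hε1 k⟩ hx (norm_le_of_mem_tsupport (hsupp k) hy)
  · rw [ENNReal.tendsto_nhds_zero]
    intro η hη
    have h1 := (ENNReal.tendsto_nhds_zero.1 (tendsto_eLpNorm_translate hu)) η hη
    obtain ⟨s, hs, hs'⟩ := Metric.eventually_nhds_iff_ball.1 h1
    have h2 : Tendsto (fun k => ε k * (‖a‖ + δ)) atTop (𝓝 0) := by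
      simpa using hεt.mul_const (‖a‖ + δ)
    filter_upwards [h2.eventually (gt_mem_nhds hs)] with k hk
    have h3 := eLpNorm_moll_sub_le hu (hκ k).continuous (hκc k) (hκ0 k) (hκ1 k) (η := η ^ 2)
      fun z hz => by
        gcongr
        refine hs' z ?_
        have hz' := hsupp k hz
        rw [Metric.mem_ball, dist_eq_norm] at hz'
        rw [mem_ball_zero_iff]
        have h4 : ‖z‖ ≤ ‖z - -(ε k • a)‖ + ‖-(ε k • a)‖ := by
          simpa using norm_add_le (z - -(ε k • a)) (-(ε k • a))
        rw [norm_neg (ε k • a), norm_smul, Real.norm_of_nonneg (hε0 k).le] at h4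
        have := mul_pos (hε0 k) hδ
        linarith
    exact (ENNReal.pow_le_pow_left_iff two_ne_zero).1 h3

end Mollification

/-! ### The product rule up to order two. -/

section Leibniz

/-- The derivatives of order at most two of the product of `f` with a function whose derivatives
are `w`. -/
noncomputable def leibniz (f : R3 → ℝ) (w : Option (Fin 3 × Option (Fin 3)) → R3 → ℝ) :
    Option (Fin 3 × Option (Fin 3)) → R3 → ℝ
  | none => fun x => f x * w none x
  | some (i, none) => fun x => jet (some (i, none)) f x * w none x + f x * w (some (i, none)) x
  | some (i, some j) => fun x => jet (some (i, some j)) f x * w none x +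
      jet (some (i, none)) f x * w (some (j, none)) x +
      (jet (some (j, none)) f x * w (some (i, none)) x + f x * w (some (i, some j)) x)

theorem jet_mul {f φ : R3 → ℝ} (hf : ContDiff ℝ ∞ f) (hφ : ContDiff ℝ ∞ φ) :
    ∀ α, jet α (fun x => f x * φ x) = leibniz f (fun β => jet β φ) α := by
  have h1 : ∀ {f φ : R3 → ℝ}, ContDiff ℝ ∞ f → ContDiff ℝ ∞ φ → ∀ b : R3,
      (fun x => fderiv ℝ (fun x => f x * φ x) x b) =
        fun x => fderiv ℝ f x b * φ x + f x * fderiv ℝ φ x b := by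
    intro f φ hf hφ b
    ext x
    rw [fderiv_fun_mul (hf.differentiable (by simp) x) (hφ.differentiable (by simp) x)]
    simp
    ring
  rintro (_ | ⟨i, _ | j⟩)
  · rfl
  · exact h1 hf hφ _
  · have hf' := contDiff_partial hf (basisVec i)
    have hφ' := contDiff_partial hφ (basisVec i)
    ext x
    simp only [jet, leibniz]
    rw [h1 hf hφ, fderiv_fun_add ((hf'.mul hφ).differentiable (by simp) x)
      ((hf.mul hφ').differentiable (by simp) x), add_apply]
    exact congrArg₂ (· + ·) (congrFun (h1 hf' hφ _) x) (congrFun (h1 hf hφ' _) x)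

theorem jet_sum {ι : Type*} (t : Finset ι) {f : ι → R3 → ℝ} (hf : ∀ i, ContDiff ℝ ∞ (f i)) :
    ∀ α, jet α (fun x => ∑ i ∈ t, f i x) = fun x => ∑ i ∈ t, jet α (f i) x := by
  have h1 : ∀ {f : ι → R3 → ℝ}, (∀ i, ContDiff ℝ ∞ (f i)) → ∀ b : R3,
      (fun x => fderiv ℝ (fun x => ∑ i ∈ t, f i x) x b) = fun x => ∑ i ∈ t, fderiv ℝ (f i) x b := by
    intro f hf b
    ext x
    rw [fderiv_fun_sum fun i _ => (hf i).differentiable (by simp) x]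
    simp
  rintro (_ | ⟨i, _ | j⟩)
  · rfl
  · exact h1 hf _
  · simp only [jet]
    rw [h1 hf]
    exact h1 (fun k => contDiff_partial (hf k) _) _

theorem jet_congr {f g : R3 → ℝ} {x : R3} (h : f =ᶠ[𝓝 x] g) : ∀ α, jet α f x = jet α g x
  | none => h.eq_of_nhds
  | some (i, none) => by simp only [jet]; rw [h.fderiv_eq]
  | some (i, some j) => by
    simp only [jet]
    have h2 : (fun y => fderiv ℝ f y (basisVec i)) =ᶠ[𝓝 x] fun y => fderiv ℝ g y (basisVec i) := by
      filter_upwards [h.fderiv (𝕜 := ℝ)] with y hy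
      rw [hy]
    rw [h2.fderiv_eq]

theorem jet_eq_zero_of_notMem_tsupport {f : R3 → ℝ} {x : R3} (hx : x ∉ tsupport f) (α) :
    jet α f x = 0 := by
  rw [jet_congr (notMem_tsupport_iff_eventuallyEq.1 hx)]
  rcases α with _ | ⟨i, _ | j⟩ <;> simp [jet]

theorem leibniz_eq_of_notMem_tsupport {f : R3 → ℝ} {x : R3} (hx : x ∉ tsupport f)
    (w : Option (Fin 3 × Option (Fin 3)) → R3 → ℝ) (α) : leibniz f w α x = 0 := by
  have h := jet_eq_zero_of_notMem_tsupport hx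
  have h0 : f x = 0 := h none
  rcases α with _ | ⟨i, _ | j⟩ <;> simp [leibniz, h, h0]

theorem leibniz_congr (f : R3 → ℝ) {x : R3} {w w' : Option (Fin 3 × Option (Fin 3)) → R3 → ℝ}
    (h : ∀ β, w β x = w' β x) (α) : leibniz f w α x = leibniz f w' α x := by
  rcases α with _ | ⟨i, _ | j⟩ <;> simp [leibniz, h]

theorem leibniz_sub (f : R3 → ℝ) (x : R3) (w w' : Option (Fin 3 × Option (Fin 3)) → R3 → ℝ) (α) :
    leibniz f (fun β y => w β y - w' β y) α x = leibniz f w α x - leibniz f w' α x := by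
  rcases α with _ | ⟨i, _ | j⟩ <;> simp only [leibniz] <;> ring

/-- The derivatives of a partition of unity sum to those of the constant `1`, so only the term with
no derivative on `f i` survives. As `w` is arbitrary, no product rule for weak derivatives is
required. -/
theorem sum_leibniz {ι : Type*} {t : Finset ι} {f : ι → R3 → ℝ} (hf : ∀ i, ContDiff ℝ ∞ (f i))
    {x : R3} (h : ∀ᶠ y in 𝓝 x, ∑ i ∈ t, f i y = 1)
    (w : Option (Fin 3 × Option (Fin 3)) → R3 → ℝ) (α) :
    ∑ i ∈ t, leibniz (f i) w α x = w α x := by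
  have h1 : ∀ β, ∑ i ∈ t, jet β (f i) x = jet β (fun _ => 1) x := fun β => by
    rw [← jet_congr (f := fun y => ∑ i ∈ t, f i y) h β, jet_sum t hf]
  have h0 : ∑ i ∈ t, f i x = 1 := h.self_of_nhds
  rcases α with _ | ⟨i, _ | j⟩
  · simp [leibniz, ← Finset.sum_mul, h0]
  · simp only [leibniz, Finset.sum_add_distrib, ← Finset.sum_mul, h1, h0]
    simp [jet]
  · simp only [leibniz, Finset.sum_add_distrib, ← Finset.sum_mul, h1, h0]
    simp [jet]

end Leibniz

/-! ### Error sequences tending to zero in `L²(K)`. -/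

section Null

variable {K : Set R3}

/-- Sequences that tend to zero in `L²(K)`. -/
def IsNull (K : Set R3) (e : ℕ → R3 → ℝ) : Prop :=
  (∀ k, AEStronglyMeasurable (e k) (volume.restrict K)) ∧
    Tendsto (fun k => eLpNorm (e k) 2 (volume.restrict K)) atTop (𝓝 0)

theorem IsNull.add {e e' : ℕ → R3 → ℝ} (h : IsNull K e) (h' : IsNull K e') :
    IsNull K fun k x => e k x + e' k x := by
  refine ⟨fun k => (h.1 k).add (h'.1 k), ?_⟩
  have h1 := h.2.add h'.2
  rw [add_zero] at h1
  exact tendsto_of_tendsto_of_tendsto_of_le_of_le tendsto_const_nhds h1 (fun _ => zero_le)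
    fun k => eLpNorm_add_le (h.1 k) (h'.1 k) one_le_two

theorem IsNull.sum {ι : Type*} (t : Finset ι) {e : ι → ℕ → R3 → ℝ}
    (h : ∀ i ∈ t, IsNull K (e i)) : IsNull K fun k x => ∑ i ∈ t, e i k x := by
  classical
  induction t using Finset.induction_on with
  | empty =>
    simp only [Finset.sum_empty]
    refine ⟨fun k => aestronglyMeasurable_const, ?_⟩
    have : (fun _ : R3 => (0 : ℝ)) = 0 := rfl
    simp [this]
  | insert a s ha ih =>
    simp only [Finset.sum_insert ha]
    exact (h a (Finset.mem_insert_self a s)).add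
      (ih fun i hi => h i (Finset.mem_insert_of_mem hi))

theorem IsNull.continuous_mul (hK : IsPolyhedron K) {e : ℕ → R3 → ℝ} (h : IsNull K e)
    {f : R3 → ℝ} (hf : Continuous f) : IsNull K fun k x => f x * e k x := by
  refine ⟨fun k => hf.aestronglyMeasurable.mul (h.1 k), ?_⟩
  obtain ⟨C, hC⟩ := hK.isBounded.isCompact_closure.exists_bound_of_continuousOn hf.continuousOn
  have h1 : Tendsto (fun k => ENNReal.ofReal C * eLpNorm (e k) 2 (volume.restrict K)) atTop
      (𝓝 (ENNReal.ofReal C * 0)) :=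
    ENNReal.Tendsto.const_mul h.2 (Or.inr ENNReal.ofReal_ne_top)
  rw [mul_zero] at h1
  refine tendsto_of_tendsto_of_tendsto_of_le_of_le tendsto_const_nhds h1 (fun _ => zero_le)
    fun k => ?_
  refine eLpNorm_le_mul_eLpNorm_of_ae_le_mul ?_ 2
  refine ae_restrict_of_forall_mem hK.isOpen.measurableSet fun x hx => ?_
  rw [norm_mul]
  gcongr
  exact hC x (subset_closure hx)

theorem IsNull.leibniz (hK : IsPolyhedron K) {f : R3 → ℝ} (hf : ContDiff ℝ ∞ f)
    {e : Option (Fin 3 × Option (Fin 3)) → ℕ → R3 → ℝ} (h : ∀ β, IsNull K (e β)) (α) :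
    IsNull K fun k x => leibniz f (fun β => e β k) α x := by
  have hj := fun β => (contDiff_jet hf β).continuous
  have hm := fun β γ => (h γ).continuous_mul hK (hj β)
  rcases α with _ | ⟨i, _ | j⟩
  · exact hm none none
  · exact (hm _ _).add (hm none _)
  · exact ((hm _ _).add (hm _ _)).add ((hm _ _).add (hm none _))

end Null

/-! ### Density of smooth functions in `H²(K)`. -/

section Density

variable {K : Set R3} {v : R3 → ℝ} {G : Fin 3 → R3 → ℝ} {H : Fin 3 → Fin 3 → R3 → ℝ}

theorem IsH2.memLp_indicator (hK : IsPolyhedron K) (hv : IsH2 K v G H) (α) :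
    MemLp (K.indicator (weakJet v G H α)) 2 volume :=
  (memLp_indicator_iff_restrict hK.isOpen.measurableSet).2 (hv.memLp_weakJet α)

/-- The derivatives fall on the kernel and pass from there to `v`. The second order differentiates
the first-order identity, which is why it is needed on an open set. -/
theorem IsH2.jet_moll (hK : IsPolyhedron K) (hv : IsH2 K v G H) {κ : R3 → ℝ}
    (hκ : ContDiff ℝ ∞ κ) (hκc : HasCompactSupport κ) {U : Set R3} (hU : IsOpen U)
    (hUK : ∀ x ∈ U, tsupport (fun y => κ (x - y)) ⊆ K) {x : R3} (hx : x ∈ U) :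
    ∀ α, jet α (moll κ (K.indicator v)) x = moll κ (K.indicator (weakJet v G H α)) x := by
  have hl : ∀ α, LocallyIntegrable (K.indicator (weakJet v G H α)) volume := fun α =>
    (hv.memLp_indicator hK α).locallyIntegrable one_le_two
  have hm := hK.isOpen.measurableSet
  have h1 : ∀ y ∈ U, ∀ i, fderiv ℝ (moll κ (K.indicator v)) y (basisVec i) =
      moll κ (K.indicator (G i)) y := fun y hy i => by
    rw [fderiv_moll (u := K.indicator v) hκ hκc (hl none)]
    exact (hv.grad_weak i).moll_eq hm hκ hκc (hUK y hy)
  rintro (_ | ⟨i, _ | j⟩)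
  · rfl
  · exact h1 x hx i
  · simp only [jet, weakJet]
    have h2 : (fun y => fderiv ℝ (moll κ (K.indicator v)) y (basisVec i)) =ᶠ[𝓝 x]
        moll κ (K.indicator (G i)) := by
      filter_upwards [hU.mem_nhds hx] with y hy using h1 y hy i
    rw [h2.fderiv_eq,
      fderiv_moll (u := K.indicator (G i)) hκ hκc (hl (some (i, none)))]
    exact (hv.hess_weak i j).moll_eq hm hκ hκc (hUK x hx)

/-- Functions that are smooth up to the boundary are dense in `H²(K)`. -/
theorem IsH2.exists_tendstoH2 (hK : IsPolyhedron K) (hv : IsH2 K v G H) :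
    ∃ φ : ℕ → R3 → ℝ, (∀ k, ContDiff ℝ ∞ (φ k)) ∧ TendstoH2 K φ v G H := by
  have hex : ∀ x₀ : R3, ∃ r > 0, x₀ ∈ closure K → ∃ a, ∃ δ > 0, IsConeAt K x₀ r a δ := fun x₀ => by
    by_cases hx₀ : x₀ ∈ closure K
    · obtain ⟨r, hr, h⟩ := exists_isConeAt hK.isOpen hK.lipschitz hx₀
      exact ⟨r, hr, fun _ => h⟩
    · exact ⟨1, one_pos, fun h => absurd h hx₀⟩
  choose r hr hcone using hex
  obtain ⟨t, f, htK, hf, hft, hf1⟩ := exists_finite_partition hK.isBounded.isCompact_closure r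
    fun x _ => hr x
  have hker : ∀ x₀ : R3, ∃ κ : ℕ → R3 → ℝ, (∀ k, ContDiff ℝ ∞ (κ k)) ∧
      (∀ k, HasCompactSupport (κ k)) ∧ (x₀ ∈ closure K →
      (∀ k, ∀ x ∈ closure K ∩ Metric.ball x₀ (r x₀), tsupport (fun y => κ k (x - y)) ⊆ K) ∧
      ∀ u, MemLp u 2 volume →
        Tendsto (fun k => eLpNorm (fun x => moll (κ k) u x - u x) 2 volume) atTop (𝓝 0)) := by
    intro x₀
    by_cases hx₀ : x₀ ∈ closure K
    · obtain ⟨a, δ, hδ, h⟩ := hcone x₀ hx₀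
      obtain ⟨κ, h1, h2, h3, h4⟩ := h.exists_kernels hδ
      exact ⟨κ, h1, h2, fun _ => ⟨h3, h4⟩⟩
    · exact ⟨fun _ _ => 0, fun _ => contDiff_const, fun _ => HasCompactSupport.zero,
        fun h => absurd h hx₀⟩
  choose κ hκ hκc hκK using hker
  set w := weakJet v G H
  have hl : ∀ α, LocallyIntegrable (K.indicator (w α)) volume := fun α =>
    (hv.memLp_indicator hK α).locallyIntegrable one_le_two
  -- Every weak derivative is mollified separately; near the support of `f x` and inside `K` these
  -- are the derivatives of the mollified `v`.
  set m : R3 → ℕ → Option (Fin 3 × Option (Fin 3)) → R3 → ℝ := fun x k α =>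
    moll (κ x k) (K.indicator (w α)) with hm
  have hms : ∀ x k α, ContDiff ℝ ∞ (m x k α) := fun x k α =>
    contDiff_moll (hκ x k) (hκc x k) (hl α)
  have hφt : ∀ k x, ContDiff ℝ ∞ fun y => f x y * m x k none y := fun k x =>
    (hf x).mul (hms x k none)
  refine ⟨fun k y => ∑ x ∈ t, f x y * m x k none y, fun k => ContDiff.sum fun x _ => hφt k x,
    tendstoH2_iff.2 fun α => ?_⟩
  have hnull : ∀ x ∈ t, ∀ β, IsNull K fun k y => m x k β y - w β y := fun x hx β => by
    refine ⟨fun k => (hms x k β).continuous.aestronglyMeasurable.sub (hv.memLp_weakJet β).1, ?_⟩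
    refine tendsto_of_tendsto_of_tendsto_of_le_of_le tendsto_const_nhds
      ((hκK x (htK x hx)).2 _ (hv.memLp_indicator hK β)) (fun _ => zero_le) fun k => ?_
    refine le_trans (le_of_eq ?_) (eLpNorm_mono_measure _
      (Measure.restrict_le_self (s := K)))
    refine eLpNorm_congr_ae (ae_restrict_of_forall_mem hK.isOpen.measurableSet fun y hy => ?_)
    simp only [hm, Set.indicator_of_mem hy]
    rfl
  -- By linearity of the product rule in its second argument, the total error is the sum of the
  -- products of the cutoffs with the local mollification errors.
  have hsum := IsNull.sum t fun x hx => IsNull.leibniz hK (hf x) (hnull x hx) α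
  refine hsum.2.congr fun k => ?_
  refine eLpNorm_congr_ae (ae_restrict_of_forall_mem hK.isOpen.measurableSet fun y hy => ?_)
  dsimp only
  have h1 : ∀ᶠ z in 𝓝 y, ∑ x ∈ t, f x z = 1 := by
    filter_upwards [hK.isOpen.mem_nhds hy] with z hz using hf1 z (subset_closure hz)
  rw [jet_sum t (hφt k)]
  simp_rw [leibniz_sub]
  rw [Finset.sum_sub_distrib, sum_leibniz hf h1]
  congr 1
  refine Finset.sum_congr rfl fun x hx => ?_
  rw [jet_mul (hf x) (hms x k none)]
  by_cases hy' : y ∈ tsupport (f x)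
  · refine (leibniz_congr _ (fun β => ?_) α).symm
    exact hv.jet_moll hK (hκ x k) (hκc x k) (hK.isOpen.inter Metric.isOpen_ball)
      (fun z hz => (hκK x (htK x hx)).1 k z ⟨subset_closure hz.1, hz.2⟩) ⟨hy, hft x hx hy'⟩ β
  · rw [leibniz_eq_of_notMem_tsupport hy', leibniz_eq_of_notMem_tsupport hy']

end Density

/-! ### Derivatives up to the boundary and the divergence theorems for them. -/

section DirDeriv

variable {K : Set R3}

/-- The closure contains the join of `x` with the ball around `x + a`, a convex set with interior
points. Thus one-sided derivatives on the boundary are unambiguous. -/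
theorem IsConeAt.uniqueDiffWithinAt {x₀ a : R3} {r δ : ℝ} (h : IsConeAt K x₀ r a δ) (hδ : 0 < δ)
    {x : R3} (hx : x ∈ closure K ∩ Metric.ball x₀ r) : UniqueDiffWithinAt ℝ (closure K) x := by
  have hsub : convexJoin ℝ {x} (Metric.ball (x + a) δ) ⊆ closure K := by
    rw [convexJoin_singleton_left]
    refine Set.iUnion₂_subset fun y hy => ?_
    rw [segment_eq_image']
    rintro _ ⟨t, ht, rfl⟩
    rcases ht.1.eq_or_lt with rfl | ht0
    · simpa using hx.1
    · refine subset_closure (h x hx t ⟨ht0, ht.2⟩ (y - x) ?_)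
      rw [Metric.mem_ball, dist_eq_norm] at hy ⊢
      rwa [sub_sub]
  have hball : Metric.ball (x + a) δ ⊆ convexJoin ℝ {x} (Metric.ball (x + a) δ) :=
    subset_convexJoin_right ⟨x, rfl⟩
  have hmem : x ∈ convexJoin ℝ {x} (Metric.ball (x + a) δ) :=
    subset_convexJoin_left ⟨x + a, Metric.mem_ball_self hδ⟩ rfl
  refine (uniqueDiffWithinAt_convex ((convex_singleton x).convexJoin (convex_ball _ _)) ?_
    (subset_closure hmem)).mono hsub
  exact ⟨x + a, mem_interior.2 ⟨_, hball, Metric.isOpen_ball, Metric.mem_ball_self hδ⟩⟩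

theorem IsPolyhedron.uniqueDiffOn (hK : IsPolyhedron K) : UniqueDiffOn ℝ (closure K) := by
  intro x hx
  obtain ⟨r, hr, a, δ, hδ, h⟩ := exists_isConeAt hK.isOpen hK.lipschitz hx
  exact h.uniqueDiffWithinAt hδ ⟨hx, Metric.mem_ball_self hr⟩

variable {f g : R3 → ℝ} {a b : R3} {x : R3}

theorem contDiffOn_dirDeriv (hK : IsPolyhedron K) (hf : ContDiffOn ℝ 2 f (closure K)) (b : R3) :
    ContDiffOn ℝ 1 (dirDeriv K b f) (closure K) :=
  (hf.fderivWithin hK.uniqueDiffOn (by norm_num)).clm_apply contDiffOn_const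

theorem continuousOn_dirDeriv (hK : IsPolyhedron K) (hf : ContDiffOn ℝ 1 f (closure K)) (b : R3) :
    ContinuousOn (dirDeriv K b f) (closure K) :=
  (hf.continuousOn_fderivWithin hK.uniqueDiffOn le_rfl).clm_apply continuousOn_const

theorem dirDeriv_mul (hK : IsPolyhedron K) (hf : ContDiffOn ℝ 1 f (closure K))
    (hg : ContDiffOn ℝ 1 g (closure K)) (hx : x ∈ closure K) :
    dirDeriv K b (fun y => f y * g y) x = dirDeriv K b f x * g x + f x * dirDeriv K b g x := by
  simp only [dirDeriv]
  rw [fderivWithin_fun_mul (hK.uniqueDiffOn x hx) (hf.differentiableOn one_ne_zero x hx)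
    (hg.differentiableOn one_ne_zero x hx)]
  simp
  ring

theorem dirDeriv_sum_mul (hK : IsPolyhedron K) {f : Fin 3 → R3 → ℝ} (c : Fin 3 → ℝ)
    (hf : ∀ i, ContDiffOn ℝ 1 (f i) (closure K)) (hx : x ∈ closure K) :
    dirDeriv K b (fun y => ∑ i, f i y * c i) x = ∑ i, dirDeriv K b (f i) x * c i := by
  simp only [dirDeriv]
  have hd := fun i => (hf i).differentiableOn one_ne_zero x hx
  rw [fderivWithin_fun_sum (hK.uniqueDiffOn x hx) fun i _ => (hd i).mul_const (c i)]
  simp only [sum_apply]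
  refine Finset.sum_congr rfl fun i _ => ?_
  rw [fderivWithin_mul_const (hK.uniqueDiffOn x hx) (hd i)]
  simp [mul_comm]

theorem dirDeriv_of_contDiff (hK : IsPolyhedron K) (hf : ContDiff ℝ ∞ f) (hx : x ∈ closure K) :
    dirDeriv K b f x = fderiv ℝ f x b := by
  rw [dirDeriv, (hf.differentiable (by simp) x).fderivWithin (hK.uniqueDiffOn x hx)]

theorem isC1Upto_of_contDiffOn (hK : IsPolyhedron K) (hf : ContDiffOn ℝ 1 f (closure K)) :
    IsC1Upto K f (fderivWithin ℝ f (closure K)) where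
  continuousOn := hf.continuousOn
  hasFDerivAt x hx := by
    have hx' := subset_closure hx
    exact (hf.differentiableOn one_ne_zero x hx').hasFDerivWithinAt.hasFDerivAt
      (mem_of_superset (hK.isOpen.mem_nhds hx) subset_closure)
  continuousOn_deriv :=
    (hf.continuousOn_fderivWithin hK.uniqueDiffOn le_rfl).mono subset_closure
  bounded := by
    obtain ⟨M, hM⟩ := hK.isBounded.isCompact_closure.exists_bound_of_continuousOn
      (hf.continuousOn_fderivWithin hK.uniqueDiffOn le_rfl)
    exact ⟨M, fun x hx => hM x (subset_closure hx)⟩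

theorem IsPolyhedron.integral_dirDeriv (hK : IsPolyhedron K)
    (hf : ContDiffOn ℝ 1 f (closure K)) (a : R3) :
    ∫ x in K, dirDeriv K a f x = ∑ᶠ F : Face K, inner ℝ F.normal a * ∫ x, f x ∂F.area :=
  hK.integral_deriv (isC1Upto_of_contDiffOn hK hf) a

theorem Face.carrier_subset_closure (F : Face K) : F.carrier ⊆ closure K :=
  F.carrier_subset_frontier.trans frontier_subset_closure

theorem Face.integral_dirDeriv (hK : IsPolyhedron K) (F : Face K)
    (hf : ContDiffOn ℝ 1 f (closure K)) (ha : inner ℝ F.normal a = 0) :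
    ∫ x, dirDeriv K a f x ∂F.area =
      ∑ᶠ E : Edge F, inner ℝ E.conormal a * ∫ x, f x ∂E.length := by
  have hsub := F.carrier_subset_closure
  have hc := hf.continuousOn_fderivWithin hK.uniqueDiffOn le_rfl
  obtain ⟨M, hM⟩ := hK.isBounded.isCompact_closure.exists_bound_of_continuousOn hc
  exact F.integral_deriv hK (hf.continuousOn.mono (closure_minimal hsub isClosed_closure))
    (fun x hx => (hf.differentiableOn one_ne_zero x (hsub hx)).hasFDerivWithinAt)
    (hc.mono hsub) (fun x hx => hM x (hsub hx)) ha

end DirDeriv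

/-! ### Integrability and convergence of pairings with continuous functions. -/

section Integrable

variable {K : Set R3} {μ : Measure R3} [IsFiniteMeasure μ]

theorem memLp_of_continuousOn_closure (hK : IsPolyhedron K) (hμ : ∀ᵐ x ∂μ, x ∈ closure K)
    {f : R3 → ℝ} (hf : ContinuousOn f (closure K)) (p : ℝ≥0∞) : MemLp f p μ := by
  obtain ⟨C, hC⟩ := hK.isBounded.isCompact_closure.exists_bound_of_continuousOn hf
  refine MemLp.of_bound ?_ C (hμ.mono hC)
  have h := hf.aestronglyMeasurable (μ := μ) isClosed_closure.measurableSet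
  rwa [Measure.restrict_eq_self_of_ae_mem hμ] at h

theorem integrable_of_continuousOn_closure (hK : IsPolyhedron K) (hμ : ∀ᵐ x ∂μ, x ∈ closure K)
    {f : R3 → ℝ} (hf : ContinuousOn f (closure K)) : Integrable f μ :=
  memLp_one_iff_integrable.1 (memLp_of_continuousOn_closure hK hμ hf 1)

theorem tendsto_integral_mul (hK : IsPolyhedron K) (hμ : ∀ᵐ x ∂μ, x ∈ closure K)
    {f : R3 → ℝ} (hf : ContinuousOn f (closure K)) {g : ℕ → R3 → ℝ} {g₀ : R3 → ℝ}
    (hg : ∀ k, MemLp (g k) 2 μ) (hg₀ : MemLp g₀ 2 μ)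
    (h : Tendsto (fun k => eLpNorm (fun x => g k x - g₀ x) 2 μ) atTop (𝓝 0)) :
    Tendsto (fun k => ∫ x, f x * g k x ∂μ) atTop (𝓝 (∫ x, f x * g₀ x ∂μ)) := by
  have hf2 := memLp_of_continuousOn_closure hK hμ hf 2
  refine tendsto_integral_of_L1 _ (hf2.integrable_mul hg₀).aestronglyMeasurable
    (Eventually.of_forall fun k => hf2.integrable_mul (hg k)) ?_
  have h1 : Tendsto (fun k => eLpNorm f 2 μ * eLpNorm (fun x => g k x - g₀ x) 2 μ) atTop
      (𝓝 (eLpNorm f 2 μ * 0)) := ENNReal.Tendsto.const_mul h (Or.inr hf2.2.ne)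
  rw [mul_zero] at h1
  refine tendsto_of_tendsto_of_tendsto_of_le_of_le tendsto_const_nhds h1 (fun _ => zero_le)
    fun k => ?_
  have h2 := eLpNorm_smul_le_mul_eLpNorm (p := 2) (q := 2) (r := 1) ((hg k).sub hg₀).1 hf2.1
  rw [eLpNorm_one_eq_lintegral_enorm] at h2
  refine le_trans (le_of_eq ?_) h2
  refine lintegral_congr fun x => ?_
  simp [mul_sub]

end Integrable

section Supports

variable {K : Set R3}

theorem IsPolyhedron.isFiniteMeasure_restrict (hK : IsPolyhedron K) :
    IsFiniteMeasure (volume.restrict K : Measure R3) :=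
  _root_.MeasureTheory.isFiniteMeasure_restrict.2 hK.isBounded.measure_lt_top.ne

theorem IsPolyhedron.ae_mem_closure (hK : IsPolyhedron K) :
    ∀ᵐ x ∂(volume.restrict K : Measure R3), x ∈ closure K :=
  ae_restrict_of_forall_mem hK.isOpen.measurableSet fun _ hx => subset_closure hx

theorem Face.ae_mem_closure (hK : IsPolyhedron K) (F : Face K) : ∀ᵐ x ∂F.area, x ∈ closure K :=
  ae_restrict_of_forall_mem (F.measurableSet_carrier hK) fun _ hx => F.carrier_subset_closure hx

theorem Edge.ae_mem_closure (hK : IsPolyhedron K) {F : Face K} (e : Edge F) :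
    ∀ᵐ x ∂e.length, x ∈ closure K :=
  ae_restrict_of_forall_mem (e.carrier_properties hK).2.1 fun _ hx => e.carrier_subset_closure hK hx

end Supports

/-! ### Green's identity for smooth functions. -/

section Green

variable {K : Set R3} {τ : R3 → Matrix (Fin 3) (Fin 3) ℝ} {φ : R3 → ℝ}

theorem inner_basisVec (a : R3) (i : Fin 3) : inner ℝ a (basisVec i) = a i := by
  simp [basisVec, EuclideanSpace.inner_single_right]

theorem bilin_eq_sum (A : Matrix (Fin 3) (Fin 3) ℝ) (a b : R3) :
    bilin A a b = ∑ i, a i * A.mulVec b i := by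
  simp only [bilin, Matrix.mulVec, dotProduct, Finset.mul_sum, mul_assoc]

namespace IsC2Sym

variable (hτ : IsC2Sym K τ)
include hτ

theorem contDiffOn_one (i j : Fin 3) : ContDiffOn ℝ 1 (fun x => τ x i j) (closure K) :=
  (hτ.contDiffOn i j).of_le (by norm_num)

theorem contDiffOn_mulVec (n : R3) (i : Fin 3) :
    ContDiffOn ℝ 1 (fun x => (τ x).mulVec n i) (closure K) := by
  simp only [Matrix.mulVec, dotProduct]
  exact ContDiffOn.sum fun j _ => (hτ.contDiffOn_one i j).mul contDiffOn_const

theorem contDiffOn_bilin (a b : R3) :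
    ContDiffOn ℝ 1 (fun x => bilin (τ x) a b) (closure K) := by
  simp only [bilin_eq_sum]
  exact ContDiffOn.sum fun i _ => contDiffOn_const.mul (hτ.contDiffOn_mulVec b i)

theorem dirDeriv_mulVec (hK : IsPolyhedron K) (n b : R3) (i : Fin 3) {x : R3}
    (hx : x ∈ closure K) : dirDeriv K b (fun y => (τ y).mulVec n i) x =
      ∑ j, dirDeriv K b (fun y => τ y i j) x * n j :=
  dirDeriv_sum_mul hK _ (hτ.contDiffOn_one i) hx

theorem dirDeriv_bilin (hK : IsPolyhedron K) (n b : R3) {x : R3}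
    (hx : x ∈ closure K) : dirDeriv K b (fun y => bilin (τ y) n n) x =
      ∑ i, (∑ j, dirDeriv K b (fun y => τ y i j) x * n j) * n i := by
  simp only [bilin_eq_sum, mul_comm (n _)]
  rw [dirDeriv_sum_mul hK _ (hτ.contDiffOn_mulVec n) hx]
  simp only [hτ.dirDeriv_mulVec hK n b _ hx]

theorem dirDeriv_symm (b : R3) (i j : Fin 3) {x : R3} (hx : x ∈ closure K) :
    dirDeriv K b (fun y => τ y i j) x = dirDeriv K b (fun y => τ y j i) x := by
  simp only [dirDeriv]
  rw [fderivWithin_congr (fun y hy => ((hτ.symm y hy).apply i j).symm)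
    ((hτ.symm x hx).apply i j).symm]

theorem continuousOn_divDiv (hK : IsPolyhedron K) : ContinuousOn (divDiv K τ) (closure K) := by
  refine continuousOn_finsetSum _ fun i _ => continuousOn_finsetSum _ fun j _ => ?_
  exact continuousOn_dirDeriv hK (contDiffOn_dirDeriv hK (hτ.contDiffOn i j) _) _

theorem continuousOn_faceCoeff (hK : IsPolyhedron K) (n : R3) :
    ContinuousOn (fun x => 2 * surfDiv K n (fun y => (τ y).mulVec n) x +
      dirDeriv K n (fun y => bilin (τ y) n n) x) (closure K) := by
  refine ContinuousOn.add (continuousOn_const.mul (continuousOn_finsetSum _ fun i _ => ?_))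
    (continuousOn_dirDeriv hK (hτ.contDiffOn_bilin n n) n)
  exact continuousOn_dirDeriv hK (hτ.contDiffOn_mulVec n i) _

end IsC2Sym

/-- The integrand on a face with normal `n` after integrating by parts twice. -/
noncomputable def faceFlux (K : Set R3) (τ : R3 → Matrix (Fin 3) (Fin 3) ℝ) (φ : R3 → ℝ) (n : R3)
    (x : R3) : ℝ :=
  ∑ i, ∑ j, (n i * (dirDeriv K (basisVec j) (fun y => τ y i j) x * φ x) -
    n j * (τ x i j * fderiv ℝ φ x (basisVec i)))

/-- The flux is `(n · div τ) φ - (τn) · ∇φ`. Symmetry rewrites `n · div τ` as `div_F(τn) +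
∂ₙ(nᵀτn)`. The tangential part of `(τn) · ∇φ` is `div_F(φ τn) - φ div_F(τn)`, which supplies the
second copy of `div_F(τn)`. -/
theorem faceFlux_eq (hK : IsPolyhedron K) (hτ : IsC2Sym K τ) (hφ : ContDiff ℝ ∞ φ) (n : R3)
    {x : R3} (hx : x ∈ closure K) : faceFlux K τ φ n x =
      (2 * surfDiv K n (fun y => (τ y).mulVec n) x +
        dirDeriv K n (fun y => bilin (τ y) n n) x) * φ x -
      bilin (τ x) n n * normalDerivOp n φ x -
      ∑ i, dirDeriv K (basisVec i - n i • n) (fun y => (τ y).mulVec n i * φ y) x := by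
  have hφ1 : ContDiffOn ℝ 1 φ (closure K) := (hφ.of_le (by simp)).contDiffOn
  have e1 : ∀ i, dirDeriv K (basisVec i - n i • n) (fun y => (τ y).mulVec n i * φ y) x =
      dirDeriv K (basisVec i - n i • n) (fun y => (τ y).mulVec n i) x * φ x +
        (τ x).mulVec n i * (fderiv ℝ φ x (basisVec i) - n i * fderiv ℝ φ x n) := fun i => by
    rw [dirDeriv_mul hK (hτ.contDiffOn_mulVec n i) hφ1 hx, dirDeriv_of_contDiff hK hφ hx]
    simp
  have e2 : ∀ i, dirDeriv K (basisVec i - n i • n) (fun y => (τ y).mulVec n i) x =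
      ∑ j, (dirDeriv K (basisVec i) (fun y => τ y i j) x -
        n i * dirDeriv K n (fun y => τ y i j) x) * n j := fun i => by
    rw [hτ.dirDeriv_mulVec hK n _ i hx]
    simp [dirDeriv]
  -- Only here is the symmetry of `τ` needed: it turns `nᵢ ∂ⱼτᵢⱼ` into `nⱼ ∂ᵢτᵢⱼ`, that is `n · div
  -- τ` into `div(τn)`.
  have e3 : ∑ i, ∑ j, n i * (dirDeriv K (basisVec j) (fun y => τ y i j) x * φ x) =
      ∑ i, ∑ j, n j * (dirDeriv K (basisVec i) (fun y => τ y i j) x * φ x) := by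
    rw [Finset.sum_comm]
    refine Finset.sum_congr rfl fun i _ => Finset.sum_congr rfl fun j _ => ?_
    rw [hτ.dirDeriv_symm _ _ _ hx]
  simp only [faceFlux, Finset.sum_sub_distrib]
  rw [e3]
  simp only [e1, surfDiv, e2, hτ.dirDeriv_bilin hK n n hx, normalDerivOp]
  simp only [bilin, Matrix.mulVec, dotProduct, Fin.sum_univ_three]
  ring

/-- The tangential divergence integrates to the edges: the directions `basisVec i - n i • n` are
parallel to the face, and a conormal pairs with them to its `i`-th coordinate, so the sum over `i`
is the bilinear form of conormal and normal. -/
theorem Face.integral_faceFlux (hK : IsPolyhedron K) (F : Face K) (hτ : IsC2Sym K τ)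
    (hφ : ContDiff ℝ ∞ φ) : ∫ x, faceFlux K τ φ F.normal x ∂F.area =
      -(∑ᶠ e : Edge F, ∫ x, bilin (τ x) e.conormal F.normal * φ x ∂e.length) -
      ((∫ x, bilin (τ x) F.normal F.normal * normalDerivOp F.normal φ x ∂F.area) -
        ∫ x, (2 * surfDiv K F.normal (fun y => (τ y).mulVec F.normal) x +
          dirDeriv K F.normal (fun y => bilin (τ y) F.normal F.normal) x) * φ x ∂F.area) := by
  set n := F.normal with hn
  have := F.isFiniteMeasure_area hK
  have hF := F.ae_mem_closure hK
  have hφ1 : ContDiffOn ℝ 1 φ (closure K) := (hφ.of_le (by simp)).contDiffOn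
  have hw : ∀ i, ContDiffOn ℝ 1 (fun y => (τ y).mulVec n i * φ y) (closure K) := fun i =>
    (hτ.contDiffOn_mulVec n i).mul hφ1
  have hd : ∀ i, ContinuousOn (dirDeriv K (basisVec i - n i • n)
      (fun y => (τ y).mulVec n i * φ y)) (closure K) := fun i => continuousOn_dirDeriv hK (hw i) _
  have hB : ContinuousOn (fun x => bilin (τ x) n n * normalDerivOp n φ x) (closure K) :=
    (hτ.contDiffOn_bilin n n).continuousOn.mul (contDiff_partial hφ n).continuous.continuousOn
  have hC : ContinuousOn (fun x => (2 * surfDiv K n (fun y => (τ y).mulVec n) x +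
      dirDeriv K n (fun y => bilin (τ y) n n) x) * φ x) (closure K) :=
    (hτ.continuousOn_faceCoeff hK n).mul hφ.continuous.continuousOn
  have hi := fun {f : R3 → ℝ} (hf : ContinuousOn f (closure K)) =>
    integrable_of_continuousOn_closure hK hF hf
  rw [integral_congr_ae (hF.mono fun x hx => faceFlux_eq hK hτ hφ n hx), integral_sub
    (by exact (hi hC).sub (hi hB)) (integrable_finsetSum _ fun i _ => hi (hd i)),
    integral_sub (hi hC) (hi hB), integral_finsetSum _ fun i _ => hi (hd i)]
  have hedge : ∑ i, ∫ x, dirDeriv K (basisVec i - n i • n)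
      (fun y => (τ y).mulVec n i * φ y) x ∂F.area =
      ∑ᶠ e : Edge F, ∫ x, bilin (τ x) e.conormal n * φ x ∂e.length := by
    have := hK.finite_edge F
    have := Fintype.ofFinite (Edge F)
    rw [finsum_eq_sum_of_fintype]
    have hz : ∀ i, inner ℝ n (basisVec i - n i • n) = 0 := fun i => by
      rw [inner_sub_right, inner_basisVec, inner_smul_right, real_inner_self_eq_norm_sq, hn,
        F.norm_normal]
      simp
    simp_rw [fun i => F.integral_dirDeriv hK (hw i) (hz i), finsum_eq_sum_of_fintype]
    rw [Finset.sum_comm]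
    refine Finset.sum_congr rfl fun e _ => ?_
    have := e.isFiniteMeasure_length hK
    have hm : ∀ i, inner ℝ e.conormal (basisVec i - n i • n) = e.conormal i := fun i => by
      rw [inner_sub_right, inner_basisVec, inner_smul_right, real_inner_comm, e.parallel]
      simp
    simp_rw [hm, ← integral_const_mul]
    rw [← integral_finsetSum]
    · simp only [bilin_eq_sum, Finset.sum_mul, mul_assoc]
    · exact fun i _ => (integrable_of_continuousOn_closure hK (e.ae_mem_closure hK)
        (hw i).continuousOn).const_mul _
  rw [hedge]
  ring

/-- Green's identity for smooth functions. -/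
theorem green_of_contDiff (hK : IsPolyhedron K) (hτ : IsC2Sym K τ) (hφ : ContDiff ℝ ∞ φ) :
    ∫ x in K, divDiv K τ x * φ x =
      (∫ x in K, ∑ i, ∑ j, τ x i j * jet (some (i, some j)) φ x) +
        ∑ᶠ F : Face K, ∫ x, faceFlux K τ φ F.normal x ∂F.area := by
  have := hK.isFiniteMeasure_restrict
  have hKae := hK.ae_mem_closure
  have hφ1 : ContDiffOn ℝ 1 φ (closure K) := (hφ.of_le (by simp)).contDiffOn
  have hdφ1 : ∀ i, ContDiffOn ℝ 1 (fun x => fderiv ℝ φ x (basisVec i)) (closure K) := fun i =>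
    ((contDiff_partial hφ _).of_le (by simp)).contDiffOn
  have hw : ∀ i j, ContDiffOn ℝ 1 (fun x => dirDeriv K (basisVec j) (fun y => τ y i j) x * φ x)
      (closure K) := fun i j => (contDiffOn_dirDeriv hK (hτ.contDiffOn i j) _).mul hφ1
  have hw' : ∀ i j, ContDiffOn ℝ 1 (fun x => τ x i j * fderiv ℝ φ x (basisVec i)) (closure K) :=
    fun i j => (hτ.contDiffOn_one i j).mul (hdφ1 i)
  have hi := fun {f : R3 → ℝ} (hf : ContinuousOn f (closure K)) =>
    integrable_of_continuousOn_closure hK hKae hf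
  have hd := fun i j => continuousOn_dirDeriv hK (hw i j) (basisVec i)
  have hd' := fun i j => continuousOn_dirDeriv hK (hw' i j) (basisVec j)
  -- Both integrations by parts in one pointwise identity: the terms `∂ⱼτᵢⱼ ∂ᵢφ` of the two product
  -- rules cancel.
  have hpt : ∀ x ∈ closure K, divDiv K τ x * φ x =
      (∑ i, ∑ j, τ x i j * jet (some (i, some j)) φ x) + ∑ i, ∑ j,
        (dirDeriv K (basisVec i) (fun x => dirDeriv K (basisVec j) (fun y => τ y i j) x * φ x) x -
        dirDeriv K (basisVec j) (fun x => τ x i j * fderiv ℝ φ x (basisVec i)) x) := by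
    intro x hx
    rw [divDiv]
    simp only [Finset.sum_mul, ← Finset.sum_add_distrib]
    refine Finset.sum_congr rfl fun i _ => Finset.sum_congr rfl fun j _ => ?_
    rw [dirDeriv_mul hK (contDiffOn_dirDeriv hK (hτ.contDiffOn i j) _) hφ1 hx,
      dirDeriv_mul hK (hτ.contDiffOn_one i j) (hdφ1 i) hx, dirDeriv_of_contDiff hK hφ hx,
      dirDeriv_of_contDiff hK (contDiff_partial hφ _) hx]
    simp only [jet]
    ring
  have hT : ContinuousOn (fun x => ∑ i, ∑ j, τ x i j * jet (some (i, some j)) φ x) (closure K) :=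
    continuousOn_finsetSum _ fun i _ => continuousOn_finsetSum _ fun j _ =>
      (hτ.contDiffOn_one i j).continuousOn.mul (contDiff_jet hφ _).continuous.continuousOn
  have hij : ∀ i j, Integrable (fun x =>
      dirDeriv K (basisVec i) (fun x => dirDeriv K (basisVec j) (fun y => τ y i j) x * φ x) x -
      dirDeriv K (basisVec j) (fun x => τ x i j * fderiv ℝ φ x (basisVec i)) x)
      (volume.restrict K) := fun i j => (hi (hd i j)).sub (hi (hd' i j))
  rw [integral_congr_ae (hKae.mono hpt), integral_add (hi hT)
    (integrable_finsetSum _ fun i _ => integrable_finsetSum _ fun j _ => hij i j)]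
  congr 1
  rw [integral_finsetSum _ fun i _ => integrable_finsetSum _ fun j _ => hij i j]
  simp_rw [fun i => integral_finsetSum Finset.univ fun j _ => hij i j,
    fun i j => integral_sub (hi (hd i j)) (hi (hd' i j)),
    fun i j => hK.integral_dirDeriv (hw i j) (basisVec i),
    fun i j => hK.integral_dirDeriv (hw' i j) (basisVec j)]
  have := hK.finite_face
  have := Fintype.ofFinite (Face K)
  simp_rw [finsum_eq_sum_of_fintype, ← Finset.sum_sub_distrib]
  rw [Finset.sum_congr rfl fun i _ => Finset.sum_comm, Finset.sum_comm]
  refine Finset.sum_congr rfl fun F _ => ?_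
  have := F.isFiniteMeasure_area hK
  have hF := fun {f : R3 → ℝ} (hf : ContinuousOn f (closure K)) =>
    integrable_of_continuousOn_closure hK (F.ae_mem_closure hK) hf
  have hFij : ∀ i j, Integrable (fun x =>
      F.normal i * (dirDeriv K (basisVec j) (fun y => τ y i j) x * φ x) -
      F.normal j * (τ x i j * fderiv ℝ φ x (basisVec i))) F.area := fun i j =>
    ((hF (hw i j).continuousOn).const_mul _).sub ((hF (hw' i j).continuousOn).const_mul _)
  simp only [faceFlux]
  rw [integral_finsetSum _ fun i _ => integrable_finsetSum _ fun j _ => hFij i j]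
  refine Finset.sum_congr rfl fun i _ => ?_
  rw [integral_finsetSum _ fun j _ => hFij i j]
  refine Finset.sum_congr rfl fun j _ => ?_
  rw [integral_sub ((hF (hw i j).continuousOn).const_mul _)
    ((hF (hw' i j).continuousOn).const_mul _), integral_const_mul, integral_const_mul,
    inner_basisVec, inner_basisVec]

end Green

/-! ### Passage to the limit in the individual terms. -/

section Limit

variable {K : Set R3} {τ : R3 → Matrix (Fin 3) (Fin 3) ℝ} {v : R3 → ℝ} {G : Fin 3 → R3 → ℝ}
  {H : Fin 3 → Fin 3 → R3 → ℝ} {φ : ℕ → R3 → ℝ}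

theorem IsTrace.tendsto_integral_mul {μ : Measure R3} [IsFiniteMeasure μ]
    {B : (R3 → ℝ) → R3 → ℝ} {g : R3 → ℝ} (hg : IsTrace K v G H μ B g) (hB : IsBoundedOp K μ B)
    (hK : IsPolyhedron K) (hv : IsH2 K v G H) (hφ : ∀ k, ContDiff ℝ ∞ (φ k))
    (hφv : TendstoH2 K φ v G H) (hμ : ∀ᵐ x ∂μ, x ∈ closure K) {f : R3 → ℝ}
    (hf : ContinuousOn f (closure K)) :
    Tendsto (fun k => ∫ x, f x * B (φ k) x ∂μ) atTop (𝓝 (∫ x, f x * g x ∂μ)) :=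
  DivDivGreen.tendsto_integral_mul hK hμ hf (fun k => hB.memLp hK (hφ k)) hg.1
    (hg.tendsto hB hv hφ hφv)

theorem TendstoH2.tendsto_integral_mul (hK : IsPolyhedron K) (hv : IsH2 K v G H)
    (hφ : ∀ k, ContDiff ℝ ∞ (φ k)) (hφv : TendstoH2 K φ v G H) (α) {f : R3 → ℝ}
    (hf : ContinuousOn f (closure K)) :
    Tendsto (fun k => ∫ x in K, f x * jet α (φ k) x) atTop
      (𝓝 (∫ x in K, f x * weakJet v G H α x)) := by
  have := hK.isFiniteMeasure_restrict
  exact DivDivGreen.tendsto_integral_mul hK hK.ae_mem_closure hf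
    (fun k => memLp_of_continuousOn_closure hK hK.ae_mem_closure
      (contDiff_jet (hφ k) α).continuous.continuousOn 2)
    (hv.memLp_weakJet α) (tendstoH2_iff.1 hφv α)

theorem TendstoH2.tendsto_integral_hessian (hK : IsPolyhedron K) (hτ : IsC2Sym K τ)
    (hv : IsH2 K v G H) (hφ : ∀ k, ContDiff ℝ ∞ (φ k)) (hφv : TendstoH2 K φ v G H) :
    Tendsto (fun k => ∫ x in K, ∑ i, ∑ j, τ x i j * jet (some (i, some j)) (φ k) x) atTop
      (𝓝 (∫ x in K, ∑ i, ∑ j, τ x i j * H i j x)) := by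
  have := hK.isFiniteMeasure_restrict
  have hc := fun i j => (hτ.contDiffOn_one i j).continuousOn
  have hsum : ∀ u : Fin 3 → Fin 3 → R3 → ℝ, (∀ i j, MemLp (u i j) 2 (volume.restrict K)) →
      ∫ x in K, ∑ i, ∑ j, τ x i j * u i j x = ∑ i, ∑ j, ∫ x in K, τ x i j * u i j x := by
    intro u hu
    have hi : ∀ i j, Integrable (fun x => τ x i j * u i j x) (volume.restrict K) := fun i j =>
      (memLp_of_continuousOn_closure hK hK.ae_mem_closure (hc i j) 2).integrable_mul (hu i j)
    rw [integral_finsetSum _ fun i _ => integrable_finsetSum _ fun j _ => hi i j]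
    exact Finset.sum_congr rfl fun i _ => integral_finsetSum _ fun j _ => hi i j
  rw [hsum H hv.hess_memLp]
  simp_rw [fun k => hsum (fun i j => jet (some (i, some j)) (φ k)) fun i j =>
    memLp_of_continuousOn_closure hK hK.ae_mem_closure
      (contDiff_jet (hφ k) _).continuous.continuousOn 2]
  exact tendsto_finsetSum _ fun i _ => tendsto_finsetSum _ fun j _ =>
    hφv.tendsto_integral_mul hK hv hφ (some (i, some j)) (hc i j)

theorem tendsto_finsum {ι : Type*} [Finite ι] {u : ι → ℕ → ℝ} {l : ι → ℝ}
    (h : ∀ i, Tendsto (u i) atTop (𝓝 (l i))) :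
    Tendsto (fun k => ∑ᶠ i, u i k) atTop (𝓝 (∑ᶠ i, l i)) := by
  have := Fintype.ofFinite ι
  simp_rw [finsum_eq_sum_of_fintype]
  exact tendsto_finsetSum _ fun i _ => h i

end Limit

end DivDivGreen

/-! ### Green's identity for `H²` functions. -/

theorem mainTheorem9 (K : Set DivDivGreen.R3) (hK : DivDivGreen.IsPolyhedron K)
    (τ : DivDivGreen.R3 → Matrix (Fin 3) (Fin 3) ℝ) (hτ : DivDivGreen.IsC2Sym K τ)
    (v : DivDivGreen.R3 → ℝ) (G : Fin 3 → DivDivGreen.R3 → ℝ)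
    (H : Fin 3 → Fin 3 → DivDivGreen.R3 → ℝ) (hv : DivDivGreen.IsH2 K v G H) :
    -- there are finitely many faces and edges
    (Finite (DivDivGreen.Face K) ∧ ∀ F : DivDivGreen.Face K, Finite (DivDivGreen.Edge F)) ∧
    -- the traces of `v` and `∂ₙ v` on the faces and of `v` on the edges exist
    (∀ F : DivDivGreen.Face K,
      (∃ g, DivDivGreen.IsTrace K v G H F.area DivDivGreen.valueOp g) ∧
      (∃ g, DivDivGreen.IsTrace K v G H F.area (DivDivGreen.normalDerivOp F.normal) g) ∧
      ∀ e : DivDivGreen.Edge F,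
        ∃ g, DivDivGreen.IsTrace K v G H e.length DivDivGreen.valueOp g) ∧
    -- and Green's identity holds for them
    ∀ (vF dnv : DivDivGreen.Face K → DivDivGreen.R3 → ℝ)
      (ve : (F : DivDivGreen.Face K) → DivDivGreen.Edge F → DivDivGreen.R3 → ℝ),
      (∀ F, DivDivGreen.IsTrace K v G H F.area DivDivGreen.valueOp (vF F)) →
      (∀ F, DivDivGreen.IsTrace K v G H F.area
        (DivDivGreen.normalDerivOp F.normal) (dnv F)) →
      (∀ F e, DivDivGreen.IsTrace K v G H e.length DivDivGreen.valueOp (ve F e)) →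
      ∫ x in K, DivDivGreen.divDiv K τ x * v x =
        (∫ x in K, ∑ i, ∑ j, τ x i j * H i j x)
        - (∑ᶠ F : DivDivGreen.Face K, ∑ᶠ e : DivDivGreen.Edge F,
            ∫ x, DivDivGreen.bilin (τ x) e.conormal F.normal * ve F e x ∂e.length)
        - ∑ᶠ F : DivDivGreen.Face K,
            ((∫ x, DivDivGreen.bilin (τ x) F.normal F.normal * dnv F x ∂F.area)
              - ∫ x, (2 * DivDivGreen.surfDiv K F.normal
                      (fun y => Matrix.mulVec (τ y) F.normal) x
                    + DivDivGreen.dirDeriv K F.normal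
                      (fun y => DivDivGreen.bilin (τ y) F.normal F.normal) x) * vF F x
                  ∂F.area) := by
  obtain ⟨φ, hφ, hφv⟩ := hv.exists_tendstoH2 hK
  have hface := hK.finite_face
  have hedge := hK.finite_edge
  have hFfin := fun F : DivDivGreen.Face K => F.isFiniteMeasure_area hK
  have hefin := fun (F : DivDivGreen.Face K) (e : DivDivGreen.Edge F) => e.isFiniteMeasure_length hK
  have hBF := fun F : DivDivGreen.Face K => F.isBoundedOp_valueOp hK
  have hBn := fun F : DivDivGreen.Face K => F.isBoundedOp_normalDerivOp hK
  have hBe := fun (F : DivDivGreen.Face K) (e : DivDivGreen.Edge F) => e.isBoundedOp_valueOp hK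
  refine ⟨⟨hface, hedge⟩, fun F => ⟨(hBF F).exists_isTrace hK hv hφ hφv,
    (hBn F).exists_isTrace hK hv hφ hφv, fun e => (hBe F e).exists_isTrace hK hv hφ hφv⟩,
    fun vF dnv ve hvF hdnv hve => ?_⟩
  -- Each term pairs a coefficient that is continuous on `closure K` with a quantity converging in
  -- `L²` along the same sequence `φ`, so the smooth identity passes to the limit, which is unique.
  have hL := hφv.tendsto_integral_mul hK hv hφ none (hτ.continuousOn_divDiv hK)
  have hR := hφv.tendsto_integral_hessian hK hτ hv hφ
  have hE := fun (F : DivDivGreen.Face K) (e : DivDivGreen.Edge F) =>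
    (hve F e).tendsto_integral_mul (hBe F e) hK hv hφ hφv (e.ae_mem_closure hK)
      (hτ.contDiffOn_bilin e.conormal F.normal).continuousOn
  have hN := fun F : DivDivGreen.Face K =>
    (hdnv F).tendsto_integral_mul (hBn F) hK hv hφ hφv (F.ae_mem_closure hK)
      (hτ.contDiffOn_bilin F.normal F.normal).continuousOn
  have hV := fun F : DivDivGreen.Face K =>
    (hvF F).tendsto_integral_mul (hBF F) hK hv hφ hφv (F.ae_mem_closure hK)
      (hτ.continuousOn_faceCoeff hK F.normal)
  have hlim := hR.add (DivDivGreen.tendsto_finsum fun F : DivDivGreen.Face K =>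
    (DivDivGreen.tendsto_finsum (hE F)).neg.sub ((hN F).sub (hV F)))
  refine (tendsto_nhds_unique hL (hlim.congr fun k => ?_)).trans ?_
  · refine Eq.trans ?_ (DivDivGreen.green_of_contDiff hK hτ (hφ k)).symm
    congr 1
    exact finsum_congr fun F => (F.integral_faceFlux hK hτ (hφ k)).symm
  · rw [finsum_sub_distrib (Set.toFinite _) (Set.toFinite _), finsum_neg_distrib]
    ring
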